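/- Let $\mathbf M$ be a nonempty compact (boundaryless, smooth) Riemannian manifold of dimension $n$, with Riemannian distance, open metric balls $B(x,r)$ and Riemannian measure $dx$. A set $M_\rho\subset\mathbf M$ is called a metric $\rho$-lattice (with multiplicity bound $N\in\mathbb N$) if the balls $B(y,\rho/4)$, $y\in M_\rho$, are pairwise disjoint, the balls $B(y,\rho/2)$, $y\in M_\rho$, cover $\mathbf M$, and each point of $\mathbf M$ lies in at most $N$ of the balls $B(y,\rho)$, $y\in M_\rho$. **Theorem.** Let $c_0>0$ and $\omega_0>0$. 1. There are constants $a_1,a_2>0$, depending only on $\mathbf M$, $c_0$ and $\omega_0$, such that for every $\omega\ge\omega_0$ and every metric $\rho$-lattice $M_\rho$ with $\rho=c_0\omega^{-1/2}$ (with any multiplicity bound $N$) the set $M_\rho$ is finite and $$a_1\,\omega^{n/2}\le |M_\rho|\le a_2\,\omega^{n/2}.$$ 2. Consequently the number of nodes is essentially optimal: let $\mathcal L$ be an elliptic second-order differential operator with smooth real coefficients on $\mathbf M$ which is self-adjoint in the real space $L_2(\mathbf M,dx)$ (as the closure of its restriction to $C^\infty(\mathbf M)$), nonnegative, and has $0$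 as an eigenvalue, and let $\mathbf E_\omega(\mathcal L)$ be the span of all eigenfunctions of $\mathcal L$ with eigenvalue at most $\omega$. Then there are constants $b_1,b_2>0$, depending only on $\mathbf M$, $\mathcal L$, $c_0$ and $\omega_0$, such that for all $\omega\ge\omega_0$ and all such lattices $\mathbf E_\omega(\mathcal L)$ is finite-dimensional and $$b_1\,\dim\mathbf E_\omega(\mathcal L)\le |M_\rho|\le b_2\,\dim\mathbf E_\omega(\mathcal L).$$ -/

import Mathlib

open Bundle Manifold MeasureTheory Set
open scoped ContDiff ENNReal Topology

/-- A metric `ρ`-lattice with multiplicity bound `N`: the balls of radius `ρ / 4` centred at the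
points of `S` are pairwise disjoint, the balls of radius `ρ / 2` cover the space, and every point
lies in at most `N` of the balls of radius `ρ`. -/
structure IsMetricLattice {M : Type*} [EMetricSpace M] (N : ℕ) (ρ : ℝ) (S : Set M) : Prop where
  disjoint_balls :
    S.PairwiseDisjoint (fun y => Metric.eball y (ENNReal.ofReal (ρ / 4)))
  cover : (⋃ y ∈ S, Metric.eball y (ENNReal.ofReal (ρ / 2))) = univ
  multiplicity :
    ∀ x : M, {y | y ∈ S ∧ x ∈ Metric.eball y (ENNReal.ofReal ρ)}.encard ≤ (N : ℕ∞)

noncomputable section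

section SmoothOperators

variable {n : ℕ} {M : Type*} [TopologicalSpace M] [ChartedSpace (EuclideanSpace ℝ (Fin n)) M]

/-- The commutator `[P, f]` of a linear operator on smooth functions with multiplication
by `f`, that is `u ↦ P (f u) - f P u`. -/
def mulCommutator (P : C^∞⟮𝓡 n, M; ℝ⟯ →ₗ[ℝ] C^∞⟮𝓡 n, M; ℝ⟯) (f : C^∞⟮𝓡 n, M; ℝ⟯) :
    C^∞⟮𝓡 n, M; ℝ⟯ →ₗ[ℝ] C^∞⟮𝓡 n, M; ℝ⟯ :=
  P ∘ₗ LinearMap.mulLeft ℝ f - LinearMap.mulLeft ℝ f ∘ₗ P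

/-- Linear differential operators of order at most `k` with smooth real coefficients, in the
coordinate-free description: order at most `0` means to commute with all multiplications, and
order at most `k + 1` means that all commutators with multiplications have order at most `k`. -/
def IsDiffOp : ℕ → (C^∞⟮𝓡 n, M; ℝ⟯ →ₗ[ℝ] C^∞⟮𝓡 n, M; ℝ⟯) → Prop
  | 0, P => ∀ f, mulCommutator P f = 0
  | k + 1, P => ∀ f, IsDiffOp k (mulCommutator P f)

/-- Second-order elliptic differential operators. For an operator of order at most two which is
`∑ a i j ∂ i ∂ j + (lower order)` in a chart, with `a` symmetric, the function `[[P, f], f] 1`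
equals `2 * ∑ a i j (∂ i f) (∂ j f)`, so ellipticity (the principal symbol does not vanish on
nonzero covectors) says that it is nonzero at each point where `df ≠ 0`. -/
structure IsEllipticSecondOrder (P : C^∞⟮𝓡 n, M; ℝ⟯ →ₗ[ℝ] C^∞⟮𝓡 n, M; ℝ⟯) : Prop where
  isDiffOp : IsDiffOp 2 P
  elliptic : ∀ (f : C^∞⟮𝓡 n, M; ℝ⟯) (x : M), mfderiv (𝓡 n) 𝓘(ℝ, ℝ) f x ≠ 0 →
    mulCommutator (mulCommutator P f) f 1 x ≠ 0

end SmoothOperators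

/-- The real space `L₂(M)` of an `n`-dimensional Riemannian manifold. The Riemannian measure is the
`n`-dimensional Hausdorff measure of the Riemannian distance, normalized so that it is Lebesgue
measure on Euclidean space. -/
abbrev RiemannianL2 (n : ℕ) (M : Type*) [EMetricSpace M] [MeasurableSpace M] [BorelSpace M] :
    Type _ :=
  Lp ℝ 2 (μHE[n] : Measure M)

section L2Operators

variable {n : ℕ} {M : Type*} [EMetricSpace M] [MeasurableSpace M] [BorelSpace M]

/-- The unbounded operator `L` on `L₂(M)` is a self-adjoint elliptic second-order differential
operator with smooth real coefficients: it is self-adjoint, and it is the closure of an elliptic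
second-order differential operator `P` acting on the smooth functions. -/
structure IsSelfAdjointElliptic [ChartedSpace (EuclideanSpace ℝ (Fin n)) M]
    (P : C^∞⟮𝓡 n, M; ℝ⟯ →ₗ[ℝ] C^∞⟮𝓡 n, M; ℝ⟯)
    (L : RiemannianL2 n M →ₗ.[ℝ] RiemannianL2 n M) : Prop where
  elliptic : IsEllipticSecondOrder P
  graph_eq : (L.graph : Set (RiemannianL2 n M × RiemannianL2 n M)) =
    closure {p | ∃ f : C^∞⟮𝓡 n, M; ℝ⟯,
      (p.1 : M → ℝ) =ᵐ[μHE[n]] f ∧ (p.2 : M → ℝ) =ᵐ[μHE[n]] P f}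
  selfAdjoint : IsSelfAdjoint L

/-- The lowest eigenvalue of `L` is `0`: the operator `L` is nonnegative and has `0` as an
eigenvalue. -/
structure HasLowestEigenvalueZero (L : RiemannianL2 n M →ₗ.[ℝ] RiemannianL2 n M) : Prop where
  nonneg : ∀ u : L.domain, 0 ≤ inner ℝ (L u) (u : RiemannianL2 n M)
  exists_ker : ∃ u : L.domain, (u : RiemannianL2 n M) ≠ 0 ∧ L u = 0

/-- The space `E_w(L)` of `w`-band-limited functions: the span of all eigenfunctions of `L` whose
eigenvalues are not greater than `w`. -/
def bandLimited (L : RiemannianL2 n M →ₗ.[ℝ] RiemannianL2 n M) (w : ℝ) :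
    Submodule ℝ (RiemannianL2 n M) :=
  Submodule.span ℝ {v | ∃ u : L.domain, (u : RiemannianL2 n M) = v ∧
    ∃ lam : ℝ, lam ≤ w ∧ L u = lam • (u : RiemannianL2 n M)}

end L2Operators

end

/-!
Both counts are compared with `w ^ (n / 2)`.

*Lattices.* Near each point the inverse of the chart is bi-Lipschitz for the Riemannian distance
(`exists_isBiLipschitzChart`), so the Hausdorff measure is comparable to Lebesgue measure, and by
compactness balls of bounded radius `s` have measure comparable to `s ^ n`
(`exists_uniform_measure_eball_bounds`). The disjoint balls of radius `ρ / 4` bound the number of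
nodes from above, and the covering balls of radius `ρ / 2` bound it from below
(`exists_ncard_bounds`).

*Eigenvalues.* The dimension of `E_w(L)` is bounded above and below by the min-max principle, in the
manner of Weyl, without heat kernels or elliptic regularity. Let `Γ` be the carré du champ of the
operator `P`, that is the bilinear form of its principal symbol. Since `P` is symmetric, `∫ (P f) f`
equals `∫ Γ(f, f) + ∫ (P 1) f ^ 2`, and the last term is `O(∫ f ^ 2)`. Testing the nonnegativity of
this form on the rapidly oscillating functions `φ cos (t f)` and `φ sin (t f)` shows `Γ ≥ 0`
(`carreDuChamp_self_nonneg`). By Hadamard's lemma `Γ(f, f)` depends only on `df`, so by ellipticity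
and compactness it is comparable to the square of the Euclidean gradient in charts
(`IsEllipticSecondOrder.exists_carreDuChamp_bounds`).

* Upper bound (`IsSelfAdjointElliptic.exists_finrank_le`): cut finitely many charts into `k ^ n`
  cubes of side `O(1 / k)` each. The Poincaré inequality on every cube
  (`Convex.lintegral_enorm_sub_sq_le`) gives
  `‖u‖ ^ 2 ≤ B k ^ (-2) (⟨L u, u⟩ + K ‖u‖ ^ 2) + ∑ j, a j * ⟨v j, u⟩ ^ 2` with `O(k ^ n)` summands,
  first for smooth `u` and then on the domain of `L`, the graph being the closure of the graph of
  `P`. On `E_w(L)` one has `⟨L u, u⟩ ≤ w ‖u‖ ^ 2`, so for `k ^ 2 > B (w + K)` the functionals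
  `⟨v j, ·⟩` have no common zero there besides `0`.
* Lower bound (`IsSelfAdjointElliptic.exists_le_finrank`): `k ^ n` bump functions with disjoint
  supports of diameter comparable to `1 / k` span a space on which
  `⟨L u, u⟩ ≤ (Λ k ^ 2 + K) ‖u‖ ^ 2`. If its dimension exceeded that of `E_w(L)` for some
  `w > Λ k ^ 2 + K`, it would contain a nonzero vector orthogonal to `E_w(L)`. But on the orthogonal
  complement `⟨L u, u⟩ ≥ w ‖u‖ ^ 2` (`le_inner_of_mem_orthogonal_eigenSpan`), because the inequality
  of the upper bound makes the resolvent `(L + 1)⁻¹` compact, so that the spectral theorem applies.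
  For bounded `w` the kernel of `L` already gives dimension at least `1`.
-/


/-! ### Self-adjoint operators with compact resolvent -/

section Spectral

variable {H : Type*} [NormedAddCommGroup H] [InnerProductSpace ℝ H]

/-- The span of the eigenvectors of an unbounded operator with eigenvalue at most `w`. -/
def eigenSpan (L : H →ₗ.[ℝ] H) (w : ℝ) : Submodule ℝ H :=
  Submodule.span ℝ {v | ∃ u : L.domain, (u : H) = v ∧
    ∃ lam : ℝ, lam ≤ w ∧ L u = lam • (u : H)}

lemma eigenSpan_le_domain (L : H →ₗ.[ℝ] H) (w : ℝ) : eigenSpan L w ≤ L.domain := by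
  refine Submodule.span_le.2 ?_
  rintro _ ⟨u, rfl, -⟩
  exact u.2

/-- On the span of the eigenvectors, the quadratic form of a symmetric operator is bounded by the
largest admitted eigenvalue, because distinct eigenspaces are orthogonal. -/
lemma inner_le_of_mem_eigenSpan {L : H →ₗ.[ℝ] H}
    (hsymm : ∀ u v : L.domain, inner ℝ (L u) (v : H) = inner ℝ (u : H) (L v)) {w : ℝ}
    (u : L.domain) (hu : (u : H) ∈ eigenSpan L w) :
    inner ℝ (L u) (u : H) ≤ w * ‖(u : H)‖ ^ 2 := by
  classical
  let G : {lam : ℝ // lam ≤ w} → Submodule ℝ H := fun lam =>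
    (LinearMap.ker (L.toFun - (lam : ℝ) • L.domain.subtype)).map L.domain.subtype
  have hG : ∀ (lam : {lam : ℝ // lam ≤ w}) (v : H), v ∈ G lam ↔
      ∃ x : L.domain, (x : H) = v ∧ L x = (lam : ℝ) • (x : H) := by
    intro lam v
    constructor
    · rintro ⟨x, hx, rfl⟩
      refine ⟨x, rfl, ?_⟩
      have : L.toFun x - (lam : ℝ) • (x : H) = 0 := by simpa using hx
      exact sub_eq_zero.1 this
    · rintro ⟨x, rfl, hx⟩
      refine ⟨x, ?_, rfl⟩
      have : L.toFun x - (lam : ℝ) • (x : H) = 0 := sub_eq_zero.2 hx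
      simpa using this
  have horth : OrthogonalFamily ℝ (fun lam => G lam) (fun lam => (G lam).subtypeₗᵢ) := by
    rintro a b hab ⟨_, hxa⟩ ⟨_, hyb⟩
    obtain ⟨x, rfl, hx⟩ := (hG _ _).1 hxa
    obtain ⟨y, rfl, hy⟩ := (hG _ _).1 hyb
    have h := hsymm x y
    rw [hx, hy, inner_smul_left, inner_smul_right] at h
    have h' : ((a : ℝ) - b) * inner ℝ (x : H) (y : H) = 0 := by
      rw [conj_trivial] at h; linarith
    rcases mul_eq_zero.1 h' with h' | h'
    · exact absurd (Subtype.ext (sub_eq_zero.1 h')) hab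
    · simpa using h'
  have hmem : (u : H) ∈ ⨆ lam, G lam := by
    refine Submodule.span_le.2 ?_ hu
    rintro _ ⟨x, rfl, lam, hlam, hx⟩
    exact Submodule.mem_iSup_of_mem (p := G) ⟨lam, hlam⟩ ((hG _ _).2 ⟨x, rfl, hx⟩)
  obtain ⟨f, hf⟩ := (Submodule.mem_iSup_iff_exists_finsupp G (u : H)).1 hmem
  obtain ⟨hfm, hsum⟩ := hf
  choose x hx hLx using fun lam => (hG lam (f lam)).1 (hfm lam)
  have hu_eq : u = ∑ i ∈ f.support, x i := by
    apply Subtype.ext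
    rw [← hsum, Finsupp.sum, AddSubmonoidClass.coe_finsetSum]
    exact Finset.sum_congr rfl fun i _ => (hx i).symm
  have hLu : L u = ∑ i ∈ f.support, (i : ℝ) • f i := by
    rw [hu_eq]
    have : L (∑ i ∈ f.support, x i) = ∑ i ∈ f.support, L (x i) := map_sum L.toFun _ _
    rw [this]
    exact Finset.sum_congr rfl fun i _ => by rw [hLx, hx]
  have e1 : (∑ i ∈ f.support, f i) = (u : H) := hsum
  have e2 : inner ℝ (L u) (u : H) = ∑ i ∈ f.support, (i : ℝ) * ‖f i‖ ^ 2 := by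
    have := horth.inner_sum (fun i => (i : ℝ) • (⟨f i, hfm i⟩ : G i)) (fun i => ⟨f i, hfm i⟩)
      f.support
    simp only [Submodule.coe_subtypeₗᵢ, Submodule.subtype_apply, Submodule.coe_smul,
      Submodule.coe_inner, inner_smul_left] at this
    rw [hLu, ← e1, this]
    simp
  have e3 : ‖(u : H)‖ ^ 2 = ∑ i ∈ f.support, ‖f i‖ ^ 2 := by
    have := horth.norm_sum (fun i => (⟨f i, hfm i⟩ : G i)) f.support
    simp only [Submodule.coe_subtypeₗᵢ, Submodule.subtype_apply, Submodule.coe_norm] at this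
    rw [← e1, this]
  rw [e2, e3, Finset.mul_sum]
  exact Finset.sum_le_sum fun i _ => mul_le_mul_of_nonneg_right i.2 (sq_nonneg _)

/-- An inequality that controls the norm by the quadratic form and by finitely many linear
functionals bounds the number of small eigenvalues by the number of functionals: a vector of
`eigenSpan L w` annihilated by all functionals vanishes. -/
lemma finrank_eigenSpan_le {L : H →ₗ.[ℝ] H}
    (hsymm : ∀ u v : L.domain, inner ℝ (L u) (v : H) = inner ℝ (u : H) (L v))
    {ι : Type*} [Fintype ι] (a : ι → ℝ) (v : ι → H) {δ K w : ℝ} (hδ : 0 ≤ δ)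
    (hδw : δ * (w + K) < 1)
    (h : ∀ u : L.domain, ‖(u : H)‖ ^ 2 ≤ δ * (inner ℝ (L u) (u : H) + K * ‖(u : H)‖ ^ 2) +
      ∑ j, a j * inner ℝ (v j) (u : H) ^ 2) :
    FiniteDimensional ℝ (eigenSpan L w) ∧ Module.finrank ℝ (eigenSpan L w) ≤ Fintype.card ι := by
  let Φ : eigenSpan L w →ₗ[ℝ] (ι → ℝ) :=
    LinearMap.pi fun j => (innerₛₗ ℝ (v j)) ∘ₗ (eigenSpan L w).subtype
  have hΦ : Function.Injective Φ := by
    rw [injective_iff_map_eq_zero]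
    intro u hu
    have hu' : ∀ j, inner ℝ (v j) (u : H) = 0 := fun j => congrFun hu j
    have h1 := h ⟨u, eigenSpan_le_domain L w u.2⟩
    have h2 := inner_le_of_mem_eigenSpan hsymm ⟨u, eigenSpan_le_domain L w u.2⟩ u.2
    simp only [hu', ne_eq, OfNat.ofNat_ne_zero, not_false_eq_true, zero_pow, mul_zero,
      Finset.sum_const_zero, add_zero] at h1
    have h3 : ‖(u : H)‖ ^ 2 ≤ δ * (w + K) * ‖(u : H)‖ ^ 2 := by
      refine h1.trans ?_
      rw [mul_assoc]
      refine mul_le_mul_of_nonneg_left ?_ hδ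
      linarith
    have h4 : ‖(u : H)‖ ^ 2 = 0 := by
      by_contra hne
      have : 0 < ‖(u : H)‖ ^ 2 := lt_of_le_of_ne (sq_nonneg _) (Ne.symm hne)
      nlinarith
    simpa using h4
  have hfd : FiniteDimensional ℝ (eigenSpan L w) := FiniteDimensional.of_injective Φ hΦ
  refine ⟨hfd, ?_⟩
  have := LinearMap.finrank_le_finrank_of_injective hΦ
  simpa using this

lemma norm_le_norm_apply_add_self {L : H →ₗ.[ℝ] H}
    (hnn : ∀ u : L.domain, 0 ≤ inner ℝ (L u) (u : H)) (u : L.domain) :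
    ‖(u : H)‖ ≤ ‖L u + (u : H)‖ := by
  by_cases h0 : ‖(u : H)‖ = 0
  · rw [h0]; exact norm_nonneg _
  have hpos : 0 < ‖(u : H)‖ := lt_of_le_of_ne (norm_nonneg _) (Ne.symm h0)
  have h1 : ‖(u : H)‖ ^ 2 ≤ inner ℝ (L u + (u : H)) (u : H) := by
    rw [inner_add_left, real_inner_self_eq_norm_sq]; linarith [hnn u]
  have h2 := real_inner_le_norm (L u + (u : H)) (u : H)
  nlinarith

lemma isSymmetric_resolvent {L : H →ₗ.[ℝ] H}
    (hsymm : ∀ u v : L.domain, inner ℝ (L u) (v : H) = inner ℝ (u : H) (L v)) {T : H →L[ℝ] H}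
    (hT : ∀ g, T g ∈ L.domain) (hTL : ∀ g, L ⟨T g, hT g⟩ + T g = g) :
    (T : H →ₗ[ℝ] H).IsSymmetric := by
  intro f g
  simp only [ContinuousLinearMap.coe_coe]
  conv_lhs => rw [← hTL g]
  conv_rhs => rw [← hTL f]
  rw [inner_add_right, inner_add_left]
  have := hsymm ⟨T f, hT f⟩ ⟨T g, hT g⟩
  simp only at this
  rw [this]

variable [CompleteSpace H]

lemma inner_apply_of_isSelfAdjoint {L : H →ₗ.[ℝ] H} (hL : IsSelfAdjoint L) (u v : L.domain) :
    inner ℝ (L u) (v : H) = inner ℝ (u : H) (L v) := by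
  have h := LinearPMap.adjoint_isFormalAdjoint hL.dense_domain
  rw [LinearPMap.isSelfAdjoint_def.1 hL] at h
  exact h u v

/-- For a nonnegative self-adjoint operator `L`, the operator `L + 1` is onto. -/
lemma exists_apply_add_self_eq {L : H →ₗ.[ℝ] H} (hL : IsSelfAdjoint L)
    (hnn : ∀ u : L.domain, 0 ≤ inner ℝ (L u) (u : H)) (g : H) :
    ∃ u : L.domain, L u + (u : H) = g := by
  let R : L.domain →ₗ[ℝ] H := L.toFun + L.domain.subtype
  have hR : ∀ u : L.domain, R u = L u + (u : H) := fun u => rfl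
  have hgraph : IsClosed (L.graph : Set (H × H)) := hL.isClosed
  have hclosed : IsClosed (LinearMap.range R : Set H) := by
    refine IsSeqClosed.isClosed ?_
    intro y z hy hz
    choose u hu using hy
    have hcau : CauchySeq fun k => (u k : H) := by
      rw [Metric.cauchySeq_iff']
      intro ε hε
      obtain ⟨N, hN⟩ := (Metric.cauchySeq_iff'.1 hz.cauchySeq) ε hε
      refine ⟨N, fun k hk => lt_of_le_of_lt ?_ (hN k hk)⟩
      rw [dist_eq_norm, dist_eq_norm, ← hu, ← hu, ← map_sub, hR]
      exact norm_le_norm_apply_add_self hnn (u k - u N)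
    obtain ⟨x, hx⟩ := cauchySeq_tendsto_of_complete hcau
    have hLx : Filter.Tendsto (fun k => L (u k)) Filter.atTop (𝓝 (z - x)) := by
      refine (hz.sub hx).congr fun k => ?_
      rw [← hu, hR, add_sub_cancel_right]
    have hmem : (x, z - x) ∈ (L.graph : Set (H × H)) :=
      hgraph.mem_of_tendsto (hx.prodMk_nhds hLx)
        (Filter.Eventually.of_forall fun k => L.mem_graph (u k))
    obtain ⟨v, hv1, hv2⟩ := (LinearPMap.mem_graph_iff L).1 hmem
    refine ⟨v, ?_⟩
    rw [hR, hv2, hv1]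
    simp
  have horth : (LinearMap.range R)ᗮ = ⊥ := by
    rw [Submodule.eq_bot_iff]
    intro v hv
    have hv' : ∀ x : L.domain, inner ℝ (-v) (x : H) = inner ℝ v (L x) := by
      intro x
      have := (Submodule.mem_orthogonal' _ v).1 hv (R x) ⟨x, rfl⟩
      rw [hR, inner_add_right] at this
      rw [inner_neg_left]; linarith
    have hdom := LinearPMap.mem_adjoint_domain_of_exists v ⟨-v, hv'⟩
    have hval := LinearPMap.adjoint_apply_eq hL.dense_domain ⟨v, hdom⟩ hv'
    have hg : (v, -v) ∈ L.graph := by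
      have : (v, -v) ∈ (L.adjoint).graph := by
        rw [LinearPMap.mem_graph_iff]; exact ⟨⟨v, hdom⟩, rfl, hval⟩
      rwa [LinearPMap.isSelfAdjoint_def.1 hL] at this
    obtain ⟨x, hx1, hx2⟩ := (LinearPMap.mem_graph_iff L).1 hg
    have := hnn x
    simp only at hx1 hx2
    rw [hx2, hx1, inner_neg_left, real_inner_self_eq_norm_sq] at this
    have h0 : ‖v‖ ^ 2 = 0 := le_antisymm (by linarith) (sq_nonneg _)
    simpa using h0
  have htop : LinearMap.range R = ⊤ := by
    rw [← hclosed.submodule_topologicalClosure_eq, Submodule.topologicalClosure_eq_top_iff, horth]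
  have : g ∈ LinearMap.range R := by rw [htop]; trivial
  exact this

/-- The resolvent `(L + 1)⁻¹` of a nonnegative self-adjoint operator, as a bounded operator. -/
lemma exists_resolvent {L : H →ₗ.[ℝ] H} (hL : IsSelfAdjoint L)
    (hnn : ∀ u : L.domain, 0 ≤ inner ℝ (L u) (u : H)) :
    ∃ (T : H →L[ℝ] H) (hT : ∀ g, T g ∈ L.domain),
      (∀ g, L ⟨T g, hT g⟩ + T g = g) ∧ ∀ u : L.domain, T (L u + (u : H)) = u := by
  let R : L.domain →ₗ[ℝ] H := L.toFun + L.domain.subtype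
  have hR : ∀ u : L.domain, R u = L u + (u : H) := fun u => rfl
  have hinj : Function.Injective R := by
    rw [injective_iff_map_eq_zero]
    intro u hu
    have := norm_le_norm_apply_add_self hnn u
    rw [← hR, hu, norm_zero] at this
    exact Subtype.ext (norm_le_zero_iff.1 this)
  have hsurj : Function.Surjective R := fun g => exists_apply_add_self_eq hL hnn g
  let e := LinearEquiv.ofBijective R ⟨hinj, hsurj⟩
  have he : ∀ g, L (e.symm g) + (e.symm g : H) = g := fun g => e.apply_symm_apply g
  refine ⟨(L.domain.subtype ∘ₗ e.symm.toLinearMap).mkContinuous 1 fun g => ?_,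
    fun g => (e.symm g).2, fun g => he g, fun u => ?_⟩
  · rw [one_mul]
    have := norm_le_norm_apply_add_self hnn (e.symm g)
    rwa [he] at this
  · change ((e.symm (L u + (u : H)) : L.domain) : H) = u
    rw [← hR]
    exact congrArg _ (e.symm_apply_apply u)

/-- If on subspaces of finite codimension the quadratic form of `L` dominates arbitrarily large
multiples of the square of the norm, then the resolvent is compact: it is a norm limit of operators
of finite rank. -/
lemma isCompactOperator_resolvent {L : H →ₗ.[ℝ] H}
    (hsymm : ∀ u v : L.domain, inner ℝ (L u) (v : H) = inner ℝ (u : H) (L v))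
    (hcoer : ∀ Λ : ℝ, ∃ (ι : Type) (_ : Finite ι) (v : ι → H), ∀ u : L.domain,
      (∀ j, inner ℝ (v j) (u : H) = 0) → Λ * ‖(u : H)‖ ^ 2 ≤ inner ℝ (L u) (u : H))
    {T : H →L[ℝ] H} (hT : ∀ g, T g ∈ L.domain) (hTL : ∀ g, L ⟨T g, hT g⟩ + T g = g) :
    IsCompactOperator T := by
  have hTsymm : ∀ f g, inner ℝ (T f) g = inner ℝ f (T g) := isSymmetric_resolvent hsymm hT hTL
  have key : ∀ ε : ℝ, 0 < ε → ∃ S : H →L[ℝ] H, IsCompactOperator S ∧ ‖T - S‖ ≤ ε := by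
    intro ε hε
    -- `T` is approximated by `T ∘ p`, where `p` is the projection onto the span of the `T v j`: for
    -- `q` orthogonal to this span, `T q` satisfies the coercivity estimate.
    obtain ⟨ι, hι, v, hv⟩ := hcoer (ε⁻¹ ^ 2)
    let F : Submodule ℝ H := Submodule.span ℝ (Set.range fun j => T (v j))
    have hF : FiniteDimensional ℝ F := FiniteDimensional.span_of_finite ℝ (Set.finite_range _)
    refine ⟨T ∘L F.starProjection, ?_, ?_⟩
    · have h1 : IsCompactOperator (F.subtypeL) := by
        have : IsCompactOperator (ContinuousLinearMap.id ℝ F) :=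
          isCompactOperator_id_iff_finiteDimensional.2 hF
        have h2 := this.clm_comp F.subtypeL
        exact h2
      have h2 := (h1.comp_clm F.orthogonalProjectionOnto).clm_comp T
      exact h2
    · refine ContinuousLinearMap.opNorm_le_bound _ hε.le fun g => ?_
      set q := g - F.starProjection g with hq
      have hqF : q ∈ Fᗮ := Submodule.sub_starProjection_mem_orthogonal g
      have hqn : ‖q‖ ≤ ‖g‖ := by
        have h := F.norm_sq_eq_add_norm_sq_projection g
        have h' : ‖F.starProjection g‖ ^ 2 + ‖q‖ ^ 2 = ‖g‖ ^ 2 := by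
          have ho : inner ℝ (F.starProjection g) q = 0 :=
            (Submodule.mem_orthogonal _ q).1 hqF _ (Submodule.starProjection_apply_mem F g)
          have := norm_add_sq_real (F.starProjection g) q
          rw [ho, hq, add_sub_cancel] at this
          rw [this]; ring
        nlinarith [norm_nonneg q, norm_nonneg g, sq_nonneg ‖F.starProjection g‖]
      have hval : (T - T ∘L F.starProjection) g = T q := by simp [hq]
      rw [hval]
      refine le_trans ?_ (mul_le_mul_of_nonneg_left hqn hε.le)
      have h1 := hv ⟨T q, hT q⟩ fun j => by
        simp only
        rw [← hTsymm]
        exact (Submodule.mem_orthogonal _ q).1 hqF _ (Submodule.subset_span ⟨j, rfl⟩)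
      simp only at h1
      have h2 : inner ℝ (L ⟨T q, hT q⟩) (T q) ≤ ‖q‖ * ‖T q‖ - ‖T q‖ ^ 2 := by
        have e : L ⟨T q, hT q⟩ = q - T q := by rw [eq_sub_iff_add_eq]; exact hTL q
        rw [e, inner_sub_left, real_inner_self_eq_norm_sq]
        linarith [real_inner_le_norm q (T q)]
      -- It remains to combine this with the coercivity `ε⁻² ‖Tq‖² ≤ ⟪L (Tq), Tq⟫`.
      have h3 : ε⁻¹ ^ 2 * ‖T q‖ ^ 2 + ‖T q‖ ^ 2 ≤ ‖q‖ * ‖T q‖ := by linarith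
      rcases (norm_nonneg (T q)).eq_or_lt with h0 | h0
      · rw [← h0]; positivity
      have h4 : (ε⁻¹ ^ 2 + 1) * ‖T q‖ ≤ ‖q‖ := by
        have : ((ε⁻¹ ^ 2 + 1) * ‖T q‖) * ‖T q‖ ≤ ‖q‖ * ‖T q‖ := by nlinarith
        exact le_of_mul_le_mul_right this h0
      have h5 : ε⁻¹ ≤ ε⁻¹ ^ 2 + 1 := by nlinarith [sq_nonneg (ε⁻¹ - 1), sq_nonneg (ε⁻¹)]
      have h6 : ε⁻¹ * ‖T q‖ ≤ ‖q‖ := le_trans (mul_le_mul_of_nonneg_right h5 h0.le) h4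
      calc ‖T q‖ = ε * (ε⁻¹ * ‖T q‖) := by field_simp
        _ ≤ ε * ‖q‖ := mul_le_mul_of_nonneg_left h6 hε.le
  choose S hS hSn using fun k : ℕ => key (1 / ((k : ℝ) + 1)) (by positivity)
  refine isCompactOperator_of_tendsto (l := Filter.atTop) (F := S) ?_
    (Filter.Eventually.of_forall hS)
  rw [tendsto_iff_norm_sub_tendsto_zero]
  refine squeeze_zero (fun _ => norm_nonneg _) (fun k => ?_)
    tendsto_one_div_add_atTop_nhds_zero_nat
  rw [norm_sub_rev]
  exact hSn k

/-- A compact symmetric operator whose eigenvalues have absolute value at most `r` has norm at most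
`r`. -/
lemma norm_le_of_forall_hasEigenvalue {E : Type*} [NormedAddCommGroup E] [InnerProductSpace ℝ E]
    [CompleteSpace E] {S : E →L[ℝ] E} (hS : IsCompactOperator S)
    (hS' : (S : E →ₗ[ℝ] E).IsSymmetric) {r : ℝ} (hr : 0 ≤ r)
    (h : ∀ μ : ℝ, Module.End.HasEigenvalue (S : Module.End ℝ E) μ → |μ| ≤ r) : ‖S‖ ≤ r := by
  have h1 : spectralRadius ℝ S ≤ ENNReal.ofReal r := by
    refine iSup₂_le fun μ hμ => ?_
    by_cases h0 : μ = 0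
    · simp [h0]
    · have := h μ ((hS.hasEigenvalue_iff_mem_spectrum h0).2 hμ)
      rw [← enorm_eq_nnnorm, Real.enorm_eq_ofReal_abs]
      exact ENNReal.ofReal_le_ofReal this
  rw [S.spectralRadius_eq_nnnorm hS'.isSelfAdjoint, ← enorm_eq_nnnorm,
    ← ofReal_norm] at h1
  exact (ENNReal.ofReal_le_ofReal_iff hr).1 h1

/-- For a nonnegative self-adjoint operator with compact resolvent, the quadratic form is at least
`w` times the square of the norm on the orthogonal complement of `eigenSpan L w`. -/
lemma le_inner_of_mem_orthogonal_eigenSpan {L : H →ₗ.[ℝ] H} (hL : IsSelfAdjoint L)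
    (hnn : ∀ u : L.domain, 0 ≤ inner ℝ (L u) (u : H))
    (hcoer : ∀ Λ : ℝ, ∃ (ι : Type) (_ : Finite ι) (v : ι → H), ∀ u : L.domain,
      (∀ j, inner ℝ (v j) (u : H) = 0) → Λ * ‖(u : H)‖ ^ 2 ≤ inner ℝ (L u) (u : H))
    {w : ℝ} (hw : 0 ≤ w) (f : L.domain) (hf : (f : H) ∈ (eigenSpan L w)ᗮ) :
    w * ‖(f : H)‖ ^ 2 ≤ inner ℝ (L f) (f : H) := by
  have hsymm := inner_apply_of_isSelfAdjoint hL
  obtain ⟨T, hT, hTL, hLT⟩ := exists_resolvent hL hnn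
  have hcomp := isCompactOperator_resolvent hsymm hcoer hT hTL
  have hTsymm := isSymmetric_resolvent hsymm hT hTL
  set W := (eigenSpan L w)ᗮ with hW
  have hmemW : ∀ v : H, (∀ x : L.domain, ∀ lam ≤ w, L x = lam • (x : H) →
      inner ℝ (x : H) v = 0) → v ∈ W := by
    intro v hv
    rw [hW, eigenSpan, Submodule.mem_orthogonal]
    intro y hy
    induction hy using Submodule.span_induction with
    | mem y hy =>
      obtain ⟨x, rfl, lam, hlam, hx⟩ := hy
      exact hv x lam hlam hx
    | zero => simp
    | add y z _ _ hy hz => rw [inner_add_left, hy, hz, add_zero]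
    | smul c y _ hy => rw [inner_smul_left, hy, mul_zero]
  have hWmem : ∀ v ∈ W, ∀ x : L.domain, ∀ lam ≤ w, L x = lam • (x : H) →
      inner ℝ (x : H) v = 0 := fun v hv x lam hlam hx =>
    (Submodule.mem_orthogonal _ v).1 hv x (Submodule.subset_span ⟨x, rfl, lam, hlam, hx⟩)
  have hinv : ∀ v ∈ W, T v ∈ W := by
    intro v hv
    refine hmemW _ fun x lam hlam hx => ?_
    have h1 : (lam + 1) • T x = (x : H) := by
      rw [← map_smul, add_smul, one_smul, ← hx]; exact hLT x
    by_cases h0 : lam + 1 = 0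
    · have hx0 : (x : H) = 0 := by rw [← h1, h0, zero_smul]
      rw [hx0, inner_zero_left]
    · have h2 : T x = (lam + 1)⁻¹ • (x : H) := by
        rw [eq_inv_smul_iff₀ h0]; exact h1
      have h3 : inner ℝ (T x) v = inner ℝ (x : H) (T v) := hTsymm x v
      rw [← h3, h2, inner_smul_left, hWmem v hv x lam hlam hx, mul_zero]
  let S : W →L[ℝ] W := T.restrict hinv
  have hSapp : ∀ v : W, ((S v : W) : H) = T v := fun v => rfl
  have hScomp : IsCompactOperator S := hcomp.restrict' hinv
  have hSsymm : (S : W →ₗ[ℝ] W).IsSymmetric := hTsymm.restrict_invariant hinv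
  have hSnorm : ‖S‖ ≤ (1 + w)⁻¹ := by
    refine norm_le_of_forall_hasEigenvalue hScomp hSsymm (by positivity) fun μ hμ => ?_
    obtain ⟨v, hv⟩ := hμ.exists_hasEigenvector
    have hv0 : (v : H) ≠ 0 := fun h => hv.2 (Subtype.ext h)
    have hv1 : T v = μ • (v : H) := by
      have := hv.apply_eq_smul
      exact congrArg Subtype.val this
    have hμ0 : μ ≠ 0 := by
      intro h
      rw [h, zero_smul] at hv1
      have h2 := hTL (v : H)
      have h3 : (⟨T v, hT v⟩ : L.domain) = 0 := Subtype.ext hv1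
      rw [h3, hv1, LinearPMap.map_zero, add_zero] at h2
      exact hv0 h2.symm
    have hvdom : (v : H) ∈ L.domain := by
      have := L.domain.smul_mem μ⁻¹ (hT v)
      rwa [hv1, inv_smul_smul₀ hμ0] at this
    have hLv : L ⟨v, hvdom⟩ = (μ⁻¹ - 1) • (v : H) := by
      have h1 := hTL (v : H)
      have h2 : (⟨T v, hT v⟩ : L.domain) = μ • (⟨v, hvdom⟩ : L.domain) := Subtype.ext hv1
      rw [h2, LinearPMap.map_smul, hv1, ← smul_add] at h1
      have h3 : L ⟨v, hvdom⟩ + (v : H) = μ⁻¹ • (v : H) := by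
        rw [eq_inv_smul_iff₀ hμ0]; exact h1
      rw [sub_smul, one_smul, ← h3, add_sub_cancel_right]
    have hgt : w < μ⁻¹ - 1 := by
      by_contra hle
      have := hWmem v v.2 ⟨v, hvdom⟩ _ (not_lt.1 hle) hLv
      exact hv0 (inner_self_eq_zero.1 this)
    have hpos : 0 < μ := inv_pos.1 (by linarith)
    rw [abs_of_pos hpos]
    rw [← inv_inv μ]
    exact inv_anti₀ (by positivity) (by linarith)
  set g : H := L f + (f : H) with hg
  have hTg : T g = f := hLT f
  have hgW : g ∈ W := by
    refine W.add_mem (hmemW _ fun x lam hlam hx => ?_) hf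
    rw [← hsymm, hx, inner_smul_left, hWmem _ hf x lam hlam hx, mul_zero]
  have hTnorm : ‖T (f : H)‖ ≤ (1 + w)⁻¹ * ‖(f : H)‖ := by
    have := S.le_of_opNorm_le hSnorm ⟨f, hf⟩
    exact this
  have hTpos : ∀ v : H, 0 ≤ inner ℝ (T v) v := by
    intro v
    have hadd := hnn ⟨T v, hT v⟩
    simp only at hadd
    have : inner ℝ (T v) (L ⟨T v, hT v⟩ + T v) = inner ℝ (L ⟨T v, hT v⟩) (T v) + ‖T v‖ ^ 2 := by
      rw [inner_add_right, real_inner_self_eq_norm_sq, real_inner_comm]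
    have h2 := hTL v
    calc (0 : ℝ) ≤ inner ℝ (L ⟨T v, hT v⟩) (T v) + ‖T v‖ ^ 2 := by positivity
      _ = inner ℝ (T v) v := by rw [← this, h2]
  -- Positivity of `T` at `g - (1 + w) T g` gives `(1 + w) ‖T g‖² ≤ ⟪T g, g⟫`.
  have hq := hTpos (g - (1 + w) • (f : H))
  rw [map_sub, map_smul, hTg, inner_sub_left, inner_sub_right, inner_sub_right, inner_smul_left,
    inner_smul_left, inner_smul_right, inner_smul_right, real_inner_self_eq_norm_sq] at hq
  have hTf : inner ℝ (T (f : H)) g = ‖(f : H)‖ ^ 2 := by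
    have : inner ℝ (T (f : H)) g = inner ℝ (f : H) (T g) := hTsymm f g
    rw [this, hTg, real_inner_self_eq_norm_sq]
  have hTff : inner ℝ (T (f : H)) (f : H) ≤ (1 + w)⁻¹ * ‖(f : H)‖ ^ 2 := by
    refine (real_inner_le_norm _ _).trans ?_
    rw [sq, ← mul_assoc]
    exact mul_le_mul_of_nonneg_right hTnorm (norm_nonneg _)
  have hfg : inner ℝ (f : H) g = inner ℝ (L f) (f : H) + ‖(f : H)‖ ^ 2 := by
    rw [hg, inner_add_right, real_inner_self_eq_norm_sq, real_inner_comm]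
  have hmul : (1 + w) * ((1 + w) * inner ℝ (T (f : H)) (f : H)) ≤ (1 + w) * ‖(f : H)‖ ^ 2 := by
    refine mul_le_mul_of_nonneg_left ?_ (by positivity)
    calc (1 + w) * inner ℝ (T (f : H)) (f : H) ≤ (1 + w) * ((1 + w)⁻¹ * ‖(f : H)‖ ^ 2) :=
          mul_le_mul_of_nonneg_left hTff (by positivity)
      _ = ‖(f : H)‖ ^ 2 := by field_simp
  simp only [conj_trivial] at hq
  rw [hTf, hfg] at hq
  linarith

/-- A family of trial vectors whose combinations have Rayleigh quotient below `w` bounds the number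
of eigenvalues up to `w` from below. -/
lemma card_le_finrank_eigenSpan {L : H →ₗ.[ℝ] H} (hL : IsSelfAdjoint L)
    (hnn : ∀ u : L.domain, 0 ≤ inner ℝ (L u) (u : H))
    (hcoer : ∀ Λ : ℝ, ∃ (ι : Type) (_ : Finite ι) (v : ι → H), ∀ u : L.domain,
      (∀ j, inner ℝ (v j) (u : H) = 0) → Λ * ‖(u : H)‖ ^ 2 ≤ inner ℝ (L u) (u : H))
    {w : ℝ} (hw : 0 ≤ w) [FiniteDimensional ℝ (eigenSpan L w)]
    {ι : Type*} [Fintype ι] (f : ι → L.domain)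
    (hf : ∀ c : ι → ℝ, c ≠ 0 → inner ℝ (L (∑ j, c j • f j)) ((∑ j, c j • f j : L.domain) : H) <
      w * ‖((∑ j, c j • f j : L.domain) : H)‖ ^ 2) :
    Fintype.card ι ≤ Module.finrank ℝ (eigenSpan L w) := by
  let Φ : (ι → ℝ) →ₗ[ℝ] eigenSpan L w :=
    ((eigenSpan L w).orthogonalProjectionOnto : H →ₗ[ℝ] eigenSpan L w) ∘ₗ L.domain.subtype ∘ₗ
      Fintype.linearCombination ℝ f
  have hΦ : Function.Injective Φ := by
    rw [injective_iff_map_eq_zero]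
    intro c hc
    by_contra hne
    have h1 := hf c hne
    have hc' : (eigenSpan L w).orthogonalProjectionOnto
        ((∑ j, c j • f j : L.domain) : H) = 0 := by
      simpa [Φ, Fintype.linearCombination_apply] using hc
    have h2 := le_inner_of_mem_orthogonal_eigenSpan hL hnn hcoer hw (∑ j, c j • f j)
      (Submodule.orthogonalProjectionOnto_eq_zero_iff.1 hc')
    linarith
  have := LinearMap.finrank_le_finrank_of_injective hΦ
  simpa using this

end Spectral

/-! ### Charts of a Riemannian manifold are locally bi-Lipschitz -/

section Lipschitz

open scoped NNReal

variable {E : Type*} [NormedAddCommGroup E] [NormedSpace ℝ E]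
  {M : Type*} [PseudoEMetricSpace M] [ChartedSpace E M]
  [RiemannianBundle (fun x : M => TangentSpace 𝓘(ℝ, E) x)]
  [IsManifold 𝓘(ℝ, E) 1 M]
  [IsContinuousRiemannianBundle E (fun x : M => TangentSpace 𝓘(ℝ, E) x)]
  [IsRiemannianManifold 𝓘(ℝ, E) M]

attribute [local instance] normedAddCommGroupTangentSpaceVectorSpace
attribute [local instance] normedSpaceTangentSpaceVectorSpace

/-- The inverse of a chart is Lipschitz near the base point: the image of a segment in the chart is
a path in the manifold. -/
lemma exists_lipschitzOnWith_extChartAt_symm (x : M) :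
    ∃ (C : ℝ≥0) (r : ℝ), 0 < r ∧
      Metric.ball (extChartAt 𝓘(ℝ, E) x x) r ⊆ (extChartAt 𝓘(ℝ, E) x).target ∧
      LipschitzOnWith C (extChartAt 𝓘(ℝ, E) x).symm
        (Metric.ball (extChartAt 𝓘(ℝ, E) x x) r) := by
  rcases eventually_enorm_mfderivWithin_symm_extChartAt_lt 𝓘(ℝ, E) x with ⟨C, C_pos, hC⟩
  obtain ⟨r, r_pos, hr⟩ := Metric.mem_nhdsWithin_iff.1
    (hC.and (extChartAt_target_mem_nhdsWithin (I := 𝓘(ℝ, E)) x))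
  have hr' := fun y (hy : y ∈ Metric.ball (extChartAt 𝓘(ℝ, E) x x) r) => hr ⟨hy, by simp⟩
  refine ⟨C, r, r_pos, fun y hy => (hr' y hy).2, ?_⟩
  intro u hu v hv
  let η := ContinuousAffineMap.lineMap (R := ℝ) u v
  set γ := (extChartAt 𝓘(ℝ, E) x).symm ∘ η
  have hball : Icc 0 1 ⊆ ⇑η ⁻¹' Metric.ball (extChartAt 𝓘(ℝ, E) x x) r := by
    simp only [← image_subset_iff, ContinuousAffineMap.coe_lineMap_eq,
     ← segment_eq_image_lineMap, η]
    exact (convex_ball _ _).segment_subset hu hv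
  have hη : Icc 0 1 ⊆ ⇑η ⁻¹' (extChartAt 𝓘(ℝ, E) x).target := fun t ht => (hr' _ (hball ht)).2
  have η_smooth : CMDiff[Icc 0 1] 1 η := by
    apply ContMDiff.contMDiffOn
    rw [contMDiff_iff_contDiff]
    exact ContinuousAffineMap.contDiff _
  have hle : riemannianEDist 𝓘(ℝ, E) ((extChartAt 𝓘(ℝ, E) x).symm u)
      ((extChartAt 𝓘(ℝ, E) x).symm v) ≤ pathELength 𝓘(ℝ, E) γ 0 1 := by
    apply riemannianEDist_le_pathELength _ _ _ zero_le_one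
    · exact (contMDiffOn_extChartAt_symm x).comp η_smooth hη
    · simp [γ, η, ContinuousAffineMap.coe_lineMap_eq]
    · simp [γ, η, ContinuousAffineMap.coe_lineMap_eq]
  rw [IsRiemannianManifold.out (I := 𝓘(ℝ, E)) ((extChartAt 𝓘(ℝ, E) x).symm u)]
  apply hle.trans
  rw [← lintegral_fderiv_lineMap_eq_edist, pathELength_eq_lintegral_mfderivWithin_Icc,
    ← lintegral_const_mul' _ _ ENNReal.coe_ne_top]
  apply setLIntegral_mono' measurableSet_Icc (fun t ht ↦ ?_)
  have h1 : mfderiv[Icc 0 1] γ t =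
      (mfderiv[range 𝓘(ℝ, E)] (extChartAt 𝓘(ℝ, E) x).symm (η t)) ∘L (mfderiv[Icc 0 1] η t) := by
    apply mfderivWithin_comp
    · exact mdifferentiableWithinAt_extChartAt_symm (hη ht)
    · exact η_smooth.mdifferentiableOn one_ne_zero t ht
    · exact hη.trans (preimage_mono (extChartAt_target_subset_range x))
    · rw [uniqueMDiffWithinAt_iff_uniqueDiffWithinAt]
      exact uniqueDiffOn_Icc zero_lt_one t ht
  have h2 : mfderiv[Icc 0 1] γ t 1 =
      (mfderiv[range 𝓘(ℝ, E)] (extChartAt 𝓘(ℝ, E) x).symm (η t)) (mfderiv[Icc 0 1] η t 1) :=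
    congr($h1 1)
  rw [h2]
  apply (ContinuousLinearMap.le_opENorm _ _).trans
  gcongr
  · exact (hr' _ (hball ht)).1.le
  · simp only [mfderivWithin_eq_fderivWithin]
    exact le_of_eq rfl

/-- A chart is Lipschitz near the base point: a nearly shortest path between two points of a small
metric ball stays in a slightly larger ball, where the derivative of the chart is bounded. -/
lemma exists_lipschitzOnWith_extChartAt (x : M) :
    ∃ (C : ℝ≥0), ∃ s ∈ 𝓝 x, LipschitzOnWith C (extChartAt 𝓘(ℝ, E) x) s := by
  rcases eventually_enorm_mfderiv_extChartAt_lt 𝓘(ℝ, E) x with ⟨C, C_pos, hC⟩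
  obtain ⟨ε, ε_pos, hε⟩ := EMetric.mem_nhds_iff.1
    (Filter.inter_mem hC (extChartAt_source_mem_nhds (I := 𝓘(ℝ, E)) x))
  have h3 : 0 < ε / 3 := ENNReal.div_pos ε_pos.ne' (by simp)
  refine ⟨C, Metric.eball x (ε / 3), Metric.eball_mem_nhds _ h3, ?_⟩
  intro y hy z hz
  have hyz : edist y z < ε / 3 + ε / 3 := by
    refine (edist_triangle_right y z x).trans_lt ?_
    exact ENNReal.add_lt_add hy hz
  -- It suffices to compare with the lengths of all paths shorter than `2 ε / 3`.
  have key : ∀ r : ℝ≥0∞, edist y z < r → r ≤ ε / 3 + ε / 3 →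
      edist (extChartAt 𝓘(ℝ, E) x y) (extChartAt 𝓘(ℝ, E) x z) ≤ C * r := by
    intro r hr hrε
    rw [IsRiemannianManifold.out (I := 𝓘(ℝ, E)) y z] at hr
    obtain ⟨γ, γ0, γ1, γ_smooth, hγ, -⟩ :=
      exists_lt_locally_constant_of_riemannianEDist_lt hr zero_lt_one
    have hmem : ∀ t ∈ Icc (0 : ℝ) 1, γ t ∈ Metric.eball x ε := by
      intro t ht
      have h1 : edist y (γ t) ≤ pathELength 𝓘(ℝ, E) γ 0 1 := by
        rw [IsRiemannianManifold.out (I := 𝓘(ℝ, E)) y]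
        exact (riemannianEDist_le_pathELength γ_smooth.contMDiffOn γ0 rfl ht.1).trans
          (pathELength_mono le_rfl ht.2)
      have h2 : edist (γ t) x < (ε / 3 + ε / 3) + ε / 3 := by
        refine (edist_triangle (γ t) y x).trans_lt ?_
        rw [edist_comm (γ t) y]
        exact ENNReal.add_lt_add ((h1.trans_lt hγ).trans_le hrε) hy
      rwa [ENNReal.add_thirds] at h2
    have hsource : ∀ t ∈ Icc (0 : ℝ) 1, γ t ∈ (chartAt E x).source := fun t ht => by
      simpa using (hε (hmem t ht)).2
    let γ' := extChartAt 𝓘(ℝ, E) x ∘ γ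
    have hC' : CMDiff[Icc 0 1] 1 γ' :=
      contMDiffOn_extChartAt.comp (I' := 𝓘(ℝ, E)) (t := (chartAt E x).source)
        γ_smooth.contMDiffOn hsource
    have hfin : ‖γ' 1 - γ' 0‖ₑ ≤ C * r := calc
        ‖γ' 1 - γ' 0‖ₑ
      _ ≤ ∫⁻ t' in Icc 0 1, ‖derivWithin γ' (Icc 0 1) t'‖ₑ := by
        apply enorm_sub_le_lintegral_derivWithin_Icc_of_contDiffOn_Icc _ zero_le_one
        rwa [← contMDiffOn_iff_contDiffOn]
      _ = ∫⁻ t' in Icc 0 1, ‖mfderiv[Icc 0 1] γ' t' 1‖ₑ := by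
        simp_rw [← fderivWithin_derivWithin, mfderivWithin_eq_fderivWithin]
        rfl
      _ ≤ ∫⁻ t' in Icc 0 1, C * ‖mfderiv[Icc 0 1] γ t' 1‖ₑ := by
        apply setLIntegral_mono' measurableSet_Icc (fun t' ht' ↦ ?_)
        have h1 : mfderiv[Icc 0 1] γ' t' =
            (mfderiv% (extChartAt 𝓘(ℝ, E) x) (γ t')) ∘L (mfderiv[Icc 0 1] γ t') := by
          apply mfderiv_comp_mfderivWithin
          · exact mdifferentiableAt_extChartAt (hsource t' ht')
          · exact (γ_smooth.mdifferentiable one_ne_zero).mdifferentiableOn _ ht'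
          · rw [uniqueMDiffWithinAt_iff_uniqueDiffWithinAt]
            exact uniqueDiffOn_Icc zero_lt_one _ ht'
        have h2 : mfderiv[Icc 0 1] γ' t' 1 =
            (mfderiv% (extChartAt 𝓘(ℝ, E) x) (γ t')) (mfderiv[Icc 0 1] γ t' 1) :=
          congr($h1 1)
        rw [h2]
        apply (ContinuousLinearMap.le_opENorm _ _).trans
        gcongr
        exact (hε (hmem t' ht')).1.le
      _ = C * pathELength 𝓘(ℝ, E) γ 0 1 := by
        rw [lintegral_const_mul' _ _ ENNReal.coe_ne_top,
            pathELength_eq_lintegral_mfderivWithin_Icc]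
      _ ≤ C * r := by
        gcongr
    have e1 : γ' 1 = extChartAt 𝓘(ℝ, E) x z := by simp only [γ', Function.comp_apply, γ1]
    have e0 : γ' 0 = extChartAt 𝓘(ℝ, E) x y := by simp only [γ', Function.comp_apply, γ0]
    rw [edist_comm, edist_eq_enorm_sub, ← e1, ← e0]
    exact hfin
  have hlim : Filter.Tendsto (fun r : ℝ≥0∞ => (C : ℝ≥0∞) * r) (𝓝[>] (edist y z))
      (𝓝 (C * edist y z)) :=
    (ENNReal.Tendsto.const_mul Filter.tendsto_id (Or.inr ENNReal.coe_ne_top)).mono_left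
      nhdsWithin_le_nhds
  have : (𝓝[>] (edist y z)).NeBot := nhdsGT_neBot_of_exists_gt ⟨_, hyz⟩
  refine ge_of_tendsto hlim ?_
  filter_upwards [Ioc_mem_nhdsGT hyz] with r hr
  exact key r hr.1 hr.2

end Lipschitz

/-! ### Comparison of the Riemannian measure with Lebesgue measure in charts -/

section Measure

open scoped NNReal

variable {n : ℕ} {M : Type*} [EMetricSpace M] [ChartedSpace (EuclideanSpace ℝ (Fin n)) M]

/-- The inverse of the chart at `x₀` is bi-Lipschitz with constant `C` on the closed ball of
radius `r` about the image of `x₀`, and this ball lies in the target of the chart. -/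
structure IsBiLipschitzChart (x₀ : M) (C : ℝ≥0) (r : ℝ) : Prop where
  radius_pos : 0 < r
  subset_target : Metric.closedBall (extChartAt (𝓡 n) x₀ x₀) r ⊆ (extChartAt (𝓡 n) x₀).target
  lipschitz : LipschitzOnWith C (extChartAt (𝓡 n) x₀).symm
    (Metric.closedBall (extChartAt (𝓡 n) x₀ x₀) r)
  antilipschitz : ∀ u ∈ Metric.closedBall (extChartAt (𝓡 n) x₀ x₀) r,
    ∀ v ∈ Metric.closedBall (extChartAt (𝓡 n) x₀ x₀) r,
      edist u v ≤ C * edist ((extChartAt (𝓡 n) x₀).symm u) ((extChartAt (𝓡 n) x₀).symm v)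

lemma exists_isBiLipschitzChart [IsManifold (𝓡 n) ∞ M]
    [RiemannianBundle (fun x : M => TangentSpace (𝓡 n) x)]
    [IsContMDiffRiemannianBundle (𝓡 n) ∞ (EuclideanSpace ℝ (Fin n))
      (fun x : M => TangentSpace (𝓡 n) x)]
    [IsRiemannianManifold (𝓡 n) M] (x₀ : M) :
    ∃ (C : ℝ≥0) (r : ℝ), IsBiLipschitzChart (n := n) x₀ C r := by
  have : IsContinuousRiemannianBundle (EuclideanSpace ℝ (Fin n))
      (fun x : M => TangentSpace (𝓡 n) x) := by
    obtain ⟨g, hg, h⟩ := IsContMDiffRiemannianBundle.exists_contMDiff (IB := 𝓡 n) (n := ∞)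
      (F := EuclideanSpace ℝ (Fin n)) (E := fun x : M => TangentSpace (𝓡 n) x)
    exact ⟨⟨g, hg.continuous, h⟩⟩
  have : IsManifold (𝓡 n) 1 M := IsManifold.of_le (n := ∞) (by norm_cast)
  obtain ⟨C₁, r₁, hr₁, hsub, hlip⟩ :=
    exists_lipschitzOnWith_extChartAt_symm (E := EuclideanSpace ℝ (Fin n)) x₀
  obtain ⟨C₂, s, hs, hlip'⟩ :=
    exists_lipschitzOnWith_extChartAt (E := EuclideanSpace ℝ (Fin n)) x₀
  obtain ⟨r₂, hr₂, hr₂s⟩ := Metric.mem_nhds_iff.1 (extChartAt_preimage_mem_nhds (I := 𝓡 n) hs)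
  have hmin : 0 < min r₁ r₂ / 2 := by positivity
  have hb : Metric.closedBall (extChartAt (𝓡 n) x₀ x₀) (min r₁ r₂ / 2) ⊆
      Metric.ball (extChartAt (𝓡 n) x₀ x₀) (min r₁ r₂) :=
    Metric.closedBall_subset_ball (half_lt_self (by positivity))
  have hb₁ := hb.trans (Metric.ball_subset_ball (min_le_left r₁ r₂))
  have hb₂ := hb.trans (Metric.ball_subset_ball (min_le_right r₁ r₂))
  refine ⟨max C₁ C₂, min r₁ r₂ / 2, hmin, hb₁.trans hsub,
    (hlip.mono hb₁).weaken (le_max_left _ _), fun u hu v hv => ?_⟩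
  have h := hlip' (hr₂s (hb₂ hu)) (hr₂s (hb₂ hv))
  rw [(extChartAt (𝓡 n) x₀).right_inv (hsub (hb₁ hu)),
    (extChartAt (𝓡 n) x₀).right_inv (hsub (hb₁ hv))] at h
  refine h.trans ?_
  gcongr
  exact le_max_right _ _

namespace IsBiLipschitzChart

variable {x₀ : M} {C : ℝ≥0} {r : ℝ}

lemma continuousOn_symm (h : IsBiLipschitzChart (n := n) x₀ C r) :
    ContinuousOn (extChartAt (𝓡 n) x₀).symm (Metric.closedBall (extChartAt (𝓡 n) x₀ x₀) r) :=
  h.lipschitz.continuousOn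

/-- The image of a closed ball under the inverse chart is a neighbourhood of the image of each
interior point. -/
lemma image_closedBall_mem_nhds (h : IsBiLipschitzChart (n := n) x₀ C r)
    {s : Set (EuclideanSpace ℝ (Fin n))} {u : EuclideanSpace ℝ (Fin n)}
    (hu : u ∈ Metric.closedBall (extChartAt (𝓡 n) x₀ x₀) r) (hs : s ∈ 𝓝 u) :
    (extChartAt (𝓡 n) x₀).symm '' s ∈ 𝓝 ((extChartAt (𝓡 n) x₀).symm u) := by
  have hut := h.subset_target hu
  have h1 : (extChartAt (𝓡 n) x₀).symm u ∈ (extChartAt (𝓡 n) x₀).source :=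
    (extChartAt (𝓡 n) x₀).map_target hut
  have hc : ContinuousAt (extChartAt (𝓡 n) x₀) ((extChartAt (𝓡 n) x₀).symm u) :=
    continuousAt_extChartAt' h1
  have h2 : extChartAt (𝓡 n) x₀ ⁻¹' s ∈ 𝓝 ((extChartAt (𝓡 n) x₀).symm u) := by
    apply hc.preimage_mem_nhds
    rwa [(extChartAt (𝓡 n) x₀).right_inv hut]
  filter_upwards [h2, extChartAt_source_mem_nhds' (I := 𝓡 n) h1] with y hy hys
  exact ⟨_, hy, (extChartAt (𝓡 n) x₀).left_inv hys⟩

end IsBiLipschitzChart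

variable [MeasurableSpace M] [BorelSpace M]

lemma euclideanHausdorffMeasure_image_le {X Y : Type*} [EMetricSpace X] [MeasurableSpace X]
    [BorelSpace X] [EMetricSpace Y] [MeasurableSpace Y] [BorelSpace Y] {f : X → Y} {s : Set X}
    {K : ℝ≥0} (h : LipschitzOnWith K f s) (d : ℕ) :
    (μHE[d] : Measure Y) (f '' s) ≤ (K : ℝ≥0∞) ^ d * (μHE[d] : Measure X) s := by
  rw [Measure.euclideanHausdorffMeasure_def, Measure.euclideanHausdorffMeasure_def,
    Measure.smul_apply, Measure.smul_apply, ENNReal.smul_def, ENNReal.smul_def, smul_eq_mul,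
    smul_eq_mul, mul_left_comm]
  gcongr
  have := h.hausdorffMeasure_image_le (d := d) (by positivity)
  rwa [ENNReal.rpow_natCast] at this

namespace IsBiLipschitzChart

variable {x₀ : M} {C : ℝ≥0} {r : ℝ}

lemma measurableSet_image (h : IsBiLipschitzChart (n := n) x₀ C r)
    {A : Set (EuclideanSpace ℝ (Fin n))} (hA : MeasurableSet A)
    (hAr : A ⊆ Metric.closedBall (extChartAt (𝓡 n) x₀ x₀) r) :
    MeasurableSet ((extChartAt (𝓡 n) x₀).symm '' A) :=
  hA.image_of_continuousOn_injOn (h.continuousOn_symm.mono hAr)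
    ((extChartAt (𝓡 n) x₀).symm.injOn.mono (hAr.trans h.subset_target))

lemma measure_image_le (h : IsBiLipschitzChart (n := n) x₀ C r)
    {A : Set (EuclideanSpace ℝ (Fin n))}
    (hAr : A ⊆ Metric.closedBall (extChartAt (𝓡 n) x₀ x₀) r) :
    (μHE[n] : Measure M) ((extChartAt (𝓡 n) x₀).symm '' A) ≤ (C : ℝ≥0∞) ^ n * volume A := by
  rw [← EuclideanSpace.euclideanHausdorffMeasure_eq_volume]
  exact euclideanHausdorffMeasure_image_le (h.lipschitz.mono hAr) n

lemma le_measure_image (h : IsBiLipschitzChart (n := n) x₀ C r)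
    {A : Set (EuclideanSpace ℝ (Fin n))}
    (hAr : A ⊆ Metric.closedBall (extChartAt (𝓡 n) x₀ x₀) r) :
    volume A ≤ (C : ℝ≥0∞) ^ n * (μHE[n] : Measure M) ((extChartAt (𝓡 n) x₀).symm '' A) := by
  rw [← EuclideanSpace.euclideanHausdorffMeasure_eq_volume]
  have hinv : ∀ u ∈ A, extChartAt (𝓡 n) x₀ ((extChartAt (𝓡 n) x₀).symm u) = u := fun u hu =>
    (extChartAt (𝓡 n) x₀).right_inv (h.subset_target (hAr hu))
  have hlip : LipschitzOnWith C (extChartAt (𝓡 n) x₀) ((extChartAt (𝓡 n) x₀).symm '' A) := by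
    rintro _ ⟨u, hu, rfl⟩ _ ⟨v, hv, rfl⟩
    rw [hinv u hu, hinv v hv]
    exact h.antilipschitz u (hAr hu) v (hAr hv)
  have himage : extChartAt (𝓡 n) x₀ '' ((extChartAt (𝓡 n) x₀).symm '' A) = A := by
    rw [image_image]
    exact (image_congr hinv).trans (image_id' A)
  conv_lhs => rw [← himage]
  exact euclideanHausdorffMeasure_image_le hlip n

lemma lintegral_image_le (h : IsBiLipschitzChart (n := n) x₀ C r)
    {A : Set (EuclideanSpace ℝ (Fin n))} (hA : MeasurableSet A)
    (hAr : A ⊆ Metric.closedBall (extChartAt (𝓡 n) x₀ x₀) r) {g : M → ℝ≥0∞} (hg : Measurable g) :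
    ∫⁻ x in (extChartAt (𝓡 n) x₀).symm '' A, g x ∂(μHE[n] : Measure M) ≤
      (C : ℝ≥0∞) ^ n * ∫⁻ u in A, g ((extChartAt (𝓡 n) x₀).symm u) := by
  have hψ : AEMeasurable (extChartAt (𝓡 n) x₀).symm (volume.restrict A) :=
    (h.continuousOn_symm.mono hAr).aemeasurable hA
  have hle : (μHE[n] : Measure M).restrict ((extChartAt (𝓡 n) x₀).symm '' A) ≤
      (C : ℝ≥0∞) ^ n • (volume.restrict A).map (extChartAt (𝓡 n) x₀).symm := by
    refine Measure.le_iff.2 fun S hS => ?_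
    rw [Measure.restrict_apply hS, Measure.smul_apply, Measure.map_apply_of_aemeasurable hψ hS,
      Measure.restrict_apply' hA, smul_eq_mul, inter_comm, ← image_inter_preimage, inter_comm]
    exact h.measure_image_le (inter_subset_right.trans hAr)
  refine (lintegral_mono' hle le_rfl).trans_eq ?_
  rw [lintegral_smul_measure, lintegral_map' hg.aemeasurable hψ, smul_eq_mul]

lemma le_lintegral_image (h : IsBiLipschitzChart (n := n) x₀ C r)
    {A : Set (EuclideanSpace ℝ (Fin n))} (hA : MeasurableSet A)
    (hAr : A ⊆ Metric.closedBall (extChartAt (𝓡 n) x₀ x₀) r) {g : M → ℝ≥0∞} (hg : Measurable g) :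
    ∫⁻ u in A, g ((extChartAt (𝓡 n) x₀).symm u) ≤
      (C : ℝ≥0∞) ^ n * ∫⁻ x in (extChartAt (𝓡 n) x₀).symm '' A, g x ∂(μHE[n] : Measure M) := by
  have hψ : AEMeasurable (extChartAt (𝓡 n) x₀).symm (volume.restrict A) :=
    (h.continuousOn_symm.mono hAr).aemeasurable hA
  have hle : (volume.restrict A).map (extChartAt (𝓡 n) x₀).symm ≤
      (C : ℝ≥0∞) ^ n • (μHE[n] : Measure M).restrict ((extChartAt (𝓡 n) x₀).symm '' A) := by
    refine Measure.le_iff.2 fun S hS => ?_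
    rw [Measure.smul_apply, Measure.restrict_apply hS, Measure.map_apply_of_aemeasurable hψ hS,
      Measure.restrict_apply' hA, smul_eq_mul, inter_comm S, ← image_inter_preimage, inter_comm]
    exact h.le_measure_image (inter_subset_left.trans hAr)
  rw [← lintegral_map' hg.aemeasurable hψ]
  refine (lintegral_mono' hle le_rfl).trans_eq ?_
  rw [lintegral_smul_measure, smul_eq_mul]

/-- Near `x₀`, metric balls of radius `s` have measure comparable to `s ^ n`. -/
lemma exists_measure_eball_bounds (h : IsBiLipschitzChart (n := n) x₀ C r) :
    ∃ s₀ : ℝ, 0 < s₀ ∧ ∃ a b : ℝ, 0 < a ∧ 0 < b ∧ ∀ x ∈ Metric.eball x₀ (ENNReal.ofReal s₀),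
      ∀ s : ℝ, 0 < s → s ≤ s₀ →
        ENNReal.ofReal (a * s ^ n) ≤ (μHE[n] : Measure M) (Metric.eball x (ENNReal.ofReal s)) ∧
        (μHE[n] : Measure M) (Metric.eball x (ENNReal.ofReal s)) ≤ ENNReal.ofReal (b * s ^ n) := by
  set c := extChartAt (𝓡 n) x₀ x₀ with hc
  set ψ := (extChartAt (𝓡 n) x₀).symm with hψ
  have hψc : ψ c = x₀ := by simp [hψ, hc]
  have hrpos := h.radius_pos
  have hnhds : ψ '' Metric.closedBall c (r / 2) ∈ 𝓝 x₀ := by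
    have := h.image_closedBall_mem_nhds (u := c) (Metric.mem_closedBall_self hrpos.le)
      (Metric.closedBall_mem_nhds c (half_pos hrpos))
    rwa [← hψ, hψc] at this
  obtain ⟨ε, hε, hεs⟩ := EMetric.mem_nhds_iff.1 hnhds
  obtain ⟨δ, hδ, hδε⟩ : ∃ δ : ℝ, 0 < δ ∧ ENNReal.ofReal (2 * δ) ≤ ε := by
    rcases eq_or_ne ε ⊤ with rfl | hne
    · exact ⟨1, one_pos, le_top⟩
    · refine ⟨ε.toReal / 2, half_pos (ENNReal.toReal_pos hε.ne' hne), ?_⟩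
      rw [mul_div_cancel₀ _ two_ne_zero, ENNReal.ofReal_toReal hne]
  set K : ℝ := (C : ℝ) + 1 with hK
  have hKpos : 0 < K := by positivity
  have hK1 : 1 ≤ K := by rw [hK]; linarith [C.2]
  have hCK : (C : ℝ≥0∞) ≤ ENNReal.ofReal K := by
    rw [← ENNReal.ofReal_coe_nnreal]
    exact ENNReal.ofReal_le_ofReal (by linarith)
  have hCKn : (C : ℝ≥0∞) ^ n ≤ ENNReal.ofReal (K ^ n) := by
    rw [ENNReal.ofReal_pow hKpos.le]; gcongr
  set β : ℝ := (volume (Metric.ball (0 : EuclideanSpace ℝ (Fin n)) 1)).toReal with hβ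
  have hβpos : 0 < β :=
    ENNReal.toReal_pos (Metric.measure_ball_pos _ _ one_pos).ne' measure_ball_lt_top.ne
  have hvol : ∀ (u : EuclideanSpace ℝ (Fin n)) (t : ℝ), 0 < t →
      volume (Metric.ball u t) = ENNReal.ofReal (t ^ n * β) := by
    intro u t ht
    rw [Measure.addHaar_ball_of_pos _ _ ht, finrank_euclideanSpace_fin,
      ENNReal.ofReal_mul (by positivity), hβ, ENNReal.ofReal_toReal measure_ball_lt_top.ne]
  refine ⟨min δ (r / 2), by positivity, β / K ^ (2 * n), K ^ (2 * n) * β, by positivity,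
    by positivity, fun x hx s hs hs' => ?_⟩
  have hsδ : s ≤ δ := hs'.trans (min_le_left _ _)
  have hsr : s ≤ r / 2 := hs'.trans (min_le_right _ _)
  have hsub : Metric.eball x (ENNReal.ofReal s) ⊆ ψ '' Metric.closedBall c (r / 2) := by
    refine Subset.trans (fun y hy => ?_) hεs
    have h1 : edist y x₀ < ENNReal.ofReal s + ENNReal.ofReal (min δ (r / 2)) :=
      (edist_triangle y x x₀).trans_lt (ENNReal.add_lt_add hy hx)
    refine h1.trans_le (le_trans ?_ hδε)
    rw [← ENNReal.ofReal_add hs.le (by positivity)]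
    exact ENNReal.ofReal_le_ofReal (by linarith [min_le_left δ (r / 2)])
  obtain ⟨u, hu, hux⟩ := hsub (Metric.mem_eball_self (ENNReal.ofReal_pos.2 hs))
  have hur : u ∈ Metric.closedBall c r := Metric.closedBall_subset_closedBall (by linarith) hu
  constructor
  · have hball : Metric.ball u (s / K) ⊆ Metric.closedBall c r := by
      intro v hv
      have h1 : dist v c ≤ dist v u + dist u c := dist_triangle _ _ _
      have h2 : s / K ≤ s := div_le_self hs.le hK1
      have h3 : dist v u < s / K := hv
      have h4 : dist u c ≤ r / 2 := hu
      rw [Metric.mem_closedBall]; linarith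
    have himg : ψ '' Metric.ball u (s / K) ⊆ Metric.eball x (ENNReal.ofReal s) := by
      rintro _ ⟨v, hv, rfl⟩
      rw [← hux, Metric.mem_eball]
      refine (h.lipschitz (hball hv) hur).trans_lt ?_
      have h1 : edist v u < ENNReal.ofReal (s / K) := by
        rw [edist_dist]; exact (ENNReal.ofReal_lt_ofReal_iff (by positivity)).2 hv
      calc (C : ℝ≥0∞) * edist v u ≤ ENNReal.ofReal K * edist v u := by gcongr
        _ < ENNReal.ofReal K * ENNReal.ofReal (s / K) := by
          refine (ENNReal.mul_lt_mul_iff_right ?_ ENNReal.ofReal_ne_top).2 h1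
          exact (ENNReal.ofReal_pos.2 hKpos).ne'
        _ = ENNReal.ofReal s := by
          rw [← ENNReal.ofReal_mul hKpos.le, mul_div_cancel₀ _ hKpos.ne']
    have h1 := h.le_measure_image hball
    rw [hvol u _ (by positivity)] at h1
    have h2 : ENNReal.ofReal ((s / K) ^ n * β) ≤
        ENNReal.ofReal (K ^ n) * (μHE[n] : Measure M) (Metric.eball x (ENNReal.ofReal s)) :=
      h1.trans (mul_le_mul' hCKn (measure_mono himg))
    have h3 : ENNReal.ofReal ((s / K) ^ n * β) =
        ENNReal.ofReal (K ^ n) * ENNReal.ofReal (β / K ^ (2 * n) * s ^ n) := by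
      rw [← ENNReal.ofReal_mul (by positivity)]
      congr 1
      rw [div_pow, pow_mul', sq]
      field_simp
    rw [h3] at h2
    exact (ENNReal.mul_le_mul_iff_right (ENNReal.ofReal_pos.2 (by positivity)).ne'
      ENNReal.ofReal_ne_top).1 h2
  · have himg : Metric.eball x (ENNReal.ofReal s) ⊆
        ψ '' (Metric.closedBall c r ∩ Metric.ball u (K * s)) := by
      intro y hy
      obtain ⟨v, hv, rfl⟩ := hsub hy
      have hvr : v ∈ Metric.closedBall c r := Metric.closedBall_subset_closedBall (by linarith) hv
      refine ⟨v, ⟨hvr, ?_⟩, rfl⟩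
      have h1 := h.antilipschitz v hvr u hur
      rw [← hux, Metric.mem_eball] at hy
      have h2 : edist v u < ENNReal.ofReal (K * s) := by
        rw [ENNReal.ofReal_mul hKpos.le]
        calc edist v u ≤ C * edist (ψ v) (ψ u) := h1
          _ ≤ ENNReal.ofReal K * edist (ψ v) (ψ u) := by gcongr
          _ < ENNReal.ofReal K * ENNReal.ofReal s := by
            refine (ENNReal.mul_lt_mul_iff_right ?_ ENNReal.ofReal_ne_top).2 hy
            exact (ENNReal.ofReal_pos.2 hKpos).ne'
      rw [edist_dist] at h2
      exact (ENNReal.ofReal_lt_ofReal_iff (by positivity)).1 h2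
    calc (μHE[n] : Measure M) (Metric.eball x (ENNReal.ofReal s))
        ≤ (C : ℝ≥0∞) ^ n * volume (Metric.closedBall c r ∩ Metric.ball u (K * s)) :=
          (measure_mono himg).trans (h.measure_image_le inter_subset_left)
      _ ≤ ENNReal.ofReal (K ^ n) * ENNReal.ofReal ((K * s) ^ n * β) := by
          rw [← hvol u _ (by positivity)]
          exact mul_le_mul' hCKn (measure_mono inter_subset_right)
      _ = ENNReal.ofReal (K ^ (2 * n) * β * s ^ n) := by
          rw [← ENNReal.ofReal_mul (by positivity)]
          congr 1
          rw [mul_pow, pow_mul', sq]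
          ring

end IsBiLipschitzChart

variable [CompactSpace M]

lemma isFiniteMeasure_of_isBiLipschitzChart
    (hM : ∀ x₀ : M, ∃ (C : ℝ≥0) (r : ℝ), IsBiLipschitzChart (n := n) x₀ C r) :
    IsFiniteMeasure (μHE[n] : Measure M) := by
  have : IsLocallyFiniteMeasure (μHE[n] : Measure M) := by
    refine ⟨fun x₀ => ?_⟩
    obtain ⟨C, r, h⟩ := hM x₀
    refine ⟨(extChartAt (𝓡 n) x₀).symm '' Metric.closedBall (extChartAt (𝓡 n) x₀ x₀) r, ?_, ?_⟩
    · have := h.image_closedBall_mem_nhds (Metric.mem_closedBall_self h.radius_pos.le)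
        (Metric.closedBall_mem_nhds _ h.radius_pos)
      rwa [extChartAt_to_inv] at this
    · refine (h.measure_image_le subset_rfl).trans_lt ?_
      exact ENNReal.mul_lt_top (ENNReal.pow_lt_top ENNReal.coe_lt_top)
        measure_closedBall_lt_top
  exact CompactSpace.isFiniteMeasure

/-- On a compact manifold, the measures of metric balls of bounded radius are uniformly comparable
to the `n`-th power of the radius. -/
lemma exists_uniform_measure_eball_bounds [Nonempty M]
    (hM : ∀ x₀ : M, ∃ (C : ℝ≥0) (r : ℝ), IsBiLipschitzChart (n := n) x₀ C r) (R : ℝ)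
    (hR : 0 < R) :
    ∃ a b : ℝ, 0 < a ∧ 0 < b ∧ ∀ (x : M) (s : ℝ), 0 < s → s ≤ R →
      ENNReal.ofReal (a * s ^ n) ≤ (μHE[n] : Measure M) (Metric.eball x (ENNReal.ofReal s)) ∧
      (μHE[n] : Measure M) (Metric.eball x (ENNReal.ofReal s)) ≤ ENNReal.ofReal (b * s ^ n) := by
  have hfin := isFiniteMeasure_of_isBiLipschitzChart hM
  have hloc : ∀ x₀ : M, ∃ s₀ : ℝ, 0 < s₀ ∧ ∃ a b : ℝ, 0 < a ∧ 0 < b ∧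
      ∀ x ∈ Metric.eball x₀ (ENNReal.ofReal s₀), ∀ s : ℝ, 0 < s → s ≤ s₀ →
        ENNReal.ofReal (a * s ^ n) ≤ (μHE[n] : Measure M) (Metric.eball x (ENNReal.ofReal s)) ∧
        (μHE[n] : Measure M) (Metric.eball x (ENNReal.ofReal s)) ≤ ENNReal.ofReal (b * s ^ n) := by
    intro x₀
    obtain ⟨C, r, h⟩ := hM x₀
    exact h.exists_measure_eball_bounds
  choose s₀ hs₀ a b ha hb hab using hloc
  obtain ⟨t, -, ht⟩ := isCompact_univ.elim_nhds_subcover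
    (fun x₀ : M => Metric.eball x₀ (ENNReal.ofReal (s₀ x₀)))
    (fun x₀ _ => Metric.eball_mem_nhds _ (ENNReal.ofReal_pos.2 (hs₀ x₀)))
  have htne : t.Nonempty := by
    obtain ⟨x⟩ := ‹Nonempty M›
    obtain ⟨y, hy, -⟩ := mem_iUnion₂.1 (ht (mem_univ x))
    exact ⟨y, hy⟩
  obtain ⟨i, hi, hs⟩ := t.exists_min_image s₀ htne
  obtain ⟨j, hj, ha'⟩ := t.exists_min_image a htne
  obtain ⟨k, hk, hb'⟩ := t.exists_max_image b htne
  set σ := s₀ i with hσ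
  have hσpos : 0 < σ := hs₀ i
  set V : ℝ := ((μHE[n] : Measure M) univ).toReal with hV
  have hVnn : 0 ≤ V := ENNReal.toReal_nonneg
  -- Radii between `σ` and `R` are handled by monotonicity and by the total measure.
  have hsmall : ∀ (x : M) (s : ℝ), 0 < s → s ≤ σ →
      ENNReal.ofReal (a j * s ^ n) ≤ (μHE[n] : Measure M) (Metric.eball x (ENNReal.ofReal s)) ∧
      (μHE[n] : Measure M) (Metric.eball x (ENNReal.ofReal s)) ≤
        ENNReal.ofReal (b k * s ^ n) := by
    intro x s hs1 hs2
    obtain ⟨y, hy, hxy⟩ := mem_iUnion₂.1 (ht (mem_univ x))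
    obtain ⟨h1, h2⟩ := hab y x hxy s hs1 (hs2.trans (hs y hy))
    refine ⟨le_trans (ENNReal.ofReal_le_ofReal ?_) h1,
      h2.trans (ENNReal.ofReal_le_ofReal ?_)⟩
    · exact mul_le_mul_of_nonneg_right (ha' y hy) (by positivity)
    · exact mul_le_mul_of_nonneg_right (hb' y hy) (by positivity)
  set τ := min 1 (σ / R) with hτ
  have hτpos : 0 < τ := by positivity
  refine ⟨a j * τ ^ n, b k + V / σ ^ n, by have := ha j; positivity,
    by have := hb k; positivity, fun x s hs1 hs2 => ⟨?_, ?_⟩⟩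
  · have h1 : τ * s ≤ σ := by
      calc τ * s ≤ σ / R * R := mul_le_mul (min_le_right _ _) hs2 hs1.le (by positivity)
        _ = σ := by field_simp
    have h2 : τ * s ≤ s := by
      calc τ * s ≤ 1 * s := mul_le_mul_of_nonneg_right (min_le_left _ _) hs1.le
        _ = s := one_mul s
    have h3 := (hsmall x (τ * s) (by positivity) h1).1
    rw [mul_pow, ← mul_assoc] at h3
    exact h3.trans (measure_mono (Metric.eball_subset_eball (ENNReal.ofReal_le_ofReal h2)))
  · rcases le_total s σ with hle | hle
    · refine (hsmall x s hs1 hle).2.trans (ENNReal.ofReal_le_ofReal ?_)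
      refine mul_le_mul_of_nonneg_right ?_ (by positivity)
      have : 0 ≤ V / σ ^ n := by positivity
      linarith
    · refine (measure_mono (subset_univ _)).trans ?_
      rw [← ENNReal.ofReal_toReal (measure_ne_top (μHE[n] : Measure M) univ), ← hV]
      refine ENNReal.ofReal_le_ofReal ?_
      have h1 : σ ^ n ≤ s ^ n := by gcongr
      calc V = V / σ ^ n * σ ^ n := by field_simp
        _ ≤ V / σ ^ n * s ^ n := by gcongr
        _ ≤ (b k + V / σ ^ n) * s ^ n := by
          have := hb k
          gcongr
          linarith

end Measure

/-! ### The cardinality of metric lattices -/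

section Lattice

variable {M : Type*} [EMetricSpace M] [MeasurableSpace M]

/-- Packing bound: the disjoint balls of a metric lattice have total measure at most that of the
space. -/
lemma IsMetricLattice.finite_and_ncard_mul_le [BorelSpace M] {N : ℕ} {ρ : ℝ} {S : Set M}
    (hS : IsMetricLattice N ρ S) (μ : Measure M) [IsFiniteMeasure μ] {m : ℝ} (hm : 0 < m)
    (h : ∀ x : M, ENNReal.ofReal m ≤ μ (Metric.eball x (ENNReal.ofReal (ρ / 4)))) :
    S.Finite ∧ (S.ncard : ℝ) * m ≤ (μ univ).toReal := by
  have hT : ∀ T : Finset M, (T : Set M) ⊆ S → (T.card : ℝ) * m ≤ (μ univ).toReal := by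
    intro T hTS
    have h1 : ∑ x ∈ T, μ (Metric.eball x (ENNReal.ofReal (ρ / 4))) ≤ μ univ := by
      rw [← measure_biUnion_finset (hS.disjoint_balls.subset hTS)
        fun x _ => Metric.isOpen_eball.measurableSet]
      exact measure_mono (subset_univ _)
    have h2 : (T.card : ℝ≥0∞) * ENNReal.ofReal m ≤ μ univ := by
      refine le_trans ?_ h1
      rw [← nsmul_eq_mul]
      exact Finset.card_nsmul_le_sum _ _ _ fun x _ => h x
    have h3 := ENNReal.toReal_mono (measure_ne_top μ univ) h2
    rwa [ENNReal.toReal_mul, ENNReal.toReal_natCast, ENNReal.toReal_ofReal hm.le] at h3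
  have hfin : S.Finite := by
    by_contra hinf
    obtain ⟨k, hk⟩ := exists_nat_gt ((μ univ).toReal / m)
    obtain ⟨T, hTS, hTk⟩ := Set.Infinite.exists_subset_card_eq hinf k
    have := hT T hTS
    rw [hTk] at this
    rw [div_lt_iff₀ hm] at hk
    linarith
  refine ⟨hfin, ?_⟩
  rw [Set.ncard_eq_toFinset_card S hfin]
  exact hT _ (by simp)

/-- Covering bound: the balls of a metric lattice that cover the space have total measure at least
that of the space. -/
lemma IsMetricLattice.le_ncard_mul {N : ℕ} {ρ : ℝ} {S : Set M}
    (hS : IsMetricLattice N ρ S) (hfin : S.Finite) (μ : Measure M) {m : ℝ}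
    (hm : 0 ≤ m) (h : ∀ x : M, μ (Metric.eball x (ENNReal.ofReal (ρ / 2))) ≤ ENNReal.ofReal m) :
    (μ univ).toReal ≤ (S.ncard : ℝ) * m := by
  have h1 : μ univ ≤ (S.ncard : ℝ≥0∞) * ENNReal.ofReal m := by
    rw [← hS.cover, Set.ncard_eq_toFinset_card S hfin, ← nsmul_eq_mul]
    have : (⋃ y ∈ S, Metric.eball y (ENNReal.ofReal (ρ / 2))) =
        ⋃ y ∈ hfin.toFinset, Metric.eball y (ENNReal.ofReal (ρ / 2)) := by simp
    rw [this]
    exact (measure_biUnion_finset_le _ _).trans (Finset.sum_le_card_nsmul _ _ _ fun x _ => h x)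
  have h2 := ENNReal.toReal_mono (by finiteness) h1
  rwa [ENNReal.toReal_mul, ENNReal.toReal_natCast, ENNReal.toReal_ofReal hm] at h2

open scoped NNReal in
/-- The number of nodes of a metric lattice of mesh `c₀ * w ^ (-1 / 2)` is comparable to
`w ^ (n / 2)`, whatever the multiplicity bound. -/
lemma exists_ncard_bounds {n : ℕ} [BorelSpace M] [ChartedSpace (EuclideanSpace ℝ (Fin n)) M]
    [CompactSpace M] [Nonempty M]
    (hM : ∀ x₀ : M, ∃ (C : ℝ≥0) (r : ℝ), IsBiLipschitzChart (n := n) x₀ C r)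
    {c₀ w₀ : ℝ} (hc₀ : 0 < c₀) (hw₀ : 0 < w₀) :
    ∃ a₁ a₂ : ℝ, 0 < a₁ ∧ 0 < a₂ ∧
      ∀ w : ℝ, w₀ ≤ w → ∀ (N : ℕ) (S : Set M),
        IsMetricLattice N (c₀ * w ^ (-(1 / 2) : ℝ)) S →
          S.Finite ∧
          a₁ * w ^ ((n : ℝ) / 2) ≤ (S.ncard : ℝ) ∧
          (S.ncard : ℝ) ≤ a₂ * w ^ ((n : ℝ) / 2) := by
  have hfin := isFiniteMeasure_of_isBiLipschitzChart hM
  have hRpos : 0 < c₀ * w₀ ^ (-(1 / 2) : ℝ) := by positivity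
  obtain ⟨a, b, ha, hb, hab⟩ := exists_uniform_measure_eball_bounds hM _ hRpos
  set V : ℝ := ((μHE[n] : Measure M) univ).toReal with hV
  have hVpos : 0 < V := by
    obtain ⟨x⟩ := ‹Nonempty M›
    have h1 := (hab x _ hRpos le_rfl).1
    refine ENNReal.toReal_pos (fun h0 => ?_) (measure_ne_top _ _)
    have h2 := h1.trans (measure_mono (subset_univ _))
    rw [h0, nonpos_iff_eq_zero, ENNReal.ofReal_eq_zero] at h2
    have : 0 < a * (c₀ * w₀ ^ (-(1 / 2) : ℝ)) ^ n := by positivity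
    linarith
  refine ⟨V / (b * (c₀ / 2) ^ n), V / (a * (c₀ / 4) ^ n), by positivity, by positivity,
    fun w hw N S hS => ?_⟩
  have hwpos : 0 < w := hw₀.trans_le hw
  set ρ := c₀ * w ^ (-(1 / 2) : ℝ) with hρ
  have hρpos : 0 < ρ := by positivity
  have hρR : ρ ≤ c₀ * w₀ ^ (-(1 / 2) : ℝ) := by
    refine mul_le_mul_of_nonneg_left ?_ hc₀.le
    exact Real.rpow_le_rpow_of_nonpos hw₀ hw (by norm_num)
  have hpow : ∀ c : ℝ, (ρ / c) ^ n * w ^ ((n : ℝ) / 2) = (c₀ / c) ^ n := by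
    intro c
    have h1 : w ^ ((n : ℝ) / 2) = (w ^ ((1 : ℝ) / 2)) ^ n := by
      rw [← Real.rpow_natCast, ← Real.rpow_mul hwpos.le]; congr 1; ring
    rw [h1, ← mul_pow, hρ]
    congr 1
    rw [Real.rpow_neg hwpos.le]
    field_simp
  have hWpos : 0 < w ^ ((n : ℝ) / 2) := by positivity
  obtain ⟨hSfin, hup⟩ := hS.finite_and_ncard_mul_le (μHE[n] : Measure M)
    (m := a * (ρ / 4) ^ n) (by positivity)
    fun x => (hab x (ρ / 4) (by positivity) (by linarith)).1
  have hlow := hS.le_ncard_mul hSfin (μHE[n] : Measure M) (m := b * (ρ / 2) ^ n) (by positivity)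
    fun x => (hab x (ρ / 2) (by positivity) (by linarith)).2
  rw [← hV] at hup hlow
  refine ⟨hSfin, ?_, ?_⟩
  · rw [div_mul_eq_mul_div, div_le_iff₀ (by positivity), ← hpow 2]
    calc V * w ^ ((n : ℝ) / 2) ≤ (S.ncard : ℝ) * (b * (ρ / 2) ^ n) * w ^ ((n : ℝ) / 2) :=
          mul_le_mul_of_nonneg_right hlow hWpos.le
      _ = (S.ncard : ℝ) * (b * ((ρ / 2) ^ n * w ^ ((n : ℝ) / 2))) := by ring
  · rw [div_mul_eq_mul_div, le_div_iff₀ (by positivity), ← hpow 4]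
    calc (S.ncard : ℝ) * (a * ((ρ / 4) ^ n * w ^ ((n : ℝ) / 2)))
        = (S.ncard : ℝ) * (a * (ρ / 4) ^ n) * w ^ ((n : ℝ) / 2) := by ring
      _ ≤ V * w ^ ((n : ℝ) / 2) := mul_le_mul_of_nonneg_right hup hWpos.le

end Lattice

/-! ### Point derivations and Hadamard's lemma -/

section Hadamard

/-- Smooth dependence on a parameter of the averages of a smooth function over the segments from
a fixed point. The integral is written as a convolution with a cut-off kernel. -/
lemma contDiff_integral_lineMap {E F : Type*} [NormedAddCommGroup E] [NormedSpace ℝ E]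
    [NormedAddCommGroup F] [NormedSpace ℝ F] {f : E → F} (hf : ContDiff ℝ ∞ f)
    (c : E) : ContDiff ℝ ∞ fun u => ∫ t in (0 : ℝ)..1, f (c + t • (u - c)) := by
  let η : ContDiffBump (0 : ℝ) := ⟨1, 2, one_pos, one_lt_two⟩
  let g : E → ℝ → F := fun u s => η s • f (c + (-s) • (u - c))
  have hη : ContDiff ℝ ∞ (η : ℝ → ℝ) := η.contDiff
  have hg : ContDiff ℝ ∞ (fun q : E × ℝ => g q.1 q.2) := by
    refine (hη.comp contDiff_snd).smul (hf.comp ?_)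
    fun_prop
  have hk : IsCompact (Metric.closedBall (0 : ℝ) 2) := isCompact_closedBall _ _
  have hloc : LocallyIntegrable (indicator (Icc (0 : ℝ) 1) fun _ => (1 : ℝ)) volume :=
    (IntegrableOn.integrable_indicator (integrableOn_const (by simp))
      measurableSet_Icc).locallyIntegrable
  have key := contDiffOn_convolution_right_with_param_comp (μ := volume) (n := ⊤)
    (ContinuousLinearMap.lsmul ℝ ℝ) (s := (univ : Set E)) (v := fun _ => (0 : ℝ))
    contDiffOn_const (g := g) isOpen_univ hk
    (fun u s _ hs => by
      have : η s = 0 := by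
        refine η.zero_of_le_dist ?_
        rw [Metric.mem_closedBall, not_le] at hs
        exact hs.le
      simp [g, this]) hloc hg.contDiffOn
  rw [contDiffOn_univ] at key
  convert key using 2 with u
  rw [intervalIntegral.integral_of_le zero_le_one, ← integral_Icc_eq_integral_Ioc,
    ← integral_indicator measurableSet_Icc, convolution]
  refine integral_congr_ae (Filter.Eventually.of_forall fun t => ?_)
  by_cases ht : t ∈ Icc (0 : ℝ) 1
  · have h1 : η (0 - t) = 1 := by
      refine η.one_of_mem_closedBall ?_
      rw [Metric.mem_closedBall, dist_zero_right, zero_sub, norm_neg, Real.norm_eq_abs, abs_le]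
      exact ⟨by linarith [ht.1], ht.2⟩
    simp only [indicator_of_mem ht, ContinuousLinearMap.lsmul_apply, g, h1, one_smul]
    simp
  · simp [indicator_of_notMem ht]

/-- **Hadamard's lemma**, with smooth coefficients of the remainder. -/
lemma exists_contDiff_eq_add_apply {E : Type*} [NormedAddCommGroup E] [NormedSpace ℝ E]
    {f : E → ℝ} (hf : ContDiff ℝ ∞ f) (c : E) :
    ∃ g : E → (E →L[ℝ] ℝ), ContDiff ℝ ∞ g ∧ g c = fderiv ℝ f c ∧
      ∀ u, f u = f c + g u (u - c) := by
  have hf' : ContDiff ℝ ∞ (fderiv ℝ f) := hf.fderiv_right (by norm_cast)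
  refine ⟨_, contDiff_integral_lineMap hf' c, by simp, fun u => ?_⟩
  have hline : ∀ t : ℝ, HasDerivAt (fun t : ℝ => f (c + t • (u - c)))
      (fderiv ℝ f (c + t • (u - c)) (u - c)) t := by
    intro t
    have h1 : HasDerivAt (fun t : ℝ => c + t • (u - c)) (u - c) t := by
      simpa using ((hasDerivAt_id t).smul_const (u - c)).const_add c
    exact ((hf.differentiable (by simp)).differentiableAt.hasFDerivAt).comp_hasDerivAt t h1
  have hcont : Continuous fun t : ℝ => fderiv ℝ f (c + t • (u - c)) :=
    hf'.continuous.comp (by fun_prop)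
  have hint := intervalIntegral.integral_eq_sub_of_hasDerivAt (fun t _ => hline t)
    ((hcont.clm_apply continuous_const).intervalIntegrable 0 1)
  rw [ContinuousLinearMap.intervalIntegral_apply (hcont.intervalIntegrable 0 1), hint]
  simp

variable {n : ℕ} {M : Type*} [TopologicalSpace M]
  [ChartedSpace (EuclideanSpace ℝ (Fin n)) M]

lemma fderiv_comp_extChartAt_symm_eq_zero {x : M} {f : C^∞⟮𝓡 n, M; ℝ⟯}
    (hf : mfderiv (𝓡 n) 𝓘(ℝ, ℝ) f x = 0) :
    fderiv ℝ (fun u => f ((extChartAt (𝓡 n) x).symm u)) (extChartAt (𝓡 n) x x) = 0 := by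
  have hd : MDifferentiableAt (𝓡 n) 𝓘(ℝ, ℝ) f x := f.contMDiff.mdifferentiableAt (by simp)
  rw [hd.mfderiv] at hf
  have h : fderivWithin ℝ (fun u => f ((extChartAt (𝓡 n) x).symm u)) (range (𝓡 n))
      (extChartAt (𝓡 n) x x) = 0 := hf
  rwa [ModelWithCorners.range_eq_univ, fderivWithin_univ] at h

variable [IsManifold (𝓡 n) ∞ M]

/-- A smooth function on a manifold, read in a chart, agrees near the base point with a smooth
function on the model space. -/
lemma exists_contDiff_eventuallyEq (x : M) (f : C^∞⟮𝓡 n, M; ℝ⟯) :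
    ∃ F : EuclideanSpace ℝ (Fin n) → ℝ, ContDiff ℝ ∞ F ∧
      ∀ᶠ u in 𝓝 (extChartAt (𝓡 n) x x), F u = f ((extChartAt (𝓡 n) x).symm u) := by
  obtain ⟨r, hr, hrt⟩ := Metric.mem_nhds_iff.1 (extChartAt_target_mem_nhds (I := 𝓡 n) x)
  let η : ContDiffBump (extChartAt (𝓡 n) x x) := ⟨r / 3, r / 2, by positivity, by linarith⟩
  refine ⟨fun u => η u • f ((extChartAt (𝓡 n) x).symm u), ?_, ?_⟩
  · rw [← contMDiff_iff_contDiff]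
    refine contMDiff_of_tsupport fun u hu => ?_
    have hut : u ∈ (extChartAt (𝓡 n) x).target := by
      have h1 := tsupport_smul_subset_left _ _ hu
      rw [η.tsupport_eq] at h1
      exact hrt (Metric.closedBall_subset_ball (by change r / 2 < r; linarith) h1)
    have h2 : ContMDiffAt 𝓘(ℝ, EuclideanSpace ℝ (Fin n)) (𝓡 n) ∞ (extChartAt (𝓡 n) x).symm u :=
      (contMDiffOn_extChartAt_symm x).contMDiffAt
        ((isOpen_extChartAt_target x).mem_nhds hut)
    exact η.contDiff.contMDiff.contMDiffAt.smul (f.contMDiff.contMDiffAt.comp u h2)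
  · filter_upwards [η.eventuallyEq_one] with u hu
    rw [hu]; simp

variable [T2Space M]

/-- The smooth function on `M` that agrees with `g` read in the chart at `c` where the bump function
`χ` equals `1`, and vanishes outside the support of `χ`. -/
noncomputable def bumpLift {c : M} (χ : SmoothBumpFunction (𝓡 n) c)
    (g : EuclideanSpace ℝ (Fin n) → ℝ) (hg : ContDiff ℝ ∞ g) : C^∞⟮𝓡 n, M; ℝ⟯ :=
  ⟨fun x => χ x • g (extChartAt (𝓡 n) c x),
    χ.contMDiff_smul (hg.contMDiff.comp_contMDiffOn contMDiffOn_extChartAt)⟩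

lemma bumpLift_apply {c : M} (χ : SmoothBumpFunction (𝓡 n) c)
    {g : EuclideanSpace ℝ (Fin n) → ℝ} (hg : ContDiff ℝ ∞ g) (x : M) :
    bumpLift χ g hg x = χ x * g (extChartAt (𝓡 n) c x) := rfl

/-- A linear functional on smooth functions satisfying the Leibniz rule at `x` is local. -/
lemma apply_eq_zero_of_eventuallyEq_zero {x : M} {δ : C^∞⟮𝓡 n, M; ℝ⟯ →ₗ[ℝ] ℝ}
    (hδ : ∀ f g, δ (f * g) = f x * δ g + g x * δ f) {f : C^∞⟮𝓡 n, M; ℝ⟯}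
    (hf : ∀ᶠ y in 𝓝 x, f y = 0) : δ f = 0 := by
  obtain ⟨χ, -, hχ⟩ := (SmoothBumpFunction.nhds_basis_support (I := 𝓡 n) (c := x) hf).mem_iff.1 hf
  have hprod : bumpLift χ (fun _ => 1) contDiff_const * f = 0 := by
    ext y
    change bumpLift χ (fun _ => 1) contDiff_const y * f y = 0
    rw [bumpLift_apply]
    by_cases hy : χ y = 0
    · simp [hy]
    · have : f y = 0 := hχ hy
      simp [this]
  have h := hδ (bumpLift χ (fun _ => 1) contDiff_const) f
  rw [hprod, map_zero, bumpLift_apply, χ.eq_one, hf.self_of_nhds] at h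
  simpa using h.symm

/-- A linear functional on smooth functions satisfying the Leibniz rule at `x` depends only on the
differential at `x`. -/
lemma apply_eq_zero_of_mfderiv_eq_zero {x : M} {δ : C^∞⟮𝓡 n, M; ℝ⟯ →ₗ[ℝ] ℝ}
    (hδ : ∀ f g, δ (f * g) = f x * δ g + g x * δ f) {f : C^∞⟮𝓡 n, M; ℝ⟯}
    (hf : mfderiv (𝓡 n) 𝓘(ℝ, ℝ) f x = 0) : δ f = 0 := by
  obtain ⟨F, hF, hFf⟩ := exists_contDiff_eventuallyEq x f
  obtain ⟨g, hg, hgc, hFg⟩ := exists_contDiff_eq_add_apply hF (extChartAt (𝓡 n) x x)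
  set c := extChartAt (𝓡 n) x x with hc
  have hg0 : g c = 0 := by
    rw [hgc, Filter.EventuallyEq.fderiv_eq hFf]
    exact fderiv_comp_extChartAt_symm_eq_zero hf
  have hone : δ 1 = 0 := by
    have h := hδ 1 1
    have h1 : (1 : C^∞⟮𝓡 n, M; ℝ⟯) x = 1 := rfl
    rw [mul_one, h1] at h
    linarith
  obtain ⟨χ⟩ : Nonempty (SmoothBumpFunction (𝓡 n) x) := inferInstance
  let p : Fin n → C^∞⟮𝓡 n, M; ℝ⟯ := fun i => bumpLift χ (fun u => u i - c i) (by fun_prop)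
  let q : Fin n → C^∞⟮𝓡 n, M; ℝ⟯ := fun i =>
    bumpLift χ (fun u => g u (EuclideanSpace.single i 1)) (hg.clm_apply contDiff_const)
  have hp : ∀ i, p i x = 0 := fun i => by simp [p, bumpLift_apply, hc]
  have hq : ∀ i, q i x = 0 := fun i => by
    simp only [q, bumpLift_apply]
    rw [← hc, hg0, zero_apply, mul_zero]
  have hsum : ∀ u, g u (u - c) = ∑ i, (u i - c i) * g u (EuclideanSpace.single i 1) := by
    intro u
    conv_lhs => rw [← (EuclideanSpace.basisFun (Fin n) ℝ).sum_repr (u - c)]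
    simp [map_sum]
  have hrest : δ (f - ((f x) • 1 + ∑ i, p i * q i)) = 0 := by
    refine apply_eq_zero_of_eventuallyEq_zero hδ ?_
    have h1 : ∀ᶠ y in 𝓝 x, F (extChartAt (𝓡 n) x y) = f y := by
      have h2 := (continuousAt_extChartAt (I := 𝓡 n) x).eventually hFf
      filter_upwards [h2, extChartAt_source_mem_nhds (I := 𝓡 n) x] with y hy hys
      rw [hy, (extChartAt (𝓡 n) x).left_inv hys]
    have hFc : F c = f x := h1.self_of_nhds
    filter_upwards [h1, χ.eventuallyEq_one] with y hy hχ
    have h3 : (f - ((f x) • 1 + ∑ i, p i * q i)) y = f y - (f x + ∑ i, p i y * q i y) := by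
      have e1 : (∑ i, p i * q i) y = ∑ i, p i y * q i y := by
        have := map_sum (ContMDiffMap.evalRingHom (I := 𝓡 n) (n := ∞) (R := ℝ) (I' := 𝓘(ℝ, ℝ)) y)
          (fun i => p i * q i) Finset.univ
        exact this
      change f y - (f x * 1 + (∑ i, p i * q i) y) = _
      rw [e1, mul_one]
    rw [h3, ← hy, hFg, hFc, hsum]
    have h4 : ∀ i, p i y * q i y = (extChartAt (𝓡 n) x y i - c i) *
        g (extChartAt (𝓡 n) x y) (EuclideanSpace.single i 1) := by
      intro i
      simp only [p, q, bumpLift_apply, hχ, Pi.one_apply, one_mul]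
    simp only [h4, sub_self]
  rw [map_sub, map_add, map_smul, hone, smul_zero, zero_add, map_sum] at hrest
  have hz : ∑ i, δ (p i * q i) = 0 := Finset.sum_eq_zero fun i _ => by
    rw [hδ, hp, hq, zero_mul, zero_mul, add_zero]
  rw [hz, sub_zero] at hrest
  exact hrest

end Hadamard

/-! ### The carré du champ of a second-order operator -/

section CarreDuChamp

variable {n : ℕ} {M : Type*} [TopologicalSpace M] [ChartedSpace (EuclideanSpace ℝ (Fin n)) M]
  {P : C^∞⟮𝓡 n, M; ℝ⟯ →ₗ[ℝ] C^∞⟮𝓡 n, M; ℝ⟯}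

/-- The carré du champ `-[[P, f], g] 1 / 2` of a second-order operator: the bilinear form of its
principal symbol, with the sign for which a nonnegative operator has a nonnegative form. -/
noncomputable def carreDuChamp (P : C^∞⟮𝓡 n, M; ℝ⟯ →ₗ[ℝ] C^∞⟮𝓡 n, M; ℝ⟯)
    (f g : C^∞⟮𝓡 n, M; ℝ⟯) : C^∞⟮𝓡 n, M; ℝ⟯ :=
  (-(1 / 2) : ℝ) • mulCommutator (mulCommutator P f) g 1

lemma mulCommutator_apply (P : C^∞⟮𝓡 n, M; ℝ⟯ →ₗ[ℝ] C^∞⟮𝓡 n, M; ℝ⟯)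
    (f u : C^∞⟮𝓡 n, M; ℝ⟯) : mulCommutator P f u = P (f * u) - f * P u := rfl

lemma carreDuChamp_eq (f g : C^∞⟮𝓡 n, M; ℝ⟯) :
    carreDuChamp P f g =
      (-(1 / 2) : ℝ) • (P (f * g) - f * P g - g * P f + f * g * P 1) := by
  rw [carreDuChamp, mulCommutator_apply, mulCommutator_apply, mulCommutator_apply]
  congr 1
  rw [mul_one, mul_one]
  ring

lemma carreDuChamp_apply (f g : C^∞⟮𝓡 n, M; ℝ⟯) (x : M) :
    carreDuChamp P f g x =
      -(1 / 2) * (P (f * g) x - f x * P g x - g x * P f x + f x * g x * P 1 x) := by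
  rw [carreDuChamp_eq]; rfl

lemma carreDuChamp_comm (f g : C^∞⟮𝓡 n, M; ℝ⟯) (x : M) :
    carreDuChamp P f g x = carreDuChamp P g f x := by
  rw [carreDuChamp_apply, carreDuChamp_apply, mul_comm f g]; ring

/-- The functional `g ↦ carreDuChamp P f g x`. -/
noncomputable def carreDuChampAt (P : C^∞⟮𝓡 n, M; ℝ⟯ →ₗ[ℝ] C^∞⟮𝓡 n, M; ℝ⟯)
    (f : C^∞⟮𝓡 n, M; ℝ⟯) (x : M) : C^∞⟮𝓡 n, M; ℝ⟯ →ₗ[ℝ] ℝ where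
  toFun g := carreDuChamp P f g x
  map_add' g h := by
    have e1 : (g + h) x = g x + h x := rfl
    have e2 : (P (f * g) + P (f * h)) x = P (f * g) x + P (f * h) x := rfl
    have e3 : (P g + P h) x = P g x + P h x := rfl
    rw [carreDuChamp_apply, carreDuChamp_apply, carreDuChamp_apply, mul_add f g h,
      map_add P (f * g), map_add P g, e1, e2, e3]
    ring
  map_smul' c g := by
    have e1 : (c • g) x = c * g x := rfl
    have e2 : (c • P (f * g)) x = c * P (f * g) x := rfl
    have e3 : (c • P g) x = c * P g x := rfl
    rw [carreDuChamp_apply, carreDuChamp_apply, mul_smul_comm, map_smul, map_smul, e1, e2, e3,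
      RingHom.id_apply, smul_eq_mul]
    ring

lemma carreDuChampAt_apply (f g : C^∞⟮𝓡 n, M; ℝ⟯) (x : M) :
    carreDuChampAt P f x g = carreDuChamp P f g x := rfl

lemma sum_smul_apply {ι : Type*} (s : Finset ι) (c : ι → ℝ) (f : ι → C^∞⟮𝓡 n, M; ℝ⟯) (x : M) :
    (∑ i ∈ s, c i • f i) x = ∑ i ∈ s, c i * f i x :=
  map_sum (ContMDiffMap.evalRingHom (I := 𝓡 n) (n := ∞) (R := ℝ) (I' := 𝓘(ℝ, ℝ)) x)
    (fun i => c i • f i) s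

lemma carreDuChamp_sum_right {ι : Type*} (s : Finset ι) (c : ι → ℝ)
    (k : C^∞⟮𝓡 n, M; ℝ⟯) (f : ι → C^∞⟮𝓡 n, M; ℝ⟯) (x : M) :
    carreDuChamp P k (∑ i ∈ s, c i • f i) x = ∑ i ∈ s, c i * carreDuChamp P k (f i) x := by
  rw [← carreDuChampAt_apply, map_sum]
  exact Finset.sum_congr rfl fun i _ => by rw [map_smul, smul_eq_mul, carreDuChampAt_apply]

lemma carreDuChamp_sum_sum {ι : Type*} (s : Finset ι) (c : ι → ℝ) (f : ι → C^∞⟮𝓡 n, M; ℝ⟯)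
    (x : M) :
    carreDuChamp P (∑ i ∈ s, c i • f i) (∑ i ∈ s, c i • f i) x =
      ∑ i ∈ s, ∑ j ∈ s, c i * c j * carreDuChamp P (f i) (f j) x := by
  rw [carreDuChamp_sum_right]
  refine Finset.sum_congr rfl fun i _ => ?_
  rw [carreDuChamp_comm, carreDuChamp_sum_right, Finset.mul_sum]
  exact Finset.sum_congr rfl fun j _ => by rw [mul_assoc]

/-- The commutator of an operator of order two with a function is a first-order operator, so the
carré du champ is a derivation in each argument. -/
lemma carreDuChamp_mul (hP : IsDiffOp 2 P) (f g h : C^∞⟮𝓡 n, M; ℝ⟯) (x : M) :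
    carreDuChamp P f (g * h) x = g x * carreDuChamp P f h x + h x * carreDuChamp P f g x := by
  have h0 : mulCommutator (mulCommutator (mulCommutator P f) g) h 1 = 0 := by
    rw [hP f g h]; rfl
  have h1 : mulCommutator (mulCommutator (mulCommutator P f) g) h 1 x = 0 := by rw [h0]; rfl
  simp only [mulCommutator_apply, mul_one] at h1
  have h2 : P (f * (g * h)) x - f x * P (g * h) x - g x * (P (f * h) x - f x * P h x) -
      h x * (P (f * g) x - f x * P g x - g x * (P f x - f x * P 1 x)) = 0 := h1
  rw [carreDuChamp_apply, carreDuChamp_apply, carreDuChamp_apply]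
  have e : (g * h) x = g x * h x := rfl
  rw [e]
  linear_combination (-1 / 2 : ℝ) * h2

lemma carreDuChampAt_leibniz (hP : IsDiffOp 2 P) (f : C^∞⟮𝓡 n, M; ℝ⟯) (x : M)
    (g h : C^∞⟮𝓡 n, M; ℝ⟯) :
    carreDuChampAt P f x (g * h) = g x * carreDuChampAt P f x h + h x * carreDuChampAt P f x g :=
  carreDuChamp_mul hP f g h x

lemma carreDuChamp_mul_self (hP : IsDiffOp 2 P) (f g : C^∞⟮𝓡 n, M; ℝ⟯) (x : M) :
    carreDuChamp P (f * g) (f * g) x = f x ^ 2 * carreDuChamp P g g x +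
      2 * f x * g x * carreDuChamp P f g x + g x ^ 2 * carreDuChamp P f f x := by
  rw [carreDuChamp_mul hP, carreDuChamp_comm _ g, carreDuChamp_comm _ f, carreDuChamp_mul hP,
    carreDuChamp_mul hP, carreDuChamp_comm g f]
  ring

lemma IsEllipticSecondOrder.carreDuChamp_ne_zero (hP : IsEllipticSecondOrder P)
    {f : C^∞⟮𝓡 n, M; ℝ⟯} {x : M} (hf : mfderiv (𝓡 n) 𝓘(ℝ, ℝ) f x ≠ 0) :
    carreDuChamp P f f x ≠ 0 := by
  have h := hP.elliptic f x hf
  change -(1 / 2) * (mulCommutator (mulCommutator P f) f 1 x) ≠ 0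
  exact mul_ne_zero (by norm_num) h

/-- The composition of a smooth function on the line with a smooth function on a manifold. -/
noncomputable def compSmooth (G : ℝ → ℝ) (hG : ContDiff ℝ ∞ G)
    (f : C^∞⟮𝓡 n, M; ℝ⟯) : C^∞⟮𝓡 n, M; ℝ⟯ :=
  ⟨fun x => G (f x), hG.contMDiff.comp f.contMDiff⟩

section Energy

variable [CompactSpace M] [MeasurableSpace M] [BorelSpace M] {μ : Measure M} [IsFiniteMeasure μ]

lemma integrable_smooth (f : C^∞⟮𝓡 n, M; ℝ⟯) : Integrable (f : M → ℝ) μ :=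
  f.contMDiff.continuous.integrable_of_hasCompactSupport (HasCompactSupport.of_compactSpace _)

/-- The quadratic form of a symmetric operator is the sum of the integral of its carré du champ and
a zeroth-order term. Only symmetry is used: `∫ P (f ^ 2) = ∫ f ^ 2 P 1`. -/
lemma integral_mul_apply_eq (hsymm : ∀ f g : C^∞⟮𝓡 n, M; ℝ⟯, ∫ x, P f x * g x ∂μ =
      ∫ x, f x * P g x ∂μ) (f : C^∞⟮𝓡 n, M; ℝ⟯) :
    ∫ x, P f x * f x ∂μ = ∫ x, carreDuChamp P f f x ∂μ + ∫ x, P 1 x * f x ^ 2 ∂μ := by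
  have h1 : ∫ x, P (f * f) x ∂μ = ∫ x, P 1 x * f x ^ 2 ∂μ := by
    have h := hsymm (f * f) 1
    have e1 : ∀ x, P (f * f) x * (1 : C^∞⟮𝓡 n, M; ℝ⟯) x = P (f * f) x := fun x => mul_one _
    have e2 : ∀ x, (f * f) x * P 1 x = P 1 x * f x ^ 2 := fun x => by
      change f x * f x * P 1 x = _; ring
    simp_rw [e1, e2] at h
    exact h
  have h2 : ∀ x, carreDuChamp P f f x =
      P f x * f x - (1 / 2) * (P (f * f) x + P 1 x * f x ^ 2) := fun x => by
    rw [carreDuChamp_apply]; ring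
  have i1 : Integrable (fun x => P f x * f x) μ := integrable_smooth (P f * f)
  have i2 : Integrable (fun x => P (f * f) x) μ := integrable_smooth _
  have i3 : Integrable (fun x => P 1 x * f x ^ 2) μ := integrable_smooth (P 1 * f ^ 2)
  have i4 : Integrable (fun x => P (f * f) x + P 1 x * f x ^ 2) μ := i2.add i3
  simp_rw [h2]
  rw [integral_sub i1 (i4.const_mul _), integral_const_mul, integral_add i2 i3, h1]
  ring

end Energy

variable [T2Space M] [IsManifold (𝓡 n) ∞ M]

lemma carreDuChamp_eq_zero_of_mfderiv_eq_zero (hP : IsDiffOp 2 P) (f : C^∞⟮𝓡 n, M; ℝ⟯)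
    {g : C^∞⟮𝓡 n, M; ℝ⟯} {x : M} (hg : mfderiv (𝓡 n) 𝓘(ℝ, ℝ) g x = 0) :
    carreDuChamp P f g x = 0 :=
  apply_eq_zero_of_mfderiv_eq_zero (carreDuChampAt_leibniz hP f x) hg

lemma carreDuChamp_eq_zero_of_eventuallyEq_zero (hP : IsDiffOp 2 P) (f : C^∞⟮𝓡 n, M; ℝ⟯)
    {g : C^∞⟮𝓡 n, M; ℝ⟯} {x : M} (hg : ∀ᶠ y in 𝓝 x, g y = 0) :
    carreDuChamp P f g x = 0 :=
  apply_eq_zero_of_eventuallyEq_zero (carreDuChampAt_leibniz hP f x) hg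

lemma carreDuChamp_self_eq_of_mfderiv_sub_eq_zero (hP : IsDiffOp 2 P)
    {f g : C^∞⟮𝓡 n, M; ℝ⟯} {x : M} (h : mfderiv (𝓡 n) 𝓘(ℝ, ℝ) (f - g) x = 0) :
    carreDuChamp P f f x = carreDuChamp P g g x := by
  have h1 : ∀ k, carreDuChamp P k f x = carreDuChamp P k g x := by
    intro k
    have h2 := carreDuChamp_eq_zero_of_mfderiv_eq_zero hP k h
    rw [← carreDuChampAt_apply, map_sub, sub_eq_zero] at h2
    exact h2
  rw [h1, carreDuChamp_comm, h1]

lemma carreDuChamp_compSmooth (hP : IsDiffOp 2 P) {G : ℝ → ℝ} (hG : ContDiff ℝ ∞ G)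
    (g f : C^∞⟮𝓡 n, M; ℝ⟯) (x : M) :
    carreDuChamp P g (compSmooth G hG f) x = deriv G (f x) * carreDuChamp P g f x := by
  have hd : MDifferentiableAt (𝓡 n) 𝓘(ℝ, ℝ) f x := f.contMDiff.mdifferentiableAt (by simp)
  have h1 : HasFDerivAt (fun y : ℝ => G y - deriv G (f x) * y) (0 : ℝ →L[ℝ] ℝ) (f x) := by
    have h2 : HasDerivAt (fun y : ℝ => G y - deriv G (f x) * y)
        (deriv G (f x) - deriv G (f x) * 1) (f x) :=
      ((hG.differentiable (by simp)).differentiableAt.hasDerivAt).sub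
        ((hasDerivAt_id _).const_mul _)
    rw [mul_one, sub_self] at h2
    have h3 := h2.hasFDerivAt
    simpa using h3
  have h4 : mfderiv (𝓡 n) 𝓘(ℝ, ℝ)
      (compSmooth G hG f - deriv G (f x) • f : C^∞⟮𝓡 n, M; ℝ⟯) x = 0 := by
    have h5 := (h1.hasMFDerivAt.comp x hd.hasMFDerivAt).mfderiv
    exact h5.trans (ContinuousLinearMap.zero_comp _)
  have h6 := carreDuChamp_eq_zero_of_mfderiv_eq_zero hP g h4
  rw [← carreDuChampAt_apply, map_sub, map_smul, sub_eq_zero] at h6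
  exact h6

/-- The high-frequency identity: the oscillating trial functions `φ cos (t f)` and `φ sin (t f)`
isolate the principal symbol as `t → ∞`. -/
lemma carreDuChamp_oscillation (hP : IsDiffOp 2 P) (φ f : C^∞⟮𝓡 n, M; ℝ⟯) (t : ℝ)
    (hcos : ContDiff ℝ ∞ fun y : ℝ => Real.cos (t * y))
    (hsin : ContDiff ℝ ∞ fun y : ℝ => Real.sin (t * y)) (x : M) :
    carreDuChamp P (φ * compSmooth _ hcos f) (φ * compSmooth _ hcos f) x +
      carreDuChamp P (φ * compSmooth _ hsin f) (φ * compSmooth _ hsin f) x =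
    carreDuChamp P φ φ x + t ^ 2 * (φ x ^ 2 * carreDuChamp P f f x) := by
  have dcos : deriv (fun y : ℝ => Real.cos (t * y)) (f x) = -t * Real.sin (t * f x) := by
    have h : HasDerivAt (fun y : ℝ => Real.cos (t * y)) (-Real.sin (t * f x) * (t * 1)) (f x) :=
      ((hasDerivAt_id (f x)).const_mul t).cos
    rw [h.deriv]; ring
  have dsin : deriv (fun y : ℝ => Real.sin (t * y)) (f x) = t * Real.cos (t * f x) := by
    have h : HasDerivAt (fun y : ℝ => Real.sin (t * y)) (Real.cos (t * f x) * (t * 1)) (f x) :=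
      ((hasDerivAt_id (f x)).const_mul t).sin
    rw [h.deriv]; ring
  have c1 : ∀ g, carreDuChamp P g (compSmooth _ hcos f) x =
      -t * Real.sin (t * f x) * carreDuChamp P g f x := fun g => by
    rw [carreDuChamp_compSmooth hP, dcos]
  have s1 : ∀ g, carreDuChamp P g (compSmooth _ hsin f) x =
      t * Real.cos (t * f x) * carreDuChamp P g f x := fun g => by
    rw [carreDuChamp_compSmooth hP, dsin]
  have c2 : compSmooth _ hcos f x = Real.cos (t * f x) := rfl
  have s2 : compSmooth _ hsin f x = Real.sin (t * f x) := rfl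
  have cc : carreDuChamp P (compSmooth _ hcos f) (compSmooth _ hcos f) x =
      (-t * Real.sin (t * f x)) ^ 2 * carreDuChamp P f f x := by
    rw [c1, carreDuChamp_comm, c1]; ring
  have ss : carreDuChamp P (compSmooth _ hsin f) (compSmooth _ hsin f) x =
      (t * Real.cos (t * f x)) ^ 2 * carreDuChamp P f f x := by
    rw [s1, carreDuChamp_comm, s1]; ring
  rw [carreDuChamp_mul_self hP, carreDuChamp_mul_self hP, cc, ss, c1, s1, c2, s2]
  have hcs := Real.sin_sq_add_cos_sq (t * f x)
  linear_combination (φ x ^ 2 * t ^ 2 * carreDuChamp P f f x + carreDuChamp P φ φ x) * hcs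

/-- A nonnegative symmetric second-order operator has a nonnegative carré du champ. -/
lemma carreDuChamp_self_nonneg [CompactSpace M] [MeasurableSpace M] [BorelSpace M]
    {μ : Measure M} [IsFiniteMeasure μ] [μ.IsOpenPosMeasure] (hP : IsDiffOp 2 P)
    (hsymm : ∀ f g : C^∞⟮𝓡 n, M; ℝ⟯, ∫ x, P f x * g x ∂μ = ∫ x, f x * P g x ∂μ)
    (hnn : ∀ f : C^∞⟮𝓡 n, M; ℝ⟯, 0 ≤ ∫ x, P f x * f x ∂μ) (f : C^∞⟮𝓡 n, M; ℝ⟯) (x : M) :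
    0 ≤ carreDuChamp P f f x := by
  by_contra! hneg
  have hnhds : {y | carreDuChamp P f f y < 0} ∈ 𝓝 x :=
    (carreDuChamp P f f).contMDiff.continuous.continuousAt.eventually_lt continuousAt_const hneg
  obtain ⟨χ, -, hχ⟩ :=
    (SmoothBumpFunction.nhds_basis_support (I := 𝓡 n) (c := x) hnhds).mem_iff.1 hnhds
  -- A cut-off function supported where the carré du champ is negative.
  let φ : C^∞⟮𝓡 n, M; ℝ⟯ := ⟨χ, χ.contMDiff⟩
  have hφ : ∀ y, φ y ≠ 0 → carreDuChamp P f f y < 0 := fun y hy => hχ hy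
  have hφx : φ x = 1 := χ.eq_one
  set B : ℝ := ∫ y, φ y ^ 2 * carreDuChamp P f f y ∂μ with hB
  have iB : Integrable (fun y => φ y ^ 2 * carreDuChamp P f f y) μ :=
    integrable_smooth (φ ^ 2 * carreDuChamp P f f)
  have hBneg : B < 0 := by
    have hpos : 0 < ∫ y, -(φ y ^ 2 * carreDuChamp P f f y) ∂μ := by
      have hcont : Continuous fun y => -(φ y ^ 2 * carreDuChamp P f f y) :=
        (φ ^ 2 * carreDuChamp P f f : C^∞⟮𝓡 n, M; ℝ⟯).contMDiff.continuous.neg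
      refine hcont.integral_pos_of_hasCompactSupport_nonneg_nonzero
        (HasCompactSupport.of_compactSpace _) (fun y => ?_) (x := x) ?_
      · by_cases hy : φ y = 0
        · simp [hy]
        · have := hφ y hy
          have h2 := sq_nonneg (φ y)
          simp only [Pi.zero_apply]
          nlinarith
      · rw [hφx]; simpa using hneg.ne
    rw [integral_neg] at hpos
    linarith
  set A : ℝ := ∫ y, carreDuChamp P φ φ y ∂μ + ∫ y, P 1 y * φ y ^ 2 ∂μ with hA
  -- The sum of the quadratic form at `φ cos (t f)` and at `φ sin (t f)`, which is negative for
  -- large `t` as `B < 0`.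
  have hquad : ∀ t : ℝ, 0 ≤ A + t ^ 2 * B := by
    intro t
    have hcos : ContDiff ℝ ∞ fun y : ℝ => Real.cos (t * y) := by fun_prop
    have hsin : ContDiff ℝ ∞ fun y : ℝ => Real.sin (t * y) := by fun_prop
    set u := φ * compSmooth _ hcos f with hu
    set v := φ * compSmooth _ hsin f with hv
    have h1 := hnn u
    have h2 := hnn v
    rw [integral_mul_apply_eq hsymm] at h1 h2
    have e1 : ∫ y, carreDuChamp P u u y ∂μ + ∫ y, carreDuChamp P v v y ∂μ =
        ∫ y, carreDuChamp P φ φ y ∂μ + t ^ 2 * B := by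
      rw [← integral_add (integrable_smooth _) (integrable_smooth _), hB, ← integral_const_mul,
        ← integral_add (integrable_smooth _) (iB.const_mul _)]
      exact integral_congr_ae (Filter.Eventually.of_forall fun y =>
        carreDuChamp_oscillation hP φ f t hcos hsin y)
    have e2 : ∫ y, P 1 y * u y ^ 2 ∂μ + ∫ y, P 1 y * v y ^ 2 ∂μ = ∫ y, P 1 y * φ y ^ 2 ∂μ := by
      have iu : Integrable (fun y => P 1 y * u y ^ 2) μ := integrable_smooth (P 1 * u ^ 2)
      have iv : Integrable (fun y => P 1 y * v y ^ 2) μ := integrable_smooth (P 1 * v ^ 2)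
      rw [← integral_add iu iv]
      refine integral_congr_ae (Filter.Eventually.of_forall fun y => ?_)
      change P 1 y * (φ y * Real.cos (t * f y)) ^ 2 + P 1 y * (φ y * Real.sin (t * f y)) ^ 2 =
        P 1 y * φ y ^ 2
      have hcs := Real.sin_sq_add_cos_sq (t * f y)
      linear_combination P 1 y * φ y ^ 2 * hcs
    linarith
  have h := hquad (Real.sqrt ((|A| + 1) / (-B)))
  rw [Real.sq_sqrt (div_nonneg (by positivity) (by linarith))] at h
  have h3 : (|A| + 1) / (-B) * B = -(|A| + 1) := by
    rw [div_mul_eq_mul_div, div_neg, mul_div_assoc, div_self hBneg.ne, mul_one]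
  rw [h3] at h
  linarith [le_abs_self A]

end CarreDuChamp

/-! ### Uniform ellipticity in a chart -/

section Ellipticity

variable {n : ℕ} {M : Type*} [TopologicalSpace M]
  [ChartedSpace (EuclideanSpace ℝ (Fin n)) M] [IsManifold (𝓡 n) ∞ M]

lemma contDiffAt_comp_extChartAt_symm (x₀ : M) (f : C^∞⟮𝓡 n, M; ℝ⟯)
    {v : EuclideanSpace ℝ (Fin n)} (hv : v ∈ (extChartAt (𝓡 n) x₀).target) :
    ContDiffAt ℝ ∞ (fun u => f ((extChartAt (𝓡 n) x₀).symm u)) v := by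
  rw [← contMDiffAt_iff_contDiffAt]
  exact f.contMDiff.contMDiffAt.comp v ((contMDiffOn_extChartAt_symm x₀).contMDiffAt
    ((isOpen_extChartAt_target x₀).mem_nhds hv))

lemma mfderiv_eq_zero_iff_fderiv_comp_extChartAt_symm (x₀ : M) (f : C^∞⟮𝓡 n, M; ℝ⟯)
    {v : EuclideanSpace ℝ (Fin n)} (hv : v ∈ (extChartAt (𝓡 n) x₀).target) :
    mfderiv (𝓡 n) 𝓘(ℝ, ℝ) f ((extChartAt (𝓡 n) x₀).symm v) = 0 ↔
      fderiv ℝ (fun u => f ((extChartAt (𝓡 n) x₀).symm u)) v = 0 := by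
  have hsrc := (extChartAt (𝓡 n) x₀).map_target hv
  have : IsManifold (𝓡 n) 1 M := IsManifold.of_le (n := ∞) (by norm_cast)
  constructor
  · intro h
    have h1 : MDifferentiableAt 𝓘(ℝ, EuclideanSpace ℝ (Fin n)) (𝓡 n)
        (extChartAt (𝓡 n) x₀).symm v :=
      ((contMDiffOn_extChartAt_symm (n := ∞) x₀).contMDiffAt
        ((isOpen_extChartAt_target x₀).mem_nhds hv)).mdifferentiableAt (by simp)
    have h2 : MDifferentiableAt (𝓡 n) 𝓘(ℝ, ℝ) f ((extChartAt (𝓡 n) x₀).symm v) :=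
      f.contMDiff.mdifferentiableAt (by simp)
    have h3 := mfderiv_comp v h2 h1
    rw [h, mfderiv_eq_fderiv] at h3
    exact h3.trans (ContinuousLinearMap.zero_comp _)
  · intro h
    have h1 : HasFDerivAt (fun u => f ((extChartAt (𝓡 n) x₀).symm u))
        (0 : EuclideanSpace ℝ (Fin n) →L[ℝ] ℝ) v := by
      rw [← h]
      exact ((contDiffAt_comp_extChartAt_symm x₀ f hv).differentiableAt (by simp)).hasFDerivAt
    have h2 : MDifferentiableAt (𝓡 n) 𝓘(ℝ, EuclideanSpace ℝ (Fin n)) (extChartAt (𝓡 n) x₀)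
        ((extChartAt (𝓡 n) x₀).symm v) := by
      refine mdifferentiableAt_extChartAt ?_
      rwa [extChartAt_source] at hsrc
    have h1' : HasMFDerivAt 𝓘(ℝ, EuclideanSpace ℝ (Fin n)) 𝓘(ℝ, ℝ)
        (fun u => f ((extChartAt (𝓡 n) x₀).symm u))
        (extChartAt (𝓡 n) x₀ ((extChartAt (𝓡 n) x₀).symm v))
        (0 : EuclideanSpace ℝ (Fin n) →L[ℝ] ℝ) := by
      rw [(extChartAt (𝓡 n) x₀).right_inv hv]
      exact h1.hasMFDerivAt
    have h3 := h1'.comp _ h2.hasMFDerivAt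
    have h4 : (f : M → ℝ) =ᶠ[𝓝 ((extChartAt (𝓡 n) x₀).symm v)]
        (fun u => f ((extChartAt (𝓡 n) x₀).symm u)) ∘ extChartAt (𝓡 n) x₀ := by
      filter_upwards [extChartAt_source_mem_nhds' (I := 𝓡 n) hsrc] with y hy
      simp only [Function.comp_apply, (extChartAt (𝓡 n) x₀).left_inv hy]
    exact (h3.congr_of_eventuallyEq h4).mfderiv.trans (ContinuousLinearMap.zero_comp _)

variable [T2Space M]

/-- In a small closed ball of a chart, the carré du champ of an elliptic operator is uniformly
comparable to the square of the Euclidean length of the differential. -/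
lemma IsEllipticSecondOrder.exists_carreDuChamp_bounds
    {P : C^∞⟮𝓡 n, M; ℝ⟯ →ₗ[ℝ] C^∞⟮𝓡 n, M; ℝ⟯} (hP : IsEllipticSecondOrder P)
    (hnn : ∀ (f : C^∞⟮𝓡 n, M; ℝ⟯) (x : M), 0 ≤ carreDuChamp P f f x) (x₀ : M) :
    ∃ r lo hi : ℝ, 0 < r ∧ 0 < lo ∧ 0 < hi ∧
      Metric.closedBall (extChartAt (𝓡 n) x₀ x₀) r ⊆ (extChartAt (𝓡 n) x₀).target ∧
      ∀ (f : C^∞⟮𝓡 n, M; ℝ⟯), ∀ v ∈ Metric.closedBall (extChartAt (𝓡 n) x₀ x₀) r,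
        lo * ‖fderiv ℝ (fun u => f ((extChartAt (𝓡 n) x₀).symm u)) v‖ ^ 2 ≤
          carreDuChamp P f f ((extChartAt (𝓡 n) x₀).symm v) ∧
        carreDuChamp P f f ((extChartAt (𝓡 n) x₀).symm v) ≤
          hi * ‖fderiv ℝ (fun u => f ((extChartAt (𝓡 n) x₀).symm u)) v‖ ^ 2 := by
  obtain ⟨χ⟩ : Nonempty (SmoothBumpFunction (𝓡 n) x₀) := inferInstance
  set c := extChartAt (𝓡 n) x₀ x₀ with hc
  set ψ := (extChartAt (𝓡 n) x₀).symm with hψ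
  obtain ⟨r₁, hr₁, hrt⟩ := Metric.mem_nhds_iff.1 (extChartAt_target_mem_nhds (I := 𝓡 n) x₀)
  set r := min r₁ χ.rIn / 2 with hr
  have hm : 0 < min r₁ χ.rIn := lt_min hr₁ χ.rIn_pos
  have hrpos : 0 < r := half_pos hm
  have hrlt : r < min r₁ χ.rIn := half_lt_self hm
  have hsub : Metric.closedBall c r ⊆ (extChartAt (𝓡 n) x₀).target :=
    (Metric.closedBall_subset_ball (hrlt.trans_le (min_le_left _ _))).trans hrt
  -- Smooth functions on `M` that agree near the ball with the coordinates, and with the linear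
  -- function `ξ` of the coordinates.
  let ℓ : Fin n → C^∞⟮𝓡 n, M; ℝ⟯ := fun i => bumpLift χ (fun u => u i) (by fun_prop)
  let lin : (EuclideanSpace ℝ (Fin n) →L[ℝ] ℝ) → C^∞⟮𝓡 n, M; ℝ⟯ := fun ξ =>
    ∑ i, ξ (EuclideanSpace.single i 1) • ℓ i
  have hlin : ∀ ξ, ∀ v ∈ Metric.closedBall c r, ∀ᶠ u in 𝓝 v, lin ξ (ψ u) = ξ u := by
    intro ξ v hv
    have h1 : v ∈ Metric.ball c (min r₁ χ.rIn) := Metric.closedBall_subset_ball hrlt hv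
    filter_upwards [Metric.isOpen_ball.mem_nhds h1] with u hu
    have hut : u ∈ (extChartAt (𝓡 n) x₀).target :=
      hrt (Metric.ball_subset_ball (min_le_left _ _) hu)
    have hus := (extChartAt (𝓡 n) x₀).map_target hut
    have hinv : extChartAt (𝓡 n) x₀ (ψ u) = u := (extChartAt (𝓡 n) x₀).right_inv hut
    have hχ : χ (ψ u) = 1 := by
      refine χ.one_of_dist_le (by rwa [extChartAt_source] at hus) ?_
      rw [hinv]
      exact (Metric.mem_ball.1 hu).le.trans (min_le_right _ _)
    rw [sum_smul_apply]
    conv_rhs => rw [← (EuclideanSpace.basisFun (Fin n) ℝ).sum_repr u]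
    simp only [ℓ, bumpLift_apply, hχ, hinv, one_mul, map_sum, map_smul, smul_eq_mul,
      EuclideanSpace.basisFun_repr, EuclideanSpace.basisFun_apply]
    exact Finset.sum_congr rfl fun i _ => mul_comm _ _
  have hdlin : ∀ ξ, ∀ v ∈ Metric.closedBall c r, HasFDerivAt (fun u => lin ξ (ψ u)) ξ v :=
    fun ξ v hv => ξ.hasFDerivAt.congr_of_eventuallyEq (hlin ξ v hv)
  -- The value of the principal symbol at the covector `ξ`: it is continuous, positive for `ξ ≠ 0`
  -- and quadratic in `ξ`, so its extrema for `‖ξ‖ = 1` give the two bounds.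
  let Θ : (EuclideanSpace ℝ (Fin n) →L[ℝ] ℝ) × EuclideanSpace ℝ (Fin n) → ℝ := fun q =>
    carreDuChamp P (lin q.1) (lin q.1) (ψ q.2)
  have hΘcont : ContinuousOn Θ (univ ×ˢ Metric.closedBall c r) := by
    have h1 : Θ = fun q => ∑ i, ∑ j, q.1 (EuclideanSpace.single i 1) *
        q.1 (EuclideanSpace.single j 1) * carreDuChamp P (ℓ i) (ℓ j) (ψ q.2) := by
      funext q
      exact carreDuChamp_sum_sum _ _ _ _
    rw [h1]
    have hψc : ContinuousOn ψ (Metric.closedBall c r) :=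
      (continuousOn_extChartAt_symm x₀).mono hsub
    refine continuousOn_finsetSum _ fun i _ => continuousOn_finsetSum _ fun j _ => ?_
    refine ContinuousOn.mul (by fun_prop) ?_
    exact (carreDuChamp P (ℓ i) (ℓ j)).contMDiff.continuous.comp_continuousOn
      (hψc.comp continuousOn_snd fun q hq => hq.2)
  have hΘpos : ∀ ξ ≠ 0, ∀ v ∈ Metric.closedBall c r, 0 < Θ (ξ, v) := by
    intro ξ hξ v hv
    refine lt_of_le_of_ne (hnn _ _) (Ne.symm (hP.carreDuChamp_ne_zero ?_))
    intro h
    rw [mfderiv_eq_zero_iff_fderiv_comp_extChartAt_symm x₀ _ (hsub hv)] at h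
    rw [← hψ, (hdlin ξ v hv).fderiv] at h
    exact hξ h
  have hΘsmul : ∀ (a : ℝ) ξ v, Θ (a • ξ, v) = a ^ 2 * Θ (ξ, v) := by
    intro a ξ v
    simp only [Θ, lin]
    rw [carreDuChamp_sum_sum, carreDuChamp_sum_sum, Finset.mul_sum]
    refine Finset.sum_congr rfl fun i _ => ?_
    rw [Finset.mul_sum]
    refine Finset.sum_congr rfl fun j _ => ?_
    simp only [smul_apply, smul_eq_mul]
    ring
  have hcomp : IsCompact (Metric.sphere (0 : EuclideanSpace ℝ (Fin n) →L[ℝ] ℝ) 1 ×ˢ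
      Metric.closedBall c r) := (isCompact_sphere _ _).prod (isCompact_closedBall _ _)
  obtain ⟨lo, hi, hlo, hhi, hbound⟩ : ∃ lo hi : ℝ, 0 < lo ∧ 0 < hi ∧
      ∀ q ∈ Metric.sphere (0 : EuclideanSpace ℝ (Fin n) →L[ℝ] ℝ) 1 ×ˢ Metric.closedBall c r,
        lo ≤ Θ q ∧ Θ q ≤ hi := by
    have hcont' := hΘcont.mono (prod_mono (subset_univ
      (Metric.sphere (0 : EuclideanSpace ℝ (Fin n) →L[ℝ] ℝ) 1)) subset_rfl)
    rcases (Metric.sphere (0 : EuclideanSpace ℝ (Fin n) →L[ℝ] ℝ) 1 ×ˢ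
      Metric.closedBall c r).eq_empty_or_nonempty with hne | hne
    · exact ⟨1, 1, one_pos, one_pos, fun q hq => by rw [hne] at hq; exact hq.elim⟩
    · obtain ⟨q₁, hq₁, h₁⟩ := hcomp.exists_isMinOn hne hcont'
      obtain ⟨q₂, hq₂, h₂⟩ := hcomp.exists_isMaxOn hne hcont'
      have hpos : ∀ q ∈ Metric.sphere (0 : EuclideanSpace ℝ (Fin n) →L[ℝ] ℝ) 1 ×ˢ
          Metric.closedBall c r, 0 < Θ q := fun q hq =>
        hΘpos q.1 (ne_zero_of_mem_unit_sphere ⟨q.1, hq.1⟩) q.2 hq.2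
      exact ⟨Θ q₁, Θ q₂, hpos _ hq₁, hpos _ hq₂, fun q hq => ⟨h₁ hq, h₂ hq⟩⟩
  refine ⟨r, lo, hi, hrpos, hlo, hhi, hsub, fun f v hv => ?_⟩
  set ξ := fderiv ℝ (fun u => f (ψ u)) v with hξ
  have hΓ : carreDuChamp P f f (ψ v) = Θ (ξ, v) := by
    refine carreDuChamp_self_eq_of_mfderiv_sub_eq_zero hP.isDiffOp ?_
    rw [hψ, mfderiv_eq_zero_iff_fderiv_comp_extChartAt_symm x₀ _ (hsub hv), ← hψ]
    have h1 : HasFDerivAt (fun u => f (ψ u)) ξ v :=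
      ((contDiffAt_comp_extChartAt_symm x₀ f (hsub hv)).differentiableAt (by simp)).hasFDerivAt
    have h2 := (h1.sub (hdlin ξ v hv)).fderiv
    rw [sub_self] at h2
    exact h2
  rw [hΓ]
  by_cases h0 : ξ = 0
  · have : Θ (ξ, v) = 0 := by
      have := hΘsmul 0 ξ v
      rwa [zero_smul, sq, zero_mul, zero_mul, ← h0] at this
    rw [this, h0]; simp
  · have hn : 0 < ‖ξ‖ := norm_pos_iff.2 h0
    have h1 : Θ (ξ, v) = ‖ξ‖ ^ 2 * Θ (‖ξ‖⁻¹ • ξ, v) := by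
      rw [hΘsmul]; field_simp
    have h2 := hbound (‖ξ‖⁻¹ • ξ, v) ⟨by
      rw [mem_sphere_zero_iff_norm, norm_smul, norm_inv, norm_norm, inv_mul_cancel₀ hn.ne'], hv⟩
    rw [h1]
    constructor
    · rw [mul_comm]; exact mul_le_mul_of_nonneg_left h2.1 (by positivity)
    · rw [mul_comm hi]; exact mul_le_mul_of_nonneg_left h2.2 (by positivity)

end Ellipticity

/-! ### A Poincaré inequality on convex sets -/

section Poincare

lemma sq_lintegral_le_lintegral_sq {α : Type*} [MeasurableSpace α] (μ : Measure α)
    [IsProbabilityMeasure μ] {h : α → ℝ≥0∞} (hh : AEMeasurable h μ) :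
    (∫⁻ t, h t ∂μ) ^ 2 ≤ ∫⁻ t, h t ^ 2 ∂μ := by
  have h1 := ENNReal.lintegral_mul_le_Lp_mul_Lq μ (p := 2) (q := 2)
    (Real.holderConjugate_iff.2 ⟨by norm_num, by norm_num⟩) hh (aemeasurable_const (b := 1))
  simp only [Pi.mul_apply, mul_one, lintegral_const, measure_univ,
    ENNReal.rpow_two, one_pow, ENNReal.one_rpow] at h1
  calc (∫⁻ t, h t ∂μ) ^ 2 ≤ ((∫⁻ t, h t ^ 2 ∂μ) ^ (1 / 2 : ℝ)) ^ 2 := by gcongr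
    _ = ∫⁻ t, h t ^ 2 ∂μ := by
      rw [← ENNReal.rpow_natCast, ← ENNReal.rpow_mul]; norm_num

variable {E : Type*} [NormedAddCommGroup E] [NormedSpace ℝ E]

lemma enorm_sub_sq_le_lintegral_fderiv {Q : Set E} (hQ : Convex ℝ Q) {v : E → ℝ}
    (hv : ∀ x ∈ Q, ContDiffAt ℝ 1 v x) {x y : E} (hx : x ∈ Q) (hy : y ∈ Q) :
    ‖v y - v x‖ₑ ^ 2 ≤
      ‖y - x‖ₑ ^ 2 * ∫⁻ t in Icc (0 : ℝ) 1, ‖fderiv ℝ v (x + t • (y - x))‖ₑ ^ 2 := by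
  have hmem : ∀ t ∈ Icc (0 : ℝ) 1, x + t • (y - x) ∈ Q := fun t ht => by
    have := hQ hx hy (sub_nonneg.2 ht.2) ht.1 (by ring)
    convert this using 1
    module
  have hline : ∀ t : ℝ, HasDerivAt (fun t : ℝ => x + t • (y - x)) (y - x) t := fun t => by
    simpa using ((hasDerivAt_id t).smul_const (y - x)).const_add x
  have hf : ContDiffOn ℝ 1 (fun t : ℝ => v (x + t • (y - x))) (Icc 0 1) := fun t ht =>
    ((hv _ (hmem t ht)).comp t (by fun_prop)).contDiffWithinAt
  have h1 := enorm_sub_le_lintegral_deriv_of_contDiffOn_Icc hf zero_le_one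
  have e1 : x + (1 : ℝ) • (y - x) = y := by module
  have e0 : x + (0 : ℝ) • (y - x) = x := by module
  simp only [e1, e0] at h1
  have hder : ∀ t ∈ Icc (0 : ℝ) 1, deriv (fun t : ℝ => v (x + t • (y - x))) t =
      fderiv ℝ v (x + t • (y - x)) (y - x) := fun t ht =>
    (((hv _ (hmem t ht)).differentiableAt (by simp)).hasFDerivAt.comp_hasDerivAt t
      (hline t)).deriv
  have hcont : ContinuousOn (fun t : ℝ => fderiv ℝ v (x + t • (y - x))) (Icc 0 1) := by
    intro t ht
    have h2 : ContinuousAt (fderiv ℝ v) (x + t • (y - x)) :=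
      ((hv _ (hmem t ht)).fderiv_right (m := 0) (by norm_num)).continuousAt
    have h3 : ContinuousAt (fun t : ℝ => x + t • (y - x)) t := by fun_prop
    exact (ContinuousAt.comp (f := fun t : ℝ => x + t • (y - x)) h2 h3).continuousWithinAt
  have hmeas : AEMeasurable (fun t : ℝ => ‖fderiv ℝ v (x + t • (y - x))‖ₑ)
      (volume.restrict (Icc 0 1)) :=
    (hcont.enorm).aemeasurable measurableSet_Icc
  have : IsProbabilityMeasure (volume.restrict (Icc (0 : ℝ) 1)) := ⟨by simp⟩
  calc ‖v y - v x‖ₑ ^ 2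
      ≤ (∫⁻ t in Icc (0 : ℝ) 1, ‖fderiv ℝ v (x + t • (y - x))‖ₑ * ‖y - x‖ₑ) ^ 2 := by
        gcongr
        refine h1.trans (setLIntegral_mono' measurableSet_Icc fun t ht => ?_)
        rw [hder t ht]
        exact ContinuousLinearMap.le_opENorm _ _
    _ = ‖y - x‖ₑ ^ 2 * (∫⁻ t in Icc (0 : ℝ) 1, ‖fderiv ℝ v (x + t • (y - x))‖ₑ) ^ 2 := by
        rw [lintegral_mul_const' _ _ enorm_ne_top, mul_pow, mul_comm]
    _ ≤ _ := by
        gcongr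
        exact sq_lintegral_le_lintegral_sq _ hmeas

variable [MeasurableSpace E] [BorelSpace E] [FiniteDimensional ℝ E] (μ : Measure E)
  [μ.IsAddHaarMeasure]

lemma lintegral_comp_add_smul {G : E → ℝ≥0∞} (hG : Measurable G) (a : E) {t : ℝ} (ht : 0 < t) :
    ∫⁻ y, G (a + t • y) ∂μ =
      ENNReal.ofReal (t ^ Module.finrank ℝ E)⁻¹ * ∫⁻ y, G y ∂μ := by
  have h1 : ∫⁻ y, G (a + t • y) ∂μ = ∫⁻ z, G (a + z) ∂(μ.map fun y => t • y) := by
    exact (lintegral_map (f := fun z => G (a + z)) (hG.comp (measurable_const_add a))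
      (measurable_const_smul t)).symm
  rw [h1, Measure.map_addHaar_smul μ ht.ne', lintegral_smul_measure, lintegral_add_left_eq_self,
    smul_eq_mul, abs_of_pos (by positivity)]

lemma lintegral_comp_add_smul_le {G : E → ℝ≥0∞} (hG : Measurable G) (a : E) {t : ℝ}
    (ht : 1 / 2 ≤ t) :
    ∫⁻ y, G (a + t • y) ∂μ ≤ 2 ^ Module.finrank ℝ E * ∫⁻ y, G y ∂μ := by
  have htpos : 0 < t := by linarith
  rw [lintegral_comp_add_smul μ hG a htpos]
  gcongr
  rw [show (2 : ℝ≥0∞) = ENNReal.ofReal 2 by simp, ← ENNReal.ofReal_pow (by norm_num), ← inv_pow]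
  refine ENNReal.ofReal_le_ofReal ?_
  have : t⁻¹ ≤ 2 := by
    rw [inv_le_comm₀ htpos two_pos]; linarith
  gcongr

/-- The Poincaré inequality on a convex set, in terms of differences of values. The segment
between the two points is parametrized; on either half of it one of the end points can be traded for
the intermediate point with a bounded Jacobian. -/
lemma Convex.lintegral_enorm_sub_sq_le {Q : Set E} (hQ : Convex ℝ Q) (hQm : MeasurableSet Q)
    {v : E → ℝ} (hv : ∀ x ∈ Q, ContDiffAt ℝ 1 v x) {d : ℝ≥0∞}
    (hd : ∀ x ∈ Q, ∀ y ∈ Q, edist x y ≤ d) :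
    ∫⁻ x in Q, ∫⁻ y in Q, ‖v x - v y‖ₑ ^ 2 ∂μ ∂μ ≤
      d ^ 2 * (2 ^ Module.finrank ℝ E * (μ Q * ∫⁻ z in Q, ‖fderiv ℝ v z‖ₑ ^ 2 ∂μ)) := by
  set G : E → ℝ≥0∞ := Q.indicator fun z => ‖fderiv ℝ v z‖ₑ ^ 2 with hG
  have hGm : Measurable G := ((measurable_fderiv ℝ v).enorm.pow_const 2).indicator hQm
  have hGint : ∫⁻ z, G z ∂μ = ∫⁻ z in Q, ‖fderiv ℝ v z‖ₑ ^ 2 ∂μ := lintegral_indicator hQm _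
  have hstep : ∀ x ∈ Q, ∀ y ∈ Q, ‖v x - v y‖ₑ ^ 2 ≤
      d ^ 2 * ∫⁻ t in Icc (0 : ℝ) 1, G (x + t • (y - x)) := by
    intro x hx y hy
    rw [← enorm_neg, neg_sub]
    refine (enorm_sub_sq_le_lintegral_fderiv hQ hv hx hy).trans ?_
    refine mul_le_mul' ?_ (setLIntegral_mono' measurableSet_Icc fun t ht => ?_)
    · rw [← edist_eq_enorm_sub]
      have := hd y hy x hx
      gcongr
    · have hm : x + t • (y - x) ∈ Q := by
        have := hQ hx hy (sub_nonneg.2 ht.2) ht.1 (by ring)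
        convert this using 1
        module
      rw [hG, indicator_of_mem hm]
  have hjoint : Measurable fun p : (E × E) × ℝ => G (p.1.1 + p.2 • (p.1.2 - p.1.1)) :=
    hGm.comp (by fun_prop)
  have hI : ∀ t ∈ Icc (0 : ℝ) 1, ∫⁻ x in Q, ∫⁻ y in Q, G (x + t • (y - x)) ∂μ ∂μ ≤
      2 ^ Module.finrank ℝ E * (μ Q * ∫⁻ z, G z ∂μ) := by
    intro t ht
    have hconst : ∀ F : E → ℝ≥0∞,
        (∀ x, F x ≤ 2 ^ Module.finrank ℝ E * ∫⁻ z, G z ∂μ) →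
        ∫⁻ x in Q, F x ∂μ ≤ 2 ^ Module.finrank ℝ E * (μ Q * ∫⁻ z, G z ∂μ) := by
      intro F hF
      refine (lintegral_mono hF).trans_eq ?_
      rw [setLIntegral_const]; ring
    rcases le_total (1 / 2) t with h | h
    · refine hconst _ fun x => (setLIntegral_le_lintegral _ _).trans ?_
      have := lintegral_comp_add_smul_le μ hGm ((1 - t) • x) h
      refine le_trans (le_of_eq ?_) this
      refine lintegral_congr fun y => congrArg G ?_
      module
    · rw [lintegral_lintegral_swap]
      · refine hconst _ fun y => (setLIntegral_le_lintegral _ _).trans ?_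
        have := lintegral_comp_add_smul_le μ hGm (t • y) (t := 1 - t) (by linarith)
        refine le_trans (le_of_eq ?_) this
        refine lintegral_congr fun x => congrArg G ?_
        module
      · exact (hjoint.comp (measurable_prodMk_right (y := t))).aemeasurable
  calc ∫⁻ x in Q, ∫⁻ y in Q, ‖v x - v y‖ₑ ^ 2 ∂μ ∂μ
      ≤ ∫⁻ x in Q, ∫⁻ y in Q, (d ^ 2 * ∫⁻ t in Icc (0 : ℝ) 1, G (x + t • (y - x))) ∂μ ∂μ :=
        setLIntegral_mono' hQm fun x hx => setLIntegral_mono' hQm fun y hy => hstep x hx y hy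
    _ = d ^ 2 * ∫⁻ x in Q, ∫⁻ y in Q, (∫⁻ t in Icc (0 : ℝ) 1, G (x + t • (y - x))) ∂μ ∂μ := by
        have hm2 : Measurable fun p : E × E =>
            ∫⁻ t in Icc (0 : ℝ) 1, G (p.1 + t • (p.2 - p.1)) := hjoint.lintegral_prod_right'
        rw [← lintegral_const_mul]
        · refine lintegral_congr fun x => ?_
          rw [lintegral_const_mul]
          exact hm2.comp measurable_prodMk_left
        · exact hm2.lintegral_prod_right'
    _ = d ^ 2 * ∫⁻ t in Icc (0 : ℝ) 1, ∫⁻ x in Q, ∫⁻ y in Q, G (x + t • (y - x)) ∂μ ∂μ := by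
        congr 1
        have hswap : ∀ x, ∫⁻ y in Q, (∫⁻ t in Icc (0 : ℝ) 1, G (x + t • (y - x))) ∂μ =
            ∫⁻ t in Icc (0 : ℝ) 1, ∫⁻ y in Q, G (x + t • (y - x)) ∂μ := by
          intro x
          refine lintegral_lintegral_swap ?_
          refine Measurable.aemeasurable ?_
          exact hGm.comp (by fun_prop)
        simp_rw [hswap]
        refine lintegral_lintegral_swap ?_
        refine Measurable.aemeasurable ?_
        have hm3 : Measurable fun p : (E × ℝ) × E => G (p.1.1 + p.1.2 • (p.2 - p.1.1)) :=
          hGm.comp (by fun_prop)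
        exact hm3.lintegral_prod_right'
    _ ≤ d ^ 2 * ∫⁻ _ in Icc (0 : ℝ) 1, 2 ^ Module.finrank ℝ E * (μ Q * ∫⁻ z, G z ∂μ) := by
        gcongr 1
        exact setLIntegral_mono' measurableSet_Icc hI
    _ = _ := by
        rw [setLIntegral_const, Real.volume_Icc, hGint]
        simp

end Poincare

/-! ### The Poincaré inequality on a manifold at small scales -/

section ManifoldPoincare

lemma lintegral_lintegral_enorm_sub_sq {α : Type*} [MeasurableSpace α] (ν : Measure α)
    [IsFiniteMeasure ν] {u : α → ℝ} (hu : Integrable u ν) (hu2 : Integrable (fun x => u x ^ 2) ν) :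
    ∫⁻ x, ∫⁻ y, ‖u x - u y‖ₑ ^ 2 ∂ν ∂ν =
      ENNReal.ofReal (2 * (ν.real univ * ∫ x, u x ^ 2 ∂ν - (∫ x, u x ∂ν) ^ 2)) := by
  have hsq : ∀ a : ℝ, ‖a‖ₑ ^ 2 = ENNReal.ofReal (a ^ 2) := fun a => by
    rw [Real.enorm_eq_ofReal_abs, ← ENNReal.ofReal_pow (abs_nonneg _), sq_abs]
  have hint : ∀ x, Integrable (fun y => u x ^ 2 - 2 * u x * u y + u y ^ 2) ν := fun x =>
    ((integrable_const _).sub (hu.const_mul _)).add hu2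
  have hint' : ∀ x, Integrable (fun y => u x ^ 2 - 2 * u x * u y) ν := fun x =>
    (integrable_const _).sub (hu.const_mul _)
  have hval : ∀ x, ∫ y, (u x ^ 2 - 2 * u x * u y + u y ^ 2) ∂ν =
      ν.real univ * u x ^ 2 - 2 * (∫ y, u y ∂ν) * u x + ∫ y, u y ^ 2 ∂ν := fun x => by
    rw [integral_add (hint' x) hu2,
      integral_sub (integrable_const _) (hu.const_mul _), integral_const, integral_const_mul,
      smul_eq_mul]
    ring
  have hinner : ∀ x, ∫⁻ y, ‖u x - u y‖ₑ ^ 2 ∂ν = ENNReal.ofReal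
      (ν.real univ * u x ^ 2 - 2 * (∫ y, u y ∂ν) * u x + ∫ y, u y ^ 2 ∂ν) := fun x => by
    rw [← hval, ofReal_integral_eq_lintegral_ofReal (hint x)]
    · refine lintegral_congr fun y => ?_
      rw [hsq]; congr 1; ring
    · refine Filter.Eventually.of_forall fun y => ?_
      simp only [Pi.zero_apply]
      nlinarith [sq_nonneg (u x - u y)]
  simp_rw [hinner]
  have i1 : Integrable (fun x => ν.real univ * u x ^ 2 - 2 * (∫ y, u y ∂ν) * u x) ν :=
    (hu2.const_mul _).sub (hu.const_mul _)
  have i2 : Integrable (fun x => ν.real univ * u x ^ 2 - 2 * (∫ y, u y ∂ν) * u x +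
      ∫ y, u y ^ 2 ∂ν) ν := i1.add (integrable_const _)
  rw [← ofReal_integral_eq_lintegral_ofReal i2]
  · congr 1
    rw [integral_add i1 (integrable_const _), integral_sub (hu2.const_mul _) (hu.const_mul _),
      integral_const_mul, integral_const_mul, integral_const, smul_eq_mul]
    ring
  · refine Filter.Eventually.of_forall fun x => ?_
    simp only [Pi.zero_apply]
    rw [← hval]
    refine integral_nonneg fun y => ?_
    simp only [Pi.zero_apply]
    nlinarith [sq_nonneg (u x - u y)]

open scoped NNReal

variable {n : ℕ} {M : Type*} [EMetricSpace M] [ChartedSpace (EuclideanSpace ℝ (Fin n)) M]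
  [IsManifold (𝓡 n) ∞ M] [CompactSpace M] [MeasurableSpace M] [BorelSpace M]

/-- The Poincaré inequality on the image in `M` of a small convex set of a chart. -/
lemma IsBiLipschitzChart.measure_mul_integral_sq_le [IsFiniteMeasure (μHE[n] : Measure M)]
    {x₀ : M} {C : ℝ≥0} {r : ℝ}
    (h : IsBiLipschitzChart (n := n) x₀ C r) {Γ : C^∞⟮𝓡 n, M; ℝ⟯} {lo : ℝ} (hlo : 0 < lo)
    (u : C^∞⟮𝓡 n, M; ℝ⟯) (hΓ : ∀ x, 0 ≤ Γ x)
    (hΓu : ∀ v ∈ Metric.closedBall (extChartAt (𝓡 n) x₀ x₀) r,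
      lo * ‖fderiv ℝ (fun a => u ((extChartAt (𝓡 n) x₀).symm a)) v‖ ^ 2 ≤
        Γ ((extChartAt (𝓡 n) x₀).symm v))
    {Q : Set (EuclideanSpace ℝ (Fin n))} (hQ : Convex ℝ Q) (hQm : MeasurableSet Q)
    (hQr : Q ⊆ Metric.closedBall (extChartAt (𝓡 n) x₀ x₀) r) {d : ℝ} (hd0 : 0 ≤ d)
    (hd : ∀ a ∈ Q, ∀ b ∈ Q, dist a b ≤ d) :
    (μHE[n] : Measure M).real ((extChartAt (𝓡 n) x₀).symm '' Q) *
        ∫ x in (extChartAt (𝓡 n) x₀).symm '' Q, u x ^ 2 ∂(μHE[n] : Measure M) ≤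
      (∫ x in (extChartAt (𝓡 n) x₀).symm '' Q, u x ∂(μHE[n] : Measure M)) ^ 2 +
      (C ^ n) ^ 4 * 2 ^ n * lo⁻¹ * d ^ 2 *
        ((μHE[n] : Measure M).real ((extChartAt (𝓡 n) x₀).symm '' Q) *
        ∫ x in (extChartAt (𝓡 n) x₀).symm '' Q, Γ x ∂(μHE[n] : Measure M)) := by
  set ψ := (extChartAt (𝓡 n) x₀).symm with hψ
  set A := ψ '' Q with hA
  set μ : Measure M := μHE[n] with hμ
  obtain ⟨K, hK⟩ : ∃ K : ℝ≥0∞, K = (C : ℝ≥0∞) ^ n := ⟨_, rfl⟩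
  have hKtop : K ≠ ⊤ := hK ▸ ENNReal.pow_ne_top ENNReal.coe_ne_top
  have hum : Measurable (u : M → ℝ) := u.contMDiff.continuous.measurable
  have hΓm : Measurable fun x => ENNReal.ofReal (Γ x) :=
    Γ.contMDiff.continuous.measurable.ennreal_ofReal
  have hupper : ∫⁻ x in A, ∫⁻ y in A, ‖u x - u y‖ₑ ^ 2 ∂μ ∂μ ≤
      K ^ 4 * 2 ^ n * ENNReal.ofReal lo⁻¹ * ENNReal.ofReal d ^ 2 *
        (μ A * ∫⁻ x in A, ENNReal.ofReal (Γ x) ∂μ) := by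
    have hj : Measurable fun p : M × M => ‖u p.1 - u p.2‖ₑ ^ 2 :=
      ((hum.comp measurable_fst).sub (hum.comp measurable_snd)).enorm.pow_const 2
    have hp := hQ.lintegral_enorm_sub_sq_le volume hQm (v := fun a => u (ψ a))
      (fun a ha => (contDiffAt_comp_extChartAt_symm x₀ u (h.subset_target (hQr ha))).of_le
        (by norm_cast)) (d := ENNReal.ofReal d) fun a ha b hb => by
          rw [edist_dist]; exact ENNReal.ofReal_le_ofReal (hd a ha b hb)
    rw [finrank_euclideanSpace_fin] at hp
    have hgrad : ∫⁻ z in Q, ‖fderiv ℝ (fun a => u (ψ a)) z‖ₑ ^ 2 ≤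
        ENNReal.ofReal lo⁻¹ * (K * ∫⁻ x in A, ENNReal.ofReal (Γ x) ∂μ) := by
      calc ∫⁻ z in Q, ‖fderiv ℝ (fun a => u (ψ a)) z‖ₑ ^ 2
          ≤ ∫⁻ z in Q, ENNReal.ofReal lo⁻¹ * ENNReal.ofReal (Γ (ψ z)) := by
            refine setLIntegral_mono' hQm fun z hz => ?_
            rw [← ENNReal.ofReal_mul (by positivity), ← ofReal_norm,
              ← ENNReal.ofReal_pow (norm_nonneg _)]
            refine ENNReal.ofReal_le_ofReal ?_
            rw [inv_mul_eq_div, le_div_iff₀ hlo, mul_comm]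
            exact hΓu z (hQr hz)
        _ = ENNReal.ofReal lo⁻¹ * ∫⁻ z in Q, ENNReal.ofReal (Γ (ψ z)) :=
            lintegral_const_mul' _ _ ENNReal.ofReal_ne_top
        _ ≤ _ := by
            gcongr
            rw [hK]
            exact h.le_lintegral_image hQm hQr hΓm
    calc ∫⁻ x in A, ∫⁻ y in A, ‖u x - u y‖ₑ ^ 2 ∂μ ∂μ
        ≤ K * ∫⁻ a in Q, ∫⁻ y in A, ‖u (ψ a) - u y‖ₑ ^ 2 ∂μ := by
          rw [hK]
          exact h.lintegral_image_le hQm hQr hj.lintegral_prod_right'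
      _ ≤ K * ∫⁻ a in Q, K * ∫⁻ b in Q, ‖u (ψ a) - u (ψ b)‖ₑ ^ 2 := by
          gcongr with a
          rw [hK]
          exact h.lintegral_image_le hQm hQr (g := fun y => ‖u (ψ a) - u y‖ₑ ^ 2)
            (((measurable_const.sub hum).enorm).pow_const 2)
      _ = K * (K * ∫⁻ a in Q, ∫⁻ b in Q, ‖u (ψ a) - u (ψ b)‖ₑ ^ 2) := by
          rw [lintegral_const_mul' _ _ hKtop]
      _ ≤ K * (K * (ENNReal.ofReal d ^ 2 * (2 ^ n * (volume Q *
            ∫⁻ z in Q, ‖fderiv ℝ (fun a => u (ψ a)) z‖ₑ ^ 2)))) :=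
          mul_le_mul' le_rfl (mul_le_mul' le_rfl hp)
      _ ≤ K * (K * (ENNReal.ofReal d ^ 2 * (2 ^ n * ((K * μ A) *
            (ENNReal.ofReal lo⁻¹ * (K * ∫⁻ x in A, ENNReal.ofReal (Γ x) ∂μ)))))) := by
          refine mul_le_mul' le_rfl (mul_le_mul' le_rfl (mul_le_mul' le_rfl
            (mul_le_mul' le_rfl (mul_le_mul' ?_ hgrad))))
          rw [hK]
          exact h.le_measure_image hQr
      _ = _ := by ring
  rw [lintegral_lintegral_enorm_sub_sq (μ.restrict A) (integrable_smooth u)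
    (integrable_smooth (u ^ 2)), ← ofReal_integral_eq_lintegral_ofReal (integrable_smooth Γ)
    (Filter.Eventually.of_forall hΓ)] at hupper
  have hreal := ENNReal.toReal_mono (by finiteness) hupper
  have hΓint : 0 ≤ ∫ x in A, Γ x ∂μ := integral_nonneg hΓ
  simp only [ENNReal.toReal_mul, ENNReal.toReal_pow, ENNReal.toReal_ofReal', hK,
    ENNReal.toReal_ofNat, ENNReal.coe_toReal] at hreal
  have h1 := (le_max_left _ _).trans hreal
  rw [max_eq_left hd0, max_eq_left hΓint, max_eq_left (inv_pos.2 hlo).le,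
    measureReal_restrict_apply_univ, ← measureReal_def] at h1
  have h2 : 0 ≤ (C ^ n : ℝ) ^ 4 * 2 ^ n * lo⁻¹ * d ^ 2 * (μ.real A * ∫ x in A, Γ x ∂μ) := by
    positivity
  linarith

end ManifoldPoincare

/-! ### Test functionals controlling low energy functions -/

section Grid

variable {n : ℕ}

/-- The half-open cube with lowest corner `a` and side length `s`. -/
def halfOpenCube (a : EuclideanSpace ℝ (Fin n)) (s : ℝ) : Set (EuclideanSpace ℝ (Fin n)) :=
  {v | ∀ i, v i ∈ Ico (a i) (a i + s)}

/-- The lowest corner of the subcube with index `j`, when the half-open cube with lowest corner `a`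
and side length `k * s` is divided into `k ^ n` subcubes. -/
def subcubeCorner (a : EuclideanSpace ℝ (Fin n)) (s : ℝ) {k : ℕ} (j : Fin n → Fin k) :
    EuclideanSpace ℝ (Fin n) :=
  WithLp.toLp 2 fun i => a i + j i * s

lemma EuclideanSpace.norm_le_of_forall_abs_le {v : EuclideanSpace ℝ (Fin n)} {s : ℝ}
    (hs : 0 ≤ s) (h : ∀ i, |v i| ≤ s) : ‖v‖ ≤ n * s := by
  refine abs_le_of_sq_le_sq' ?_ (by positivity) |>.2
  rw [EuclideanSpace.norm_sq_eq]
  have h1 : ∀ i ∈ Finset.univ, ‖v i‖ ^ 2 ≤ s ^ 2 := fun i _ => by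
    rw [Real.norm_eq_abs]; gcongr; exact h i
  refine (Finset.sum_le_card_nsmul _ _ _ h1).trans ?_
  rw [Finset.card_univ, Fintype.card_fin, nsmul_eq_mul, mul_pow]
  gcongr
  exact_mod_cast Nat.le_self_pow two_ne_zero n

lemma measurableSet_halfOpenCube (a : EuclideanSpace ℝ (Fin n)) (s : ℝ) :
    MeasurableSet (halfOpenCube a s) := by
  have : halfOpenCube a s = ⋂ i, (fun v : EuclideanSpace ℝ (Fin n) => v i) ⁻¹'
      Ico (a i) (a i + s) := by
    ext v; simp [halfOpenCube]
  rw [this]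
  refine MeasurableSet.iInter fun i => ?_
  have hc : Continuous fun v : EuclideanSpace ℝ (Fin n) => v i := by fun_prop
  exact hc.measurable measurableSet_Ico

lemma convex_halfOpenCube (a : EuclideanSpace ℝ (Fin n)) (s : ℝ) : Convex ℝ (halfOpenCube a s) :=
  fun _ hv _ hw _ _ hp hq hpq i => convex_Ico (𝕜 := ℝ) (a i) (a i + s) (hv i) (hw i) hp hq hpq

lemma dist_le_of_mem_halfOpenCube {a v w : EuclideanSpace ℝ (Fin n)} {s : ℝ} (hs : 0 ≤ s)
    (hv : v ∈ halfOpenCube a s) (hw : w ∈ halfOpenCube a s) : dist v w ≤ n * s := by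
  rw [dist_eq_norm]
  refine EuclideanSpace.norm_le_of_forall_abs_le hs fun i => ?_
  have h1 := hv i
  have h2 := hw i
  rw [PiLp.sub_apply, abs_le]
  constructor <;> linarith [h1.1, h1.2, h2.1, h2.2]

lemma pairwise_disjoint_subcube (a : EuclideanSpace ℝ (Fin n)) {s : ℝ} (hs : 0 < s) {k : ℕ} :
    Pairwise (Function.onFun Disjoint
      fun j : Fin n → Fin k => halfOpenCube (subcubeCorner a s j) s) := by
  intro j l hjl
  refine disjoint_left.2 fun v hv hw => hjl (funext fun i => Fin.ext ?_)
  have h1 := hv i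
  have h2 := hw i
  simp only [subcubeCorner, mem_Ico] at h1 h2
  have e1 : ((j i : ℕ) : ℝ) < (l i : ℕ) + 1 := by nlinarith [h1.1, h2.2]
  have e2 : ((l i : ℕ) : ℝ) < (j i : ℕ) + 1 := by nlinarith [h2.1, h1.2]
  have e3 : (j i : ℕ) < l i + 1 := by exact_mod_cast e1
  have e4 : (l i : ℕ) < j i + 1 := by exact_mod_cast e2
  omega

lemma iUnion_subcube (a : EuclideanSpace ℝ (Fin n)) {s : ℝ} (hs : 0 < s) (k : ℕ) :
    ⋃ j : Fin n → Fin k, halfOpenCube (subcubeCorner a s j) s = halfOpenCube a (k * s) := by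
  ext v
  simp only [mem_iUnion]
  constructor
  · rintro ⟨j, hj⟩ i
    have h1 := hj i
    simp only [subcubeCorner, mem_Ico] at h1
    have h2 : ((j i : ℕ) : ℝ) + 1 ≤ k := by exact_mod_cast (j i).2
    constructor
    · nlinarith [h1.1, (Nat.cast_nonneg (j i : ℕ) : (0 : ℝ) ≤ _)]
    · nlinarith [h1.2]
  · intro hv
    have h0 : ∀ i, 0 ≤ (v i - a i) / s := fun i =>
      div_nonneg (sub_nonneg.2 (hv i).1) hs.le
    have hlt : ∀ i, ⌊(v i - a i) / s⌋₊ < k := fun i => by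
      rw [Nat.floor_lt (h0 i), div_lt_iff₀ hs]
      linarith [(hv i).2]
    refine ⟨fun i => ⟨_, hlt i⟩, fun i => ?_⟩
    have h1 := Nat.floor_le (h0 i)
    have h2 := Nat.lt_floor_add_one ((v i - a i) / s)
    rw [le_div_iff₀ hs] at h1
    rw [div_lt_iff₀ hs] at h2
    simp only [subcubeCorner, mem_Ico]
    constructor <;> linarith

end Grid

section GlobalPoincare

open scoped NNReal

variable {n : ℕ} {M : Type*} [EMetricSpace M] [ChartedSpace (EuclideanSpace ℝ (Fin n)) M]

lemma IsBiLipschitzChart.mono {x₀ : M} {C : ℝ≥0} {r r' : ℝ}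
    (h : IsBiLipschitzChart (n := n) x₀ C r) (hr' : 0 < r') (hle : r' ≤ r) :
    IsBiLipschitzChart (n := n) x₀ C r' :=
  have hs := Metric.closedBall_subset_closedBall (x := extChartAt (𝓡 n) x₀ x₀) hle
  ⟨hr', hs.trans h.subset_target, h.lipschitz.mono hs,
    fun u hu v hv => h.antilipschitz u (hs hu) v (hs hv)⟩

variable [IsManifold (𝓡 n) ∞ M] [CompactSpace M] [MeasurableSpace M] [BorelSpace M]

/-- Near a point of `M`, the `L²` norm of a function is controlled by its Dirichlet energy `∫ Γ u`
and by `k ^ n` of its averages, with a factor `k ^ (-2)` in front of the energy. -/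
lemma IsBiLipschitzChart.exists_nhds_integral_sq_le [IsFiniteMeasure (μHE[n] : Measure M)]
    {x₀ : M} {C : ℝ≥0} {r : ℝ} (h : IsBiLipschitzChart (n := n) x₀ C r)
    {Γ : C^∞⟮𝓡 n, M; ℝ⟯ → C^∞⟮𝓡 n, M; ℝ⟯} {lo : ℝ} (hlo : 0 < lo) (hΓ : ∀ u x, 0 ≤ Γ u x)
    (hΓu : ∀ u : C^∞⟮𝓡 n, M; ℝ⟯, ∀ v ∈ Metric.closedBall (extChartAt (𝓡 n) x₀ x₀) r,
      lo * ‖fderiv ℝ (fun a => u ((extChartAt (𝓡 n) x₀).symm a)) v‖ ^ 2 ≤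
        Γ u ((extChartAt (𝓡 n) x₀).symm v)) :
    ∃ D ∈ 𝓝 x₀, MeasurableSet D ∧ ∃ B : ℝ, 0 < B ∧ ∀ k : ℕ, 0 < k →
      ∃ (A : (Fin n → Fin k) → Set M) (a : (Fin n → Fin k) → ℝ), (∀ j, MeasurableSet (A j)) ∧
        ∀ u : C^∞⟮𝓡 n, M; ℝ⟯,
          ∫ x in D, u x ^ 2 ∂(μHE[n] : Measure M) ≤
            B / (k : ℝ) ^ 2 * ∫ x, Γ u x ∂(μHE[n] : Measure M) +
              ∑ j, a j * (∫ x in A j, u x ∂(μHE[n] : Measure M)) ^ 2 := by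
  set c := extChartAt (𝓡 n) x₀ x₀ with hc
  set ψ := (extChartAt (𝓡 n) x₀).symm with hψ
  set μ : Measure M := μHE[n] with hμ
  have hr := h.radius_pos
  -- A cube centred at `c` that is contained in the closed ball.
  set s : ℝ := r / (n + 1) with hs
  have hspos : 0 < s := by positivity
  have hns : n * s ≤ r := by
    rw [hs, mul_div_assoc', div_le_iff₀ (by positivity)]; nlinarith
  set b : EuclideanSpace ℝ (Fin n) := WithLp.toLp 2 fun i => c i - s / 2 with hb
  have hcb : c ∈ halfOpenCube b s := fun i => by
    simp only [hb, mem_Ico]; constructor <;> linarith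
  have hQr : halfOpenCube b s ⊆ Metric.closedBall c r := fun v hv =>
    (dist_le_of_mem_halfOpenCube hspos.le hv hcb).trans hns
  have hnhds : halfOpenCube b s ∈ 𝓝 c := by
    have hopen : IsOpen {v : EuclideanSpace ℝ (Fin n) | ∀ i, v i ∈ Ioo (b i) (b i + s)} := by
      have : {v : EuclideanSpace ℝ (Fin n) | ∀ i, v i ∈ Ioo (b i) (b i + s)} =
          ⋂ i, (fun v : EuclideanSpace ℝ (Fin n) => v i) ⁻¹' Ioo (b i) (b i + s) := by
        ext v; simp
      rw [this]
      refine isOpen_iInter_of_finite fun i => ?_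
      have hcont : Continuous fun v : EuclideanSpace ℝ (Fin n) => v i := by fun_prop
      exact isOpen_Ioo.preimage hcont
    refine Filter.mem_of_superset (hopen.mem_nhds fun i => ?_)
      fun v hv i => Ioo_subset_Ico_self (hv i)
    simp only [hb, mem_Ioo]; constructor <;> linarith
  refine ⟨ψ '' halfOpenCube b s, ?_, h.measurableSet_image (measurableSet_halfOpenCube b s) hQr,
    (C ^ n) ^ 4 * 2 ^ n * lo⁻¹ * (n * s) ^ 2 + 1, by positivity, fun k hk => ?_⟩
  · have := h.image_closedBall_mem_nhds (Metric.mem_closedBall_self hr.le) hnhds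
    rwa [extChartAt_to_inv] at this
  have hk' : (0 : ℝ) < k := by exact_mod_cast hk
  have hsk : 0 < s / k := by positivity
  set Q : (Fin n → Fin k) → Set (EuclideanSpace ℝ (Fin n)) :=
    fun j => halfOpenCube (subcubeCorner b (s / k) j) (s / k) with hQ
  have hunion : ⋃ j, Q j = halfOpenCube b s := by
    rw [hQ, iUnion_subcube b hsk k, mul_div_cancel₀ _ hk'.ne']
  have hQj : ∀ j, Q j ⊆ halfOpenCube b s := fun j => hunion ▸ subset_iUnion Q j
  have hQm : ∀ j, MeasurableSet (Q j) := fun j => measurableSet_halfOpenCube _ _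
  have hAm : ∀ j, MeasurableSet (ψ '' Q j) := fun j =>
    h.measurableSet_image (hQm j) ((hQj j).trans hQr)
  have hdisj : Pairwise (Function.onFun Disjoint fun j => ψ '' Q j) := fun j l hjl =>
    (pairwise_disjoint_subcube b hsk hjl).image ψ.injOn
      ((hQj j).trans (hQr.trans h.subset_target)) ((hQj l).trans (hQr.trans h.subset_target))
  refine ⟨fun j => ψ '' Q j, fun j => (μ.real (ψ '' Q j))⁻¹, hAm, fun u => ?_⟩
  set K : ℝ := (C ^ n) ^ 4 * 2 ^ n * lo⁻¹ * (n * (s / k)) ^ 2 with hK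
  have hK0 : 0 ≤ K := by positivity
  have hpiece : ∀ j, ∫ x in ψ '' Q j, u x ^ 2 ∂μ ≤
      (μ.real (ψ '' Q j))⁻¹ * (∫ x in ψ '' Q j, u x ∂μ) ^ 2 +
        K * ∫ x in ψ '' Q j, Γ u x ∂μ := by
    intro j
    have hG : 0 ≤ ∫ x in ψ '' Q j, Γ u x ∂μ := integral_nonneg (hΓ u)
    rcases eq_or_ne (μ (ψ '' Q j)) 0 with h0 | h0
    · rw [Measure.restrict_eq_zero.2 h0] at hG ⊢
      simp
    have hpos : 0 < μ.real (ψ '' Q j) := ENNReal.toReal_pos h0 (measure_ne_top _ _)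
    have hp := h.measure_mul_integral_sq_le hlo u (hΓ u) (hΓu u) (convex_halfOpenCube _ _)
      (hQm j) ((hQj j).trans hQr) (d := n * (s / k)) (by positivity)
      fun a ha b hb => dist_le_of_mem_halfOpenCube hsk.le ha hb
    rw [inv_mul_eq_div, div_add' _ _ _ hpos.ne', le_div_iff₀ hpos]
    linarith
  have hiu : ∫ x in ψ '' halfOpenCube b s, u x ^ 2 ∂μ =
      ∑ j, ∫ x in ψ '' Q j, u x ^ 2 ∂μ := by
    rw [← hunion, image_iUnion, integral_iUnion_fintype hAm hdisj]
    exact fun j => (integrable_smooth (u ^ 2)).integrableOn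
  have hiΓ : ∑ j, ∫ x in ψ '' Q j, Γ u x ∂μ ≤ ∫ x, Γ u x ∂μ := by
    rw [← integral_iUnion_fintype hAm hdisj fun j => (integrable_smooth (Γ u)).integrableOn]
    exact setIntegral_le_integral (integrable_smooth (Γ u)) (Filter.Eventually.of_forall (hΓ u))
  have hG : 0 ≤ ∫ x, Γ u x ∂μ := integral_nonneg (hΓ u)
  have hKB : K ≤ ((C ^ n) ^ 4 * 2 ^ n * lo⁻¹ * (n * s) ^ 2 + 1) / (k : ℝ) ^ 2 := by
    have : n * (s / k) * k = n * s := by field_simp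
    rw [hK, le_div_iff₀ (by positivity), mul_assoc _ _ ((k : ℝ) ^ 2), ← mul_pow, this]
    linarith
  calc ∫ x in ψ '' halfOpenCube b s, u x ^ 2 ∂μ
      = ∑ j, ∫ x in ψ '' Q j, u x ^ 2 ∂μ := hiu
    _ ≤ ∑ j, ((μ.real (ψ '' Q j))⁻¹ * (∫ x in ψ '' Q j, u x ∂μ) ^ 2 +
        K * ∫ x in ψ '' Q j, Γ u x ∂μ) := Finset.sum_le_sum fun j _ => hpiece j
    _ = K * ∑ j, ∫ x in ψ '' Q j, Γ u x ∂μ +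
        ∑ j, (μ.real (ψ '' Q j))⁻¹ * (∫ x in ψ '' Q j, u x ∂μ) ^ 2 := by
      rw [Finset.sum_add_distrib, Finset.mul_sum, add_comm]
    _ ≤ K * ∫ x, Γ u x ∂μ +
        ∑ j, (μ.real (ψ '' Q j))⁻¹ * (∫ x in ψ '' Q j, u x ∂μ) ^ 2 := by gcongr
    _ ≤ _ := by gcongr

/-- On a compact manifold, the `L²` norm of a function is controlled by its Dirichlet energy `∫ Γ u`
and by `O(k ^ n)` of its averages, with a factor `O(k ^ (-2))` in front of the energy. -/
lemma exists_integral_sq_le_energy_add_sum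
    (hM : ∀ x₀ : M, ∃ (C : ℝ≥0) (r : ℝ), IsBiLipschitzChart (n := n) x₀ C r)
    {Γ : C^∞⟮𝓡 n, M; ℝ⟯ → C^∞⟮𝓡 n, M; ℝ⟯} (hΓ : ∀ u x, 0 ≤ Γ u x)
    (hΓu : ∀ x₀ : M, ∃ r lo : ℝ, 0 < r ∧ 0 < lo ∧
      ∀ u : C^∞⟮𝓡 n, M; ℝ⟯, ∀ v ∈ Metric.closedBall (extChartAt (𝓡 n) x₀ x₀) r,
      lo * ‖fderiv ℝ (fun a => u ((extChartAt (𝓡 n) x₀).symm a)) v‖ ^ 2 ≤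
        Γ u ((extChartAt (𝓡 n) x₀).symm v)) :
    ∃ (m : ℕ) (B : ℝ), 0 < B ∧ ∀ k : ℕ, 0 < k → ∃ (ι : Type) (_ : Fintype ι) (A : ι → Set M)
      (a : ι → ℝ), Fintype.card ι ≤ m * k ^ n ∧ (∀ j, MeasurableSet (A j)) ∧
        ∀ u : C^∞⟮𝓡 n, M; ℝ⟯,
          ∫ x, u x ^ 2 ∂(μHE[n] : Measure M) ≤
            B / (k : ℝ) ^ 2 * ∫ x, Γ u x ∂(μHE[n] : Measure M) +
              ∑ j, a j * (∫ x in A j, u x ∂(μHE[n] : Measure M)) ^ 2 := by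
  have hfin := isFiniteMeasure_of_isBiLipschitzChart hM
  set μ : Measure M := μHE[n] with hμ
  have hloc : ∀ x₀ : M, ∃ D ∈ 𝓝 x₀, MeasurableSet D ∧ ∃ B : ℝ, 0 < B ∧ ∀ k : ℕ, 0 < k →
      ∃ (A : (Fin n → Fin k) → Set M) (a : (Fin n → Fin k) → ℝ), (∀ j, MeasurableSet (A j)) ∧
        ∀ u : C^∞⟮𝓡 n, M; ℝ⟯, ∫ x in D, u x ^ 2 ∂μ ≤ B / (k : ℝ) ^ 2 * ∫ x, Γ u x ∂μ +
              ∑ j, a j * (∫ x in A j, u x ∂μ) ^ 2 := by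
    intro x₀
    obtain ⟨C, r, h⟩ := hM x₀
    obtain ⟨r', lo, hr', hlo, hb⟩ := hΓu x₀
    exact (h.mono (lt_min h.radius_pos hr') (min_le_left r r')).exists_nhds_integral_sq_le hlo hΓ
      fun u v hv => hb u v (Metric.closedBall_subset_closedBall (min_le_right r r') hv)
  choose D hD hDm B hB A a hAm hle using hloc
  obtain ⟨t, -, ht⟩ := isCompact_univ.elim_nhds_subcover D fun x₀ _ => hD x₀
  have hG : ∀ u, 0 ≤ ∫ x, Γ u x ∂μ := fun u => integral_nonneg (hΓ u)
  refine ⟨t.card, ∑ x₀ ∈ t, B x₀ + 1, ?_, fun k hk => ?_⟩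
  · have := Finset.sum_nonneg fun x₀ (_ : x₀ ∈ t) => (hB x₀).le
    linarith
  set e := t.equivFin with he
  refine ⟨Fin t.card × (Fin n → Fin k), inferInstance, fun p => A (e.symm p.1) k hk p.2,
    fun p => a (e.symm p.1) k hk p.2, ?_, fun p => hAm _ k hk p.2, fun u => ?_⟩
  · simp
  have hsq : Integrable (fun x => u x ^ 2) μ := integrable_smooth (u ^ 2)
  calc ∫ x, u x ^ 2 ∂μ ≤ ∫ x, ∑ x₀ ∈ t, (D x₀).indicator (fun x => u x ^ 2) x ∂μ := by
        refine integral_mono hsq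
          (integrable_finsetSum _ fun x₀ _ => hsq.indicator (hDm x₀)) fun x => ?_
        obtain ⟨y, hy, hxy⟩ := mem_iUnion₂.1 (ht (mem_univ x))
        have h1 := Finset.single_le_sum (f := fun x₀ => (D x₀).indicator (fun x => u x ^ 2) x)
          (fun x₀ _ => indicator_nonneg (fun x _ => sq_nonneg (u x)) x) hy
        simpa [indicator_of_mem hxy] using h1
    _ = ∑ x₀ ∈ t, ∫ x in D x₀, u x ^ 2 ∂μ := by
        rw [integral_finsetSum _ fun x₀ _ => hsq.indicator (hDm x₀)]
        exact Finset.sum_congr rfl fun x₀ _ => integral_indicator (hDm x₀)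
    _ ≤ ∑ x₀ ∈ t, (B x₀ / (k : ℝ) ^ 2 * ∫ x, Γ u x ∂μ +
          ∑ j, a x₀ k hk j * (∫ x in A x₀ k hk j, u x ∂μ) ^ 2) :=
        Finset.sum_le_sum fun x₀ _ => hle x₀ k hk u
    _ = (∑ x₀ ∈ t, B x₀) / (k : ℝ) ^ 2 * ∫ x, Γ u x ∂μ +
          ∑ x₀ ∈ t, ∑ j, a x₀ k hk j * (∫ x in A x₀ k hk j, u x ∂μ) ^ 2 := by
        rw [Finset.sum_add_distrib, Finset.sum_div, Finset.sum_mul]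
    _ ≤ (∑ x₀ ∈ t, B x₀ + 1) / (k : ℝ) ^ 2 * ∫ x, Γ u x ∂μ +
          ∑ x₀ ∈ t, ∑ j, a x₀ k hk j * (∫ x in A x₀ k hk j, u x ∂μ) ^ 2 := by
        have := hG u
        gcongr
        linarith
    _ = _ := by
        congr 1
        rw [Fintype.sum_prod_type, ← Finset.sum_coe_sort t, ← Equiv.sum_comp e.symm]

end GlobalPoincare

/-! ### Many bump functions with disjoint supports and low energy -/

section Bumps

open scoped NNReal

variable {n : ℕ} {M : Type*} [EMetricSpace M] [ChartedSpace (EuclideanSpace ℝ (Fin n)) M]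
  [IsManifold (𝓡 n) ∞ M] [CompactSpace M] [MeasurableSpace M] [BorelSpace M]
  {P : C^∞⟮𝓡 n, M; ℝ⟯ →ₗ[ℝ] C^∞⟮𝓡 n, M; ℝ⟯}

/-- Rescaled bump functions in a chart, of width `σ`, have Dirichlet energy `O(σ ^ (-2))` relative
to their `L²` norm. -/
lemma IsBiLipschitzChart.exists_bump [IsFiniteMeasure (μHE[n] : Measure M)]
    {x₀ : M} {C : ℝ≥0} {r : ℝ} (h : IsBiLipschitzChart (n := n) x₀ C r) (hP : IsDiffOp 2 P)
    {hi : ℝ} (hhi : 0 ≤ hi)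
    (hPu : ∀ u : C^∞⟮𝓡 n, M; ℝ⟯, ∀ v ∈ Metric.closedBall (extChartAt (𝓡 n) x₀ x₀) r,
      carreDuChamp P u u ((extChartAt (𝓡 n) x₀).symm v) ≤
        hi * ‖fderiv ℝ (fun a => u ((extChartAt (𝓡 n) x₀).symm a)) v‖ ^ 2) :
    ∃ Λ : ℝ, 0 < Λ ∧ ∀ (z : EuclideanSpace ℝ (Fin n)) (σ : ℝ), 0 < σ →
      Metric.closedBall z (2 * σ) ⊆ Metric.closedBall (extChartAt (𝓡 n) x₀ x₀) (r / 2) →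
      ∃ f : C^∞⟮𝓡 n, M; ℝ⟯,
        (∀ x ∉ (extChartAt (𝓡 n) x₀).symm '' Metric.closedBall z (2 * σ), f x = 0) ∧
        0 < ∫ x, f x ^ 2 ∂(μHE[n] : Measure M) ∧
        ∫ x, carreDuChamp P f f x ∂(μHE[n] : Measure M) ≤
          Λ / σ ^ 2 * ∫ x, f x ^ 2 ∂(μHE[n] : Measure M) := by
  set φ := extChartAt (𝓡 n) x₀ with hφ
  set c := φ x₀ with hc
  set μ : Measure M := μHE[n] with hμ
  have hr := h.radius_pos
  let χ : SmoothBumpFunction (𝓡 n) x₀ :=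
    { rIn := r / 2
      rOut := r
      rIn_pos := half_pos hr
      rIn_lt_rOut := half_lt_self hr
      closedBall_subset := inter_subset_left.trans h.subset_target }
  let β : ContDiffBump (0 : EuclideanSpace ℝ (Fin n)) := ⟨1, 2, one_pos, one_lt_two⟩
  have hβs : ContDiff ℝ ∞ β := β.contDiff
  obtain ⟨b, hb⟩ : ∃ b, ∀ v, ‖fderiv ℝ β v‖ ≤ b :=
    ((hβs.continuous_fderiv (by simp)).norm.bddAbove_range_of_hasCompactSupport
      (β.hasCompactSupport.fderiv ℝ).norm).imp fun b hb v => hb (mem_range_self v)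
  set Λ : ℝ := hi * b ^ 2 * C ^ n * 2 ^ n * C ^ n + 1 with hΛ
  refine ⟨Λ, by positivity, fun z σ hσ hzσ => ?_⟩
  have hhalf : Metric.closedBall c (r / 2) ⊆ Metric.closedBall c r :=
    Metric.closedBall_subset_closedBall (by linarith)
  have hzr := hzσ.trans hhalf
  set g : EuclideanSpace ℝ (Fin n) → ℝ := fun v => β (σ⁻¹ • (v - z)) with hg
  have hgs : ContDiff ℝ ∞ g := by fun_prop
  have hgzero : ∀ v ∉ Metric.closedBall z (2 * σ), g v = 0 := by
    intro v hv
    refine β.zero_of_le_dist ?_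
    rw [Metric.mem_closedBall, not_le, dist_eq_norm] at hv
    rw [dist_zero_right, norm_smul, norm_inv, Real.norm_of_nonneg hσ.le, inv_mul_eq_div]
    exact (le_div_iff₀ hσ).2 hv.le
  have hgone : ∀ v ∈ Metric.closedBall z σ, g v = 1 := by
    intro v hv
    refine β.one_of_mem_closedBall ?_
    rw [Metric.mem_closedBall, dist_eq_norm] at hv
    rw [mem_closedBall_zero_iff, norm_smul, norm_inv, Real.norm_of_nonneg hσ.le, inv_mul_eq_div]
    exact (div_le_one hσ).2 hv
  have hgd : ∀ v, ‖fderiv ℝ g v‖ ≤ σ⁻¹ * b := by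
    intro v
    have h1 : HasFDerivAt g ((fderiv ℝ β (σ⁻¹ • (v - z))).comp
        (σ⁻¹ • ContinuousLinearMap.id ℝ (EuclideanSpace ℝ (Fin n)))) v :=
      ((hβs.differentiable (by simp)).differentiableAt.hasFDerivAt).comp v
        (((hasFDerivAt_id v).sub_const z).const_smul σ⁻¹)
    rw [h1.fderiv, ContinuousLinearMap.comp_smul, ContinuousLinearMap.comp_id, norm_smul, norm_inv,
      Real.norm_of_nonneg hσ.le]
    gcongr
    exact hb _
  set f := bumpLift χ g hgs with hf
  set A := φ.symm '' Metric.closedBall z (2 * σ) with hA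
  have hfzero : ∀ x ∉ A, f x = 0 := by
    intro x hx
    rw [hf, bumpLift_apply]
    by_cases hxs : x ∈ φ.source
    · rw [hgzero, mul_zero]
      exact fun hv => hx ⟨_, hv, φ.left_inv hxs⟩
    · have : χ x = 0 := by
        by_contra h0
        have := χ.support_subset_source h0
        rw [← extChartAt_source (𝓡 n)] at this
        exact hxs this
      rw [this, zero_mul]
  have hfψ : ∀ v ∈ φ.target, f (φ.symm v) = g v := by
    intro v hv
    rw [hf, bumpLift_apply, ← hφ, φ.right_inv hv]
    by_cases hvz : v ∈ Metric.closedBall z (2 * σ)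
    · have : χ (φ.symm v) = 1 := by
        refine χ.one_of_dist_le ?_ ?_
        · rw [← extChartAt_source (𝓡 n)]; exact φ.map_target hv
        · change dist (φ (φ.symm v)) c ≤ r / 2
          rw [φ.right_inv hv]; exact hzσ hvz
      rw [this, one_mul]
    · rw [hgzero v hvz, mul_zero]
  have hAm : MeasurableSet A := h.measurableSet_image Metric.isClosed_closedBall.measurableSet hzr
  have hAc : IsClosed A :=
    ((isCompact_closedBall z (2 * σ)).image_of_continuousOn (h.continuousOn_symm.mono hzr)).isClosed
  have hΓzero : ∀ x ∉ A, carreDuChamp P f f x = 0 := fun x hx =>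
    carreDuChamp_eq_zero_of_eventuallyEq_zero hP f
      (Filter.mem_of_superset (hAc.isOpen_compl.mem_nhds hx) fun y hy => hfzero y hy)
  have hΓle : ∀ x ∈ A, carreDuChamp P f f x ≤ hi * (σ⁻¹ * b) ^ 2 := by
    rintro _ ⟨v, hv, rfl⟩
    refine (hPu f v (hzr hv)).trans ?_
    have hvt := h.subset_target (hzr hv)
    have : (fun a => f (φ.symm a)) =ᶠ[𝓝 v] g :=
      Filter.mem_of_superset ((isOpen_extChartAt_target (I := 𝓡 n) x₀).mem_nhds hvt) hfψ
    rw [this.fderiv_eq]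
    gcongr
    exact hgd v
  -- Both measures are compared with the volume of balls in the chart.
  set V : ℝ := (volume (Metric.closedBall (0 : EuclideanSpace ℝ (Fin n)) 1)).toReal with hV
  have hVpos : 0 < V := ENNReal.toReal_pos
    (Metric.measure_closedBall_pos _ _ one_pos).ne' measure_closedBall_lt_top.ne
  have hvol : ∀ t : ℝ, 0 < t → (volume (Metric.closedBall z t)).toReal = t ^ n * V := by
    intro t ht
    rw [Measure.addHaar_closedBall' _ _ ht.le, finrank_euclideanSpace_fin, ENNReal.toReal_mul,
      ENNReal.toReal_ofReal (by positivity)]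
  have hAle : μ.real A ≤ C ^ n * ((2 * σ) ^ n * V) := by
    have := ENNReal.toReal_mono (ENNReal.mul_ne_top (ENNReal.pow_ne_top ENNReal.coe_ne_top)
      measure_closedBall_lt_top.ne) (h.measure_image_le hzr)
    rwa [ENNReal.toReal_mul, ENNReal.toReal_pow, ENNReal.coe_toReal, hvol _ (by positivity)] at this
  have hsub : Metric.closedBall z σ ⊆ Metric.closedBall z (2 * σ) :=
    Metric.closedBall_subset_closedBall (by linarith)
  set A' := φ.symm '' Metric.closedBall z σ with hA'
  have hA'm : MeasurableSet A' :=
    h.measurableSet_image Metric.isClosed_closedBall.measurableSet (hsub.trans hzr)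
  have hA'le : σ ^ n * V ≤ C ^ n * μ.real A' := by
    have := ENNReal.toReal_mono (ENNReal.mul_ne_top (ENNReal.pow_ne_top ENNReal.coe_ne_top)
      (measure_ne_top μ A')) (h.le_measure_image (hsub.trans hzr))
    rwa [ENNReal.toReal_mul, ENNReal.toReal_pow, ENNReal.coe_toReal, hvol _ hσ] at this
  have hsq : Integrable (fun x => f x ^ 2) μ := integrable_smooth (f ^ 2)
  have hA'f : μ.real A' ≤ ∫ x, f x ^ 2 ∂μ := by
    have h1 : ∫ x in A', f x ^ 2 ∂μ = ∫ x in A', (1 : ℝ) ∂μ := by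
      refine setIntegral_congr_fun hA'm ?_
      rintro _ ⟨v, hv, rfl⟩
      simp only
      rw [hfψ v (h.subset_target (hzr (hsub hv))), hgone v hv, one_pow]
    have h2 := setIntegral_le_integral hsq (s := A')
      (Filter.Eventually.of_forall fun x => sq_nonneg (f x))
    rw [h1, setIntegral_const, smul_eq_mul, mul_one] at h2
    exact h2
  have hlow : σ ^ n * V ≤ C ^ n * ∫ x, f x ^ 2 ∂μ := hA'le.trans (by gcongr)
  have hσV : 0 < σ ^ n * V := by positivity
  have hIpos : 0 < ∫ x, f x ^ 2 ∂μ := by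
    refine (integral_nonneg fun x => sq_nonneg (f x)).lt_of_ne fun h0 => ?_
    rw [← h0, mul_zero] at hlow
    exact hlow.not_gt hσV
  refine ⟨f, hfzero, hIpos, ?_⟩
  have hint : ∫ x, carreDuChamp P f f x ∂μ = ∫ x in A, carreDuChamp P f f x ∂μ :=
    (setIntegral_eq_integral_of_forall_compl_eq_zero hΓzero).symm
  calc ∫ x, carreDuChamp P f f x ∂μ
      = ∫ x in A, carreDuChamp P f f x ∂μ := hint
    _ ≤ ∫ x in A, hi * (σ⁻¹ * b) ^ 2 ∂μ :=
        setIntegral_mono_on (integrable_smooth _).integrableOn (integrable_const _) hAm hΓle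
    _ = μ.real A * (hi * (σ⁻¹ * b) ^ 2) := by rw [setIntegral_const, smul_eq_mul]
    _ ≤ (C ^ n * ((2 * σ) ^ n * V)) * (hi * (σ⁻¹ * b) ^ 2) := by gcongr
    _ = (hi * b ^ 2 * C ^ n * 2 ^ n / σ ^ 2) * (σ ^ n * V) := by
        rw [mul_pow, mul_pow, inv_pow]; field_simp
    _ ≤ (hi * b ^ 2 * C ^ n * 2 ^ n / σ ^ 2) * (C ^ n * ∫ x, f x ^ 2 ∂μ) := by gcongr
    _ = (hi * b ^ 2 * C ^ n * 2 ^ n * C ^ n) / σ ^ 2 * ∫ x, f x ^ 2 ∂μ := by ring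
    _ ≤ Λ / σ ^ 2 * ∫ x, f x ^ 2 ∂μ := by
        gcongr
        rw [hΛ]; linarith

/-- There are spaces of smooth functions of dimension `k ^ n` on which the Dirichlet energy is
`O(k ^ 2)` relative to the `L²` norm. -/
lemma exists_energy_sum_le [Nonempty M]
    (hM : ∀ x₀ : M, ∃ (C : ℝ≥0) (r : ℝ), IsBiLipschitzChart (n := n) x₀ C r) (hP : IsDiffOp 2 P)
    (hPu : ∀ x₀ : M, ∃ r hi : ℝ, 0 < r ∧ 0 < hi ∧
      ∀ u : C^∞⟮𝓡 n, M; ℝ⟯, ∀ v ∈ Metric.closedBall (extChartAt (𝓡 n) x₀ x₀) r,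
      carreDuChamp P u u ((extChartAt (𝓡 n) x₀).symm v) ≤
        hi * ‖fderiv ℝ (fun a => u ((extChartAt (𝓡 n) x₀).symm a)) v‖ ^ 2) :
    ∃ Λ : ℝ, 0 < Λ ∧ ∀ k : ℕ, 0 < k → ∃ f : (Fin n → Fin k) → C^∞⟮𝓡 n, M; ℝ⟯,
      ∀ c : (Fin n → Fin k) → ℝ, c ≠ 0 →
        0 < ∫ x, (∑ j, c j • f j) x ^ 2 ∂(μHE[n] : Measure M) ∧
        ∫ x, carreDuChamp P (∑ j, c j • f j) (∑ j, c j • f j) x ∂(μHE[n] : Measure M) ≤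
          Λ * (k : ℝ) ^ 2 * ∫ x, (∑ j, c j • f j) x ^ 2 ∂(μHE[n] : Measure M) := by
  have hfin := isFiniteMeasure_of_isBiLipschitzChart hM
  set μ : Measure M := μHE[n] with hμ
  obtain ⟨x₀⟩ := ‹Nonempty M›
  obtain ⟨C, r₁, h₁⟩ := hM x₀
  obtain ⟨r₂, hi, hr₂, hhi, hbound⟩ := hPu x₀
  obtain ⟨r, h, hrr⟩ : ∃ r, IsBiLipschitzChart (n := n) x₀ C r ∧ r ≤ r₂ :=
    ⟨_, h₁.mono (lt_min h₁.radius_pos hr₂) (min_le_left r₁ r₂), min_le_right r₁ r₂⟩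
  have hr := h.radius_pos
  obtain ⟨Λ, hΛ, hbump⟩ := h.exists_bump hP hhi.le fun u v hv =>
    hbound u v (Metric.closedBall_subset_closedBall hrr hv)
  set φ := extChartAt (𝓡 n) x₀ with hφ
  set c₀ := φ x₀ with hc₀
  refine ⟨Λ * ((10 * n + 5) / r) ^ 2, by positivity, fun k hk => ?_⟩
  have hk' : (1 : ℝ) ≤ k := by exact_mod_cast hk
  -- The centres of the supports form a grid of mesh `5 * σ`.
  set σ : ℝ := r / (k * (10 * n + 5)) with hσdef
  have hσ : 0 < σ := by positivity
  have hσr : (5 * n * k + 2) * σ ≤ r / 2 := by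
    rw [hσdef, mul_div_assoc', div_le_div_iff₀ (by positivity) two_pos]
    nlinarith
  set z : (Fin n → Fin k) → EuclideanSpace ℝ (Fin n) := fun j => subcubeCorner c₀ (5 * σ) j with hz
  have hzsub : ∀ j, Metric.closedBall (z j) (2 * σ) ⊆ Metric.closedBall c₀ (r / 2) := by
    intro j
    refine Metric.closedBall_subset_closedBall' ?_
    have : dist (z j) c₀ ≤ n * (k * (5 * σ)) := by
      rw [dist_eq_norm]
      refine EuclideanSpace.norm_le_of_forall_abs_le (by positivity) fun i => ?_
      have hj : ((j i : ℕ) : ℝ) ≤ k := by exact_mod_cast (j i).2.le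
      simp only [hz, subcubeCorner, PiLp.sub_apply, add_sub_cancel_left]
      rw [abs_of_nonneg (by positivity)]
      gcongr
    linarith
  have hzdisj : ∀ i j, i ≠ j →
      Disjoint (Metric.closedBall (z i) (2 * σ)) (Metric.closedBall (z j) (2 * σ)) := by
    intro i j hij
    refine Metric.closedBall_disjoint_closedBall ?_
    obtain ⟨l, hl⟩ := Function.ne_iff.1 hij
    have h1 : (1 : ℝ) ≤ |((i l : ℕ) : ℝ) - (j l : ℕ)| := by
      have h2 : (1 : ℤ) ≤ |((i l : ℕ) : ℤ) - (j l : ℕ)| :=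
        Int.one_le_abs (sub_ne_zero.2 (by exact_mod_cast fun h => hl (Fin.ext h)))
      exact_mod_cast h2
    have h3 := PiLp.norm_apply_le (z i - z j) l
    have h4 : (z i - z j) l = (((i l : ℕ) : ℝ) - (j l : ℕ)) * (5 * σ) := by
      simp only [hz, subcubeCorner, PiLp.sub_apply]; ring
    rw [h4, Real.norm_eq_abs, abs_mul, abs_of_pos (by positivity : 0 < 5 * σ)] at h3
    rw [dist_eq_norm]
    nlinarith
  choose f hfzero hfpos hfle using fun j => hbump (z j) σ hσ (hzsub j)
  set A : (Fin n → Fin k) → Set M := fun j => φ.symm '' Metric.closedBall (z j) (2 * σ) with hA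
  have hzr : ∀ j, Metric.closedBall (z j) (2 * σ) ⊆ Metric.closedBall c₀ r := fun j =>
    (hzsub j).trans (Metric.closedBall_subset_closedBall (by linarith))
  have hAc : ∀ j, IsClosed (A j) := fun j =>
    ((isCompact_closedBall (z j) (2 * σ)).image_of_continuousOn
      (h.continuousOn_symm.mono (hzr j))).isClosed
  have hAdisj : ∀ i j, i ≠ j → Disjoint (A i) (A j) := fun i j hij =>
    (hzdisj i j hij).image φ.symm.injOn ((hzr i).trans h.subset_target)
      ((hzr j).trans h.subset_target)
  have hout : ∀ i j, i ≠ j → ∀ x, x ∉ A i ∨ x ∉ A j := fun i j hij x => by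
    by_contra! hx
    exact disjoint_left.1 (hAdisj i j hij) hx.1 hx.2
  have hmul : ∀ i j, i ≠ j → ∀ x, f i x * f j x = 0 := fun i j hij x => by
    rcases hout i j hij x with hx | hx
    · rw [hfzero i x hx, zero_mul]
    · rw [hfzero j x hx, mul_zero]
  have hΓzero : ∀ (g : C^∞⟮𝓡 n, M; ℝ⟯) j, ∀ x ∉ A j, carreDuChamp P g (f j) x = 0 := fun g j x hx =>
    carreDuChamp_eq_zero_of_eventuallyEq_zero hP g
      (Filter.mem_of_superset ((hAc j).isOpen_compl.mem_nhds hx) fun y hy => hfzero j y hy)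
  have hΓ : ∀ i j, i ≠ j → ∀ x, carreDuChamp P (f i) (f j) x = 0 := fun i j hij x => by
    rcases hout i j hij x with hx | hx
    · rw [carreDuChamp_comm]; exact hΓzero _ i x hx
    · exact hΓzero _ j x hx
  refine ⟨f, fun c hc => ?_⟩
  have hsqeq : ∀ x, (∑ j, c j • f j) x ^ 2 = ∑ j, c j ^ 2 * f j x ^ 2 := fun x => by
    rw [sum_smul_apply, sq, Finset.sum_mul_sum]
    refine Finset.sum_congr rfl fun i _ => ?_
    rw [Finset.sum_eq_single i _ (by simp)]
    · ring
    · intro j _ hij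
      rw [mul_mul_mul_comm, hmul i j hij.symm, mul_zero]
  have hΓeq : ∀ x, carreDuChamp P (∑ j, c j • f j) (∑ j, c j • f j) x =
      ∑ j, c j ^ 2 * carreDuChamp P (f j) (f j) x := fun x => by
    rw [carreDuChamp_sum_sum]
    refine Finset.sum_congr rfl fun i _ => ?_
    rw [Finset.sum_eq_single i _ (by simp)]
    · ring
    · intro j _ hij
      rw [hΓ i j hij.symm, mul_zero]
  have hsqint : ∫ x, (∑ j, c j • f j) x ^ 2 ∂μ = ∑ j, c j ^ 2 * ∫ x, f j x ^ 2 ∂μ := by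
    simp_rw [hsqeq]
    have hi : ∀ j, Integrable (fun x => f j x ^ 2) μ := fun j => integrable_smooth (f j ^ 2)
    rw [integral_finsetSum _ fun j _ => (hi j).const_mul _]
    exact Finset.sum_congr rfl fun j _ => integral_const_mul _ _
  have hΓint : ∫ x, carreDuChamp P (∑ j, c j • f j) (∑ j, c j • f j) x ∂μ =
      ∑ j, c j ^ 2 * ∫ x, carreDuChamp P (f j) (f j) x ∂μ := by
    simp_rw [hΓeq]
    rw [integral_finsetSum _ fun j _ =>
      (integrable_smooth (carreDuChamp P (f j) (f j))).const_mul _]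
    exact Finset.sum_congr rfl fun j _ => integral_const_mul _ _
  rw [hsqint, hΓint]
  constructor
  · obtain ⟨l, hl⟩ := Function.ne_iff.1 hc
    refine Finset.sum_pos' (fun j _ => mul_nonneg (sq_nonneg _) (hfpos j).le)
      ⟨l, Finset.mem_univ l, mul_pos (pow_pos (abs_pos.2 hl) 2 |>.trans_eq (sq_abs _)) (hfpos l)⟩
  · rw [Finset.mul_sum]
    refine Finset.sum_le_sum fun j _ => ?_
    rw [mul_left_comm]
    refine mul_le_mul_of_nonneg_left ((hfle j).trans_eq ?_) (sq_nonneg _)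
    congr 1
    rw [hσdef]
    field_simp

end Bumps

/-! ### The quadratic form of a self-adjoint elliptic operator -/

section QuadraticForm

open scoped NNReal

variable {n : ℕ} {M : Type*} [EMetricSpace M] [ChartedSpace (EuclideanSpace ℝ (Fin n)) M]
  [CompactSpace M] [MeasurableSpace M] [BorelSpace M]

lemma isOpenPosMeasure_of_isBiLipschitzChart [Nonempty M]
    (hM : ∀ x₀ : M, ∃ (C : ℝ≥0) (r : ℝ), IsBiLipschitzChart (n := n) x₀ C r) :
    (μHE[n] : Measure M).IsOpenPosMeasure := by
  obtain ⟨a, b, ha, -, hab⟩ := exists_uniform_measure_eball_bounds hM 1 one_pos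
  refine ⟨fun U hU ⟨x, hx⟩ h0 => ?_⟩
  obtain ⟨ε, hε, hεU⟩ := EMetric.mem_nhds_iff.1 (hU.mem_nhds hx)
  obtain ⟨s, hs0, hs1, hsε⟩ : ∃ s : ℝ, 0 < s ∧ s ≤ 1 ∧ ENNReal.ofReal s ≤ ε := by
    rcases eq_or_ne ε ⊤ with rfl | hne
    · exact ⟨1, one_pos, le_rfl, le_top⟩
    · exact ⟨min 1 ε.toReal, lt_min one_pos (ENNReal.toReal_pos hε.ne' hne), min_le_left _ _,
        ENNReal.ofReal_le_of_le_toReal (min_le_right _ _)⟩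
  have h1 := (hab x s hs0 hs1).1.trans
    (measure_mono ((Metric.eball_subset_eball hsε).trans hεU))
  rw [h0, nonpos_iff_eq_zero, ENNReal.ofReal_eq_zero] at h1
  exact h1.not_gt (by positivity)

variable [IsFiniteMeasure (μHE[n] : Measure M)]

lemma memLp_smooth (f : C^∞⟮𝓡 n, M; ℝ⟯) : MemLp f 2 (μHE[n] : Measure M) :=
  f.contMDiff.continuous.memLp_of_hasCompactSupport (HasCompactSupport.of_compactSpace _)

/-- The class in `L₂(M)` of a smooth function. -/
noncomputable def smoothToL2 : C^∞⟮𝓡 n, M; ℝ⟯ →ₗ[ℝ] RiemannianL2 n M where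
  toFun f := (memLp_smooth f).toLp f
  map_add' f g := MemLp.toLp_add (memLp_smooth f) (memLp_smooth g)
  map_smul' c f := MemLp.toLp_const_smul c (memLp_smooth f)

lemma coeFn_smoothToL2 (f : C^∞⟮𝓡 n, M; ℝ⟯) : (smoothToL2 f : M → ℝ) =ᵐ[μHE[n]] f :=
  (memLp_smooth f).coeFn_toLp

lemma inner_smoothToL2 (f g : C^∞⟮𝓡 n, M; ℝ⟯) :
    inner ℝ (smoothToL2 f) (smoothToL2 g) = ∫ x, f x * g x ∂(μHE[n] : Measure M) := by
  rw [L2.inner_def]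
  refine integral_congr_ae ?_
  filter_upwards [coeFn_smoothToL2 f, coeFn_smoothToL2 g] with x hf hg
  rw [hf, hg]
  exact mul_comm _ _

lemma norm_smoothToL2_sq (f : C^∞⟮𝓡 n, M; ℝ⟯) :
    ‖smoothToL2 f‖ ^ 2 = ∫ x, f x ^ 2 ∂(μHE[n] : Measure M) := by
  rw [← real_inner_self_eq_norm_sq, inner_smoothToL2]
  simp_rw [sq]

namespace IsSelfAdjointElliptic

variable {P : C^∞⟮𝓡 n, M; ℝ⟯ →ₗ[ℝ] C^∞⟮𝓡 n, M; ℝ⟯}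
  {L : RiemannianL2 n M →ₗ.[ℝ] RiemannianL2 n M}

lemma exists_apply_eq (h : IsSelfAdjointElliptic P L) (f : C^∞⟮𝓡 n, M; ℝ⟯) :
    ∃ u : L.domain, (u : RiemannianL2 n M) = smoothToL2 f ∧ L u = smoothToL2 (P f) := by
  have hmem : (smoothToL2 f, smoothToL2 (P f)) ∈ (L.graph : Set _) := by
    rw [h.graph_eq]
    exact subset_closure ⟨f, coeFn_smoothToL2 f, coeFn_smoothToL2 (P f)⟩
  exact (LinearPMap.mem_graph_iff L).1 hmem

/-- The smooth functions form a core: a closed relation between `u` and `L u` need only be checked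
for smooth `u`. -/
lemma forall_of_forall_smooth (h : IsSelfAdjointElliptic P L)
    {p : RiemannianL2 n M × RiemannianL2 n M → Prop} (hp : IsClosed {q | p q})
    (hs : ∀ f : C^∞⟮𝓡 n, M; ℝ⟯, p (smoothToL2 f, smoothToL2 (P f))) (u : L.domain) :
    p (u, L u) := by
  have hmem : ((u : RiemannianL2 n M), L u) ∈ (L.graph : Set _) := L.mem_graph u
  rw [h.graph_eq] at hmem
  refine closure_minimal ?_ hp hmem
  rintro ⟨q₁, q₂⟩ ⟨f, h1, h2⟩
  have e1 : q₁ = smoothToL2 f := Lp.ext (h1.trans (coeFn_smoothToL2 f).symm)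
  have e2 : q₂ = smoothToL2 (P f) := Lp.ext (h2.trans (coeFn_smoothToL2 (P f)).symm)
  rw [mem_ofPred_eq, e1, e2]
  exact hs f

lemma integral_apply_mul (h : IsSelfAdjointElliptic P L) (f g : C^∞⟮𝓡 n, M; ℝ⟯) :
    ∫ x, P f x * g x ∂(μHE[n] : Measure M) = ∫ x, f x * P g x ∂(μHE[n] : Measure M) := by
  obtain ⟨u, hu, hLu⟩ := h.exists_apply_eq f
  obtain ⟨v, hv, hLv⟩ := h.exists_apply_eq g
  have := inner_apply_of_isSelfAdjoint h.selfAdjoint u v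
  rwa [hu, hv, hLu, hLv, inner_smoothToL2, inner_smoothToL2] at this

lemma integral_apply_mul_self_nonneg (h : IsSelfAdjointElliptic P L)
    (h0 : HasLowestEigenvalueZero L) (f : C^∞⟮𝓡 n, M; ℝ⟯) :
    0 ≤ ∫ x, P f x * f x ∂(μHE[n] : Measure M) := by
  obtain ⟨u, hu, hLu⟩ := h.exists_apply_eq f
  have := h0.nonneg u
  rwa [hu, hLu, inner_smoothToL2] at this

/-- The quadratic form differs from the Dirichlet energy by a bounded zeroth-order term. -/
lemma exists_abs_integral_sub_le (h : IsSelfAdjointElliptic P L) :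
    ∃ K : ℝ, 0 ≤ K ∧ ∀ f : C^∞⟮𝓡 n, M; ℝ⟯,
      |∫ x, P f x * f x ∂(μHE[n] : Measure M) -
        ∫ x, carreDuChamp P f f x ∂(μHE[n] : Measure M)| ≤
          K * ∫ x, f x ^ 2 ∂(μHE[n] : Measure M) := by
  obtain ⟨K, hK⟩ := isCompact_univ.exists_bound_of_continuousOn
    (P 1).contMDiff.continuous.continuousOn
  refine ⟨max K 0, le_max_right _ _, fun f => ?_⟩
  have hsq : Integrable (fun x => f x ^ 2) (μHE[n] : Measure M) := integrable_smooth (f ^ 2)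
  rw [integral_mul_apply_eq h.integral_apply_mul f, add_sub_cancel_left, ← integral_const_mul,
    ← Real.norm_eq_abs]
  refine norm_integral_le_of_norm_le (hsq.const_mul _) (Filter.Eventually.of_forall fun x => ?_)
  rw [norm_mul, Real.norm_of_nonneg (sq_nonneg (f x))]
  gcongr
  exact (hK x (mem_univ x)).trans (le_max_left _ _)

variable [IsManifold (𝓡 n) ∞ M]

/-- Up to `O(k ^ n)` linear functionals, the quadratic form of `L` is bounded below by a multiple of
`k ^ 2`. -/
lemma exists_norm_sq_le (h : IsSelfAdjointElliptic P L) (h0 : HasLowestEigenvalueZero L)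
    [Nonempty M] (hM : ∀ x₀ : M, ∃ (C : ℝ≥0) (r : ℝ), IsBiLipschitzChart (n := n) x₀ C r) :
    ∃ (m : ℕ) (B K : ℝ), 0 < B ∧ 0 ≤ K ∧ ∀ k : ℕ, 0 < k → ∃ (ι : Type) (_ : Fintype ι)
      (v : ι → RiemannianL2 n M) (a : ι → ℝ), Fintype.card ι ≤ m * k ^ n ∧
        ∀ u : L.domain, ‖(u : RiemannianL2 n M)‖ ^ 2 ≤
          B / (k : ℝ) ^ 2 * (inner ℝ (L u) (u : RiemannianL2 n M) +
            K * ‖(u : RiemannianL2 n M)‖ ^ 2) +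
          ∑ j, a j * inner ℝ (v j) (u : RiemannianL2 n M) ^ 2 := by
  have := isOpenPosMeasure_of_isBiLipschitzChart hM
  have hΓ := carreDuChamp_self_nonneg h.elliptic.isDiffOp h.integral_apply_mul
    (h.integral_apply_mul_self_nonneg h0)
  obtain ⟨m, B, hB, hk⟩ := exists_integral_sq_le_energy_add_sum hM
    (Γ := fun u => carreDuChamp P u u) hΓ fun x₀ => by
      obtain ⟨r, lo, hi, hr, hlo, -, -, hb⟩ := h.elliptic.exists_carreDuChamp_bounds hΓ x₀
      exact ⟨r, lo, hr, hlo, fun u v hv => (hb u v hv).1⟩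
  obtain ⟨K, hK, hKf⟩ := h.exists_abs_integral_sub_le
  refine ⟨m, B, K, hB, hK, fun k hk0 => ?_⟩
  obtain ⟨ι, _, A, a, hcard, hAm, hA⟩ := hk k hk0
  refine ⟨ι, inferInstance, fun j => indicatorConstLp 2 (hAm j) (measure_ne_top _ _) (1 : ℝ), a,
    hcard, h.forall_of_forall_smooth
      (p := fun q => ‖q.1‖ ^ 2 ≤ B / (k : ℝ) ^ 2 * (inner ℝ q.2 q.1 + K * ‖q.1‖ ^ 2) +
        ∑ j, a j * inner ℝ (indicatorConstLp 2 (hAm j) (measure_ne_top _ _) (1 : ℝ)) q.1 ^ 2)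
      (isClosed_le (by fun_prop) (by fun_prop)) fun f => ?_⟩
  have hinner : ∀ j, inner ℝ (indicatorConstLp 2 (hAm j) (measure_ne_top _ _) (1 : ℝ))
      (smoothToL2 f) = ∫ x in A j, f x ∂(μHE[n] : Measure M) := fun j => by
    rw [L2.inner_indicatorConstLp_one]
    exact integral_congr_ae (ae_restrict_of_ae (coeFn_smoothToL2 f))
  simp only [hinner, norm_smoothToL2_sq, inner_smoothToL2]
  refine (hA f).trans ?_
  gcongr
  have := (abs_le.1 (hKf f)).1
  linarith

/-- There are subspaces of the domain, of dimension `k ^ n`, on which the quadratic form of `L` is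
`O(k ^ 2)`. -/
lemma exists_inner_sum_le (h : IsSelfAdjointElliptic P L) (h0 : HasLowestEigenvalueZero L)
    [Nonempty M] (hM : ∀ x₀ : M, ∃ (C : ℝ≥0) (r : ℝ), IsBiLipschitzChart (n := n) x₀ C r) :
    ∃ Λ K : ℝ, 0 < Λ ∧ 0 ≤ K ∧ ∀ k : ℕ, 0 < k → ∃ f : (Fin n → Fin k) → L.domain,
      ∀ c : (Fin n → Fin k) → ℝ, c ≠ 0 →
        0 < ‖((∑ j, c j • f j : L.domain) : RiemannianL2 n M)‖ ^ 2 ∧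
        inner ℝ (L (∑ j, c j • f j)) ((∑ j, c j • f j : L.domain) : RiemannianL2 n M) ≤
          (Λ * (k : ℝ) ^ 2 + K) * ‖((∑ j, c j • f j : L.domain) : RiemannianL2 n M)‖ ^ 2 := by
  have := isOpenPosMeasure_of_isBiLipschitzChart hM
  have hΓ := carreDuChamp_self_nonneg h.elliptic.isDiffOp h.integral_apply_mul
    (h.integral_apply_mul_self_nonneg h0)
  obtain ⟨Λ, hΛ, hk⟩ := exists_energy_sum_le hM h.elliptic.isDiffOp fun x₀ => by
      obtain ⟨r, lo, hi, hr, -, hhi, -, hb⟩ := h.elliptic.exists_carreDuChamp_bounds hΓ x₀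
      exact ⟨r, hi, hr, hhi, fun u v hv => (hb u v hv).2⟩
  obtain ⟨K, hK, hKf⟩ := h.exists_abs_integral_sub_le
  refine ⟨Λ, K, hΛ, hK, fun k hk0 => ?_⟩
  obtain ⟨f, hf⟩ := hk k hk0
  choose g hg hLg using fun j => h.exists_apply_eq (f j)
  refine ⟨g, fun c hc => ?_⟩
  obtain ⟨hpos, hle⟩ := hf c hc
  have hsum : ((∑ j, c j • g j : L.domain) : RiemannianL2 n M) = smoothToL2 (∑ j, c j • f j) := by
    rw [map_sum, Submodule.coe_sum]
    exact Finset.sum_congr rfl fun j _ => by rw [Submodule.coe_smul, hg, map_smul]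
  have hLsum : L (∑ j, c j • g j) = smoothToL2 (P (∑ j, c j • f j)) := by
    rw [map_sum, map_sum]
    change L.toFun _ = _
    rw [map_sum]
    exact Finset.sum_congr rfl fun j _ => by
      rw [map_smul, map_smul, map_smul, ← hLg]; rfl
  rw [hsum, hLsum, norm_smoothToL2_sq, inner_smoothToL2]
  refine ⟨hpos, ?_⟩
  have := (abs_le.1 (hKf (∑ j, c j • f j))).2
  rw [add_mul]
  linarith

end IsSelfAdjointElliptic

end QuadraticForm

/-! ### Weyl bounds and optimality of the number of nodes -/

section Weyl

open scoped NNReal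

lemma Real.sqrt_pow_eq_rpow {w : ℝ} (hw : 0 ≤ w) (n : ℕ) : √w ^ n = w ^ ((n : ℝ) / 2) := by
  rw [Real.sqrt_eq_rpow, ← Real.rpow_natCast, ← Real.rpow_mul hw]
  congr 1
  ring

lemma one_le_finrank_bandLimited {n : ℕ} {M : Type*} [EMetricSpace M] [MeasurableSpace M]
    [BorelSpace M] {L : RiemannianL2 n M →ₗ.[ℝ] RiemannianL2 n M} (h0 : HasLowestEigenvalueZero L)
    {w : ℝ} (hw : 0 ≤ w) [FiniteDimensional ℝ (bandLimited L w)] :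
    1 ≤ Module.finrank ℝ (bandLimited L w) := by
  obtain ⟨u, hu, hLu⟩ := h0.exists_ker
  have hmem : (u : RiemannianL2 n M) ∈ bandLimited L w :=
    Submodule.subset_span ⟨u, rfl, 0, hw, by rw [hLu, zero_smul]⟩
  have : Nontrivial (bandLimited L w) :=
    ⟨⟨⟨u, hmem⟩, 0, fun h => hu (congrArg Subtype.val h)⟩⟩
  exact Module.finrank_pos

variable {n : ℕ} {M : Type*} [EMetricSpace M] [ChartedSpace (EuclideanSpace ℝ (Fin n)) M]
  [CompactSpace M] [MeasurableSpace M] [BorelSpace M]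
  {P : C^∞⟮𝓡 n, M; ℝ⟯ →ₗ[ℝ] C^∞⟮𝓡 n, M; ℝ⟯} {L : RiemannianL2 n M →ₗ.[ℝ] RiemannianL2 n M}

variable [IsManifold (𝓡 n) ∞ M] [Nonempty M]

/-- Weyl's upper bound for the number of eigenvalues. -/
lemma IsSelfAdjointElliptic.exists_finrank_le (h : IsSelfAdjointElliptic P L)
    (h0 : HasLowestEigenvalueZero L)
    (hM : ∀ x₀ : M, ∃ (C : ℝ≥0) (r : ℝ), IsBiLipschitzChart (n := n) x₀ C r) {w₀ : ℝ}
    (hw₀ : 0 < w₀) :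
    ∃ D : ℝ, 0 < D ∧ ∀ w : ℝ, w₀ ≤ w → FiniteDimensional ℝ (bandLimited L w) ∧
      (Module.finrank ℝ (bandLimited L w) : ℝ) ≤ D * w ^ ((n : ℝ) / 2) := by
  have := isFiniteMeasure_of_isBiLipschitzChart hM
  obtain ⟨m, B, K, hB, hK, hk⟩ := h.exists_norm_sq_le h0 hM
  set E : ℝ := √(B * (1 + K / w₀)) + 1 / √w₀ with hE
  have hsw₀ : 0 < √w₀ := Real.sqrt_pos.2 hw₀
  have hE0 : 0 ≤ E := by positivity
  refine ⟨m * E ^ n + 1, by positivity, fun w hw => ?_⟩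
  have hw0 : 0 < w := hw₀.trans_le hw
  -- The least `k` with `B (w + K) < k ^ 2`, so that `finrank_eigenSpan_le` applies.
  set k : ℕ := ⌊√(B * (w + K))⌋₊ + 1 with hkdef
  have hklt : √(B * (w + K)) < k := by
    rw [hkdef]; exact_mod_cast Nat.lt_floor_add_one _
  have hk0 : (0 : ℝ) < k := (Real.sqrt_nonneg _).trans_lt hklt
  obtain ⟨ι, _, v, a, hcard, hle⟩ := hk k (Nat.succ_pos _)
  have hδ : B / (k : ℝ) ^ 2 * (w + K) < 1 := by
    rw [div_mul_eq_mul_div, div_lt_one (by positivity)]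
    exact (Real.sqrt_lt' hk0).1 hklt
  obtain ⟨hfd, hrank⟩ := finrank_eigenSpan_le (inner_apply_of_isSelfAdjoint h.selfAdjoint) a v
    (by positivity : 0 ≤ B / (k : ℝ) ^ 2) hδ hle
  refine ⟨hfd, ?_⟩
  have hkE : (k : ℝ) ≤ E * √w := by
    have h1 : (k : ℝ) ≤ √(B * (w + K)) + 1 := by
      rw [hkdef]; push_cast; linarith [Nat.floor_le (Real.sqrt_nonneg (B * (w + K)))]
    have h2 : √(B * (w + K)) ≤ √(B * (1 + K / w₀)) * √w := by
      rw [← Real.sqrt_mul (by positivity)]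
      refine Real.sqrt_le_sqrt ?_
      have h3 : K ≤ K / w₀ * w := by
        rw [div_mul_eq_mul_div, le_div_iff₀ hw₀]; gcongr
      nlinarith
    have h4 : 1 ≤ 1 / √w₀ * √w := by
      rw [one_div, inv_mul_eq_div, one_le_div hsw₀]; exact Real.sqrt_le_sqrt hw
    rw [hE, add_mul]; linarith
  have hfin : (Module.finrank ℝ (bandLimited L w) : ℝ) ≤ m * (k : ℝ) ^ n := by
    exact_mod_cast hrank.trans hcard
  rw [← Real.sqrt_pow_eq_rpow hw0.le]
  calc (Module.finrank ℝ (bandLimited L w) : ℝ) ≤ m * (k : ℝ) ^ n := hfin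
    _ ≤ m * (E * √w) ^ n := by gcongr
    _ = m * E ^ n * √w ^ n := by rw [mul_pow, mul_assoc]
    _ ≤ (m * E ^ n + 1) * √w ^ n := by gcongr; linarith

/-- Weyl's lower bound for the number of eigenvalues. For bounded `w` the kernel of `L` suffices. -/
lemma IsSelfAdjointElliptic.exists_le_finrank (h : IsSelfAdjointElliptic P L)
    (h0 : HasLowestEigenvalueZero L)
    (hM : ∀ x₀ : M, ∃ (C : ℝ≥0) (r : ℝ), IsBiLipschitzChart (n := n) x₀ C r) :
    ∃ d : ℝ, 0 < d ∧ ∀ w : ℝ, 0 < w → FiniteDimensional ℝ (bandLimited L w) →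
      d * w ^ ((n : ℝ) / 2) ≤ (Module.finrank ℝ (bandLimited L w) : ℝ) := by
  have := isFiniteMeasure_of_isBiLipschitzChart hM
  obtain ⟨m, B, K, hB, hK, hk⟩ := h.exists_norm_sq_le h0 hM
  have hcoer : ∀ Λ : ℝ, ∃ (ι : Type) (_ : Finite ι) (v : ι → RiemannianL2 n M), ∀ u : L.domain,
      (∀ j, inner ℝ (v j) (u : RiemannianL2 n M) = 0) →
        Λ * ‖(u : RiemannianL2 n M)‖ ^ 2 ≤ inner ℝ (L u) (u : RiemannianL2 n M) := by
    intro Λ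
    obtain ⟨k, hkΛ⟩ := exists_nat_gt (max 0 (B * (Λ + K)))
    have hk0 : (0 : ℝ) < k := (le_max_left _ _).trans_lt hkΛ
    obtain ⟨ι, _, v, a, -, hle⟩ := hk k (by exact_mod_cast hk0)
    refine ⟨ι, inferInstance, v, fun u hu => ?_⟩
    have h1 := hle u
    simp only [hu, zero_pow two_ne_zero, mul_zero, Finset.sum_const_zero, add_zero] at h1
    rw [div_mul_eq_mul_div, le_div_iff₀ (by positivity)] at h1
    have hk1 : (1 : ℝ) ≤ k := by exact_mod_cast hk0
    have h2 : B * (Λ + K) ≤ (k : ℝ) ^ 2 := by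
      nlinarith [(le_max_right 0 (B * (Λ + K))).trans hkΛ.le]
    have h3 : B * ((Λ + K) * ‖(u : RiemannianL2 n M)‖ ^ 2) ≤
        B * (inner ℝ (L u) (u : RiemannianL2 n M) + K * ‖(u : RiemannianL2 n M)‖ ^ 2) := by
      nlinarith [mul_le_mul_of_nonneg_right h2 (sq_nonneg ‖(u : RiemannianL2 n M)‖)]
    linarith [le_of_mul_le_mul_left h3 hB]
  obtain ⟨Λ, K', hΛ, hK', htrial⟩ := h.exists_inner_sum_le h0 hM
  -- For `w ≥ w₁` there is `k ≥ 1` comparable to `√w` with `Λ * k ^ 2 ≤ w / 4` and `K' < w / 4`.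
  set w₁ : ℝ := max (4 * Λ) (4 * K' + 1) with hw₁
  have hw₁0 : 0 < w₁ := lt_max_of_lt_left (by positivity)
  have hsw₁ : 0 < √w₁ := Real.sqrt_pos.2 hw₁0
  have hs4 : 0 < √(4 * Λ) := Real.sqrt_pos.2 (by positivity)
  refine ⟨min ((1 / (2 * √(4 * Λ))) ^ n) ((1 / √w₁) ^ n), by positivity, fun w hw hfd => ?_⟩
  rw [← Real.sqrt_pow_eq_rpow hw.le]
  rcases lt_or_ge w w₁ with hlt | hge
  · have h1 : (1 / √w₁ * √w) ^ n ≤ 1 := by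
      refine pow_le_one₀ (by positivity) ?_
      rw [one_div, inv_mul_eq_div, div_le_one hsw₁]
      exact Real.sqrt_le_sqrt hlt.le
    have h2 : (1 : ℝ) ≤ Module.finrank ℝ (bandLimited L w) := by
      exact_mod_cast one_le_finrank_bandLimited h0 hw.le
    calc _ ≤ (1 / √w₁) ^ n * √w ^ n := by gcongr; exact min_le_right _ _
      _ = (1 / √w₁ * √w) ^ n := (mul_pow _ _ _).symm
      _ ≤ _ := h1.trans h2
  · set x : ℝ := √w / √(4 * Λ) with hx
    have hx1 : 1 ≤ x := by
      rw [hx, one_le_div hs4]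
      exact Real.sqrt_le_sqrt ((le_max_left _ _).trans hge)
    set k : ℕ := ⌊x⌋₊ with hkdef
    have hkpos : 0 < k := Nat.floor_pos.2 hx1
    have hk1 : (1 : ℝ) ≤ k := by exact_mod_cast hkpos
    have hkx : (k : ℝ) ≤ x := Nat.floor_le (by positivity)
    have hxk : x < k + 1 := Nat.lt_floor_add_one x
    have hΛk : Λ * (k : ℝ) ^ 2 ≤ w / 4 := by
      have h1 : x ^ 2 = w / (4 * Λ) := by
        rw [hx, div_pow, Real.sq_sqrt hw.le, Real.sq_sqrt (by positivity)]
      have h2 : (k : ℝ) ^ 2 ≤ w / (4 * Λ) := h1 ▸ by gcongr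
      rw [le_div_iff₀ (by positivity)] at h2
      linarith
    have hKw : 4 * K' + 1 ≤ w := (le_max_right _ _).trans hge
    obtain ⟨f, hf⟩ := htrial k hkpos
    have : FiniteDimensional ℝ (eigenSpan L w) := hfd
    have hcard := card_le_finrank_eigenSpan h.selfAdjoint h0.nonneg hcoer hw.le f fun c hc => by
      obtain ⟨hpos, hle⟩ := hf c hc
      exact hle.trans_lt (mul_lt_mul_of_pos_right (by linarith) hpos)
    rw [Fintype.card_fun, Fintype.card_fin, Fintype.card_fin] at hcard
    have hcard' : (k : ℝ) ^ n ≤ Module.finrank ℝ (bandLimited L w) := by exact_mod_cast hcard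
    have hxle : 1 / (2 * √(4 * Λ)) * √w ≤ k := by
      have : 1 / (2 * √(4 * Λ)) * √w = x / 2 := by rw [hx]; field_simp
      rw [this]; linarith
    calc _ ≤ (1 / (2 * √(4 * Λ))) ^ n * √w ^ n := by gcongr; exact min_le_left _ _
      _ = (1 / (2 * √(4 * Λ)) * √w) ^ n := (mul_pow _ _ _).symm
      _ ≤ (k : ℝ) ^ n := by gcongr
      _ ≤ _ := hcard'

end Weyl

theorem mainTheorem10 (n : ℕ) {M : Type*} [EMetricSpace M] [CompactSpace M] [Nonempty M]
    [MeasurableSpace M] [BorelSpace M]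
    [ChartedSpace (EuclideanSpace ℝ (Fin n)) M] [IsManifold (𝓡 n) ∞ M]
    [RiemannianBundle (fun x : M => TangentSpace (𝓡 n) x)]
    [IsContMDiffRiemannianBundle (𝓡 n) ∞ (EuclideanSpace ℝ (Fin n))
      (fun x : M => TangentSpace (𝓡 n) x)]
    [IsRiemannianManifold (𝓡 n) M]
    (c₀ : ℝ) (hc₀ : 0 < c₀) (w₀ : ℝ) (hw₀ : 0 < w₀) :
    (∃ a₁ a₂ : ℝ, 0 < a₁ ∧ 0 < a₂ ∧
      ∀ w : ℝ, w₀ ≤ w → ∀ (N : ℕ) (S : Set M),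
        IsMetricLattice N (c₀ * w ^ (-(1 / 2) : ℝ)) S →
          S.Finite ∧
          a₁ * w ^ ((n : ℝ) / 2) ≤ (S.ncard : ℝ) ∧
          (S.ncard : ℝ) ≤ a₂ * w ^ ((n : ℝ) / 2)) ∧
    (∀ (P : C^∞⟮𝓡 n, M; ℝ⟯ →ₗ[ℝ] C^∞⟮𝓡 n, M; ℝ⟯)
        (L : RiemannianL2 n M →ₗ.[ℝ] RiemannianL2 n M),
      IsSelfAdjointElliptic P L → HasLowestEigenvalueZero L →
      ∃ b₁ b₂ : ℝ, 0 < b₁ ∧ 0 < b₂ ∧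
        ∀ w : ℝ, w₀ ≤ w → ∀ (N : ℕ) (S : Set M),
          IsMetricLattice N (c₀ * w ^ (-(1 / 2) : ℝ)) S →
            FiniteDimensional ℝ (bandLimited L w) ∧
            b₁ * (Module.finrank ℝ (bandLimited L w) : ℝ) ≤ (S.ncard : ℝ) ∧
            (S.ncard : ℝ) ≤ b₂ * (Module.finrank ℝ (bandLimited L w) : ℝ)) := by
  have hM : ∀ x₀ : M, ∃ (C : NNReal) (r : ℝ), IsBiLipschitzChart (n := n) x₀ C r :=
    exists_isBiLipschitzChart
  obtain ⟨a₁, a₂, ha₁, ha₂, ha⟩ := exists_ncard_bounds hM hc₀ hw₀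
  refine ⟨⟨a₁, a₂, ha₁, ha₂, ha⟩, fun P L h h0 => ?_⟩
  obtain ⟨D, hD, hupper⟩ := h.exists_finrank_le h0 hM hw₀
  obtain ⟨d, hd, hlower⟩ := h.exists_le_finrank h0 hM
  refine ⟨a₁ / D, a₂ / d, by positivity, by positivity, fun w hw N S hS => ?_⟩
  obtain ⟨-, hS₁, hS₂⟩ := ha w hw N S hS
  obtain ⟨hfd, hle⟩ := hupper w hw
  have hge := hlower w (hw₀.trans_le hw) hfd
  refine ⟨hfd, le_trans ?_ hS₁, hS₂.trans ?_⟩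
  · rw [div_mul_eq_mul_div, div_le_iff₀ hD, mul_assoc, mul_comm _ D]
    gcongr
  · rw [div_mul_eq_mul_div, le_div_iff₀ hd, mul_assoc, mul_comm _ d]
    gcongr
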